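/- **Setting.** Let $k\in\{4,5\}$ and let $\Omega\subset\mathbb R^2=\mathbb C$ be a smooth bounded domain (open, connected) with $0\in\Omega$, invariant under $x\mapsto\overline x$ and under the rotation $x\mapsto e^{2\pi\mathrm i/k}x$; $x^k$ denotes the complex power. *Projection and Robin constant.* For a $C^2$ function $\varphi$ on $\mathbb R^2$, $\mathrm P\varphi$ is the solution of $-\Delta(\mathrm P\varphi)=-\Delta\varphi$ in $\Omega$, $\mathrm P\varphi=0$ on $\partial\Omega$. $H(\cdot,0)$ is the harmonic function in $\Omega$ with $H(x,0)=\frac1{2\pi}\log|x|$ on $\partial\Omega$. *Profiles.* Let $U(x)=\log\frac8{(|x|^2+1)^2}$, $f_1(u)=\frac{u^2}2$, $f_2(u,v)=uv-\frac{u^3}3-\frac12\left(v-\frac{u^2}2\right)^2$. Let $V,W$ be the radial entire solutions of $$\Delta V+e^UV=e^Uf_1(U),\qquad \Delta W+e^UW=e^Uf_2(U,V)\qquad\text{in }\mathbb R^2$$ with $V(x)=\mathcal C_1\log|x|+O(1/|x|)$ and $W(x)=\mathcal C_2\log|x|+O(1/|x|)$ as $|x|\to\infty$, where $$\mathcal C_1=\int_0^\infty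 r\tfrac{r^2-1}{r^2+1}e^{U(r)}f_1(U(r))\,dr,\qquad \mathcal C_2=\int_0^\infty r\tfrac{r^2-1}{r^2+1}e^{U(r)}f_2(U(r),V(r))\,dr .$$ *Ansatz.* For $p>1$ and $\alpha,\beta,\rho,\tau,\eta>0$ put $$U_1(x)=\log\tfrac{8\alpha^2}{(|x|^2+\alpha^2)^2},\quad V_1(x)=V\left(\tfrac x\alpha\right),\quad W_1(x)=W\left(\tfrac x\alpha\right),$$ $$U_2(x)=\log\tfrac{8k^2\beta^{2k}}{(|x^k-\rho^k|^2+\beta^{2k})^2},\quad V_2(x)=V\left(\tfrac{x^k-\rho^k}{\beta^k}\right),\quad W_2(x)=W\left(\tfrac{x^k-\rho^k}{\beta^k}\right),$$ $$\Upsilon=\tau\left(\mathrm PU_1+\frac{\mathrm PV_1}p+\frac{\mathrm PW_1}{p^2}\right)-\tau\eta\left(\mathrm PU_2+\frac{\mathrm PV_2}p+\frac{\mathrm PW_2}{p^2}\right),\qquad \mathscr E=\Delta\Upsilon+|\Upsilon|^{p-1}\Upsilon .$$ *Relations between the parameters.* With $M_p=4-\frac{\mathcal C_1}p-\frac{\mathcal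 C_2}{p^2}$, $$\left\{\begin{array}{l}\dfrac\tau{\alpha^2}=(p\tau)^p,\qquad \tau\eta\,\dfrac{k^2\rho^{2k-2}}{\beta^{2k}}=(p\tau\eta)^p,\\[2mm] M_p\log\dfrac{\rho^{k\eta}}\alpha-\log8-2(k\eta-1)\pi M_pH(0,0)=p,\\[2mm] M_p\log\dfrac{\rho^{1/\eta}}{\beta^k}-\log8+2\left(k-\dfrac1\eta\right)\pi M_pH(0,0)=p.\end{array}\right.\tag{param}$$ *Norm.* For $\delta\in(0,1)$, $$\|h\|_*=\sup_{x\in\Omega}\left|\frac{h(x)}{\frac{\alpha^{2\delta}}{(|x|^2+\alpha^2)^{1+\delta}}+\frac{\beta^{2k\delta}|x|^{2k-2}}{(|x^k-\rho^k|^2+\beta^{2k})^{1+\delta}}}\right| .$$ **Proposition 3.1.** For $k\in\{4,5\}$ there is $\epsilon>0$, depending only on $k$, such that for every $\Omega$ as above there are $C>0$, $\delta\in(0,1)$ and $p_0>1$ such that, for all $p>p_0$, all $\eta$ with $\left|\eta-\frac2{k-1}\right|\le\epsilon$, and all positive $\alpha,\beta,\rho,\tau$ satisfying (param), $$\|\mathscr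 E\|_*\le\frac C{p^4}.$$ -/

import Mathlib

open scoped Topology Laplacian ContDiff ENNReal ComplexConjugate

noncomputable section

namespace LaneEmden

/- The plane `ℝ²` is `ℂ` with its Euclidean norm, so that `x ^ k` is the complex power, a positive
real number is identified with a point of the real half-line, and `Δ` is the Laplacian of the
real inner product space `ℂ`. -/

/-! ### Domains -/

/-- A smooth bounded domain of the plane: open, connected, nonempty, bounded, and near each boundary
point equal to the sublevel set `{f < 0}` of a smooth function with non-vanishing differential. -/
structure IsSmoothBoundedDomain (Ω : Set ℂ) : Prop where
  isOpen : IsOpen Ω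
  isConnected : IsConnected Ω
  isBounded : Bornology.IsBounded Ω
  smooth_boundary : ∀ x ∈ frontier Ω, ∃ N ∈ 𝓝 x, ∃ f : ℂ → ℝ,
    ContDiff ℝ ∞ f ∧ fderiv ℝ f x ≠ 0 ∧ ∀ y ∈ N, (y ∈ Ω ↔ f y < 0)

/-- Invariance under reflection across the first axis. -/
def ReflectionInvariant (Ω : Set ℂ) : Prop :=
  ∀ x : ℂ, x ∈ Ω ↔ conj x ∈ Ω

/-- Invariance under the rotation of angle `2π / k` about the origin. -/
def RotationInvariant (k : ℕ) (Ω : Set ℂ) : Prop :=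
  ∀ x : ℂ, x ∈ Ω ↔ Complex.exp ((2 * Real.pi / k : ℝ) * Complex.I) * x ∈ Ω

/-! ### The Dirichlet projection and the regular part of the Green function -/

/-- `u` is a (classical) solution of `-Δ u = -Δ φ` in `Ω`, `u = 0` on `∂Ω`. -/
structure IsDirichletProjection (Ω : Set ℂ) (φ u : ℂ → ℝ) : Prop where
  contDiffOn : ContDiffOn ℝ 2 u Ω
  continuousOn : ContinuousOn u (closure Ω)
  laplacian_eq : ∀ x ∈ Ω, -(Δ u x) = -(Δ φ x)
  boundary : ∀ x ∈ frontier Ω, u x = 0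

/-- The projection `P φ` of `φ`: the solution of `-Δ (P φ) = -Δ φ` in `Ω`, `P φ = 0` on `∂Ω`
(on the closure of a bounded domain it is unique, by the maximum principle). -/
def proj (Ω : Set ℂ) (φ : ℂ → ℝ) : ℂ → ℝ :=
  Classical.epsilon (IsDirichletProjection Ω φ)

/-- `h` is the regular part at `y` of the Green function of `-Δ` on `Ω` with Dirichlet conditions:
it is harmonic in `Ω`, with boundary values `(1 / 2π) log |x - y|`. The Green function is then
`G(x, y) = -(1 / 2π) log |x - y| + h x`. -/
structure IsGreenRegularPart (Ω : Set ℂ) (y : ℂ) (h : ℂ → ℝ) : Prop where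
  harmonic : InnerProductSpace.HarmonicOnNhd h Ω
  continuousOn : ContinuousOn h (closure Ω)
  boundary : ∀ x ∈ frontier Ω, h x = 1 / (2 * Real.pi) * Real.log ‖x - y‖

/-- The regular part `H(x, y)` of the Green function. -/
def greenRegularPart (Ω : Set ℂ) (x y : ℂ) : ℝ :=
  Classical.epsilon (IsGreenRegularPart Ω y) x

/-! ### The bubble and the correction profiles on the whole plane -/

/-- The standard bubble `U`. -/
def bubble (x : ℂ) : ℝ := Real.log (8 / (‖x‖ ^ 2 + 1) ^ 2)

/-- `f₁(u) = u² / 2`. -/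
def f₁ (u : ℝ) : ℝ := u ^ 2 / 2

/-- `f₂(u, v) = u v - u³ / 3 - (v - u² / 2)² / 2`. -/
def f₂ (u v : ℝ) : ℝ := u * v - u ^ 3 / 3 - 1 / 2 * (v - u ^ 2 / 2) ^ 2

/-- `∫₀^∞ r (r² - 1) / (r² + 1) e^{U(r)} g(r) dr`. -/
def logCoeff (g : ℂ → ℝ) : ℝ :=
  ∫ r in Set.Ioi (0 : ℝ),
    r * ((r ^ 2 - 1) / (r ^ 2 + 1)) * Real.exp (bubble (r : ℂ)) * g (r : ℂ)

/-- `Φ` is a radial entire solution of `Δ Φ + e^U Φ = e^U g` with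
`Φ(x) = 𝒞 log |x| + O(1 / |x|)` at infinity, where `𝒞 = logCoeff g`. -/
structure IsProfile (g Φ : ℂ → ℝ) : Prop where
  contDiff : ContDiff ℝ 2 Φ
  radial : ∀ x y : ℂ, ‖x‖ = ‖y‖ → Φ x = Φ y
  equation : ∀ x : ℂ, Δ Φ x + Real.exp (bubble x) * Φ x = Real.exp (bubble x) * g x
  asymptotic : (fun x : ℂ => Φ x - logCoeff g * Real.log ‖x‖)
    =O[Bornology.cobounded ℂ] (fun x : ℂ => ‖x‖⁻¹)

/-- The profile of right-hand side `e^U g`. It is unique: the radial solutions of the homogeneous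
equation are the multiples of `(|x|² - 1) / (|x|² + 1)`, which tends to `1` at infinity. -/
def profile (g : ℂ → ℝ) : ℂ → ℝ := Classical.epsilon (IsProfile g)

/-- The right-hand side `f₁(U)` of the equation of `V`. -/
def rhsV (x : ℂ) : ℝ := f₁ (bubble x)

/-- The second order profile `V`. -/
def V : ℂ → ℝ := profile rhsV

/-- The right-hand side `f₂(U, V)` of the equation of `W`. -/
def rhsW (x : ℂ) : ℝ := f₂ (bubble x) (V x)

/-- The third order profile `W`. -/
def W : ℂ → ℝ := profile rhsW

/-- The constant `𝒞₁`, the logarithmic coefficient of `V`. -/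
def C₁ : ℝ := logCoeff rhsV

/-- The constant `𝒞₂`, the logarithmic coefficient of `W`. -/
def C₂ : ℝ := logCoeff rhsW

/-! ### The ansatz -/

def U₁ (α : ℝ) (x : ℂ) : ℝ := Real.log (8 * α ^ 2 / (‖x‖ ^ 2 + α ^ 2) ^ 2)

def V₁ (α : ℝ) (x : ℂ) : ℝ := V (x / α)

def W₁ (α : ℝ) (x : ℂ) : ℝ := W (x / α)

def U₂ (k : ℕ) (β ρ : ℝ) (x : ℂ) : ℝ :=
  Real.log (8 * k ^ 2 * β ^ (2 * k) / (‖x ^ k - (ρ : ℂ) ^ k‖ ^ 2 + β ^ (2 * k)) ^ 2)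

def V₂ (k : ℕ) (β ρ : ℝ) (x : ℂ) : ℝ := V ((x ^ k - (ρ : ℂ) ^ k) / (β : ℂ) ^ k)

def W₂ (k : ℕ) (β ρ : ℝ) (x : ℂ) : ℝ := W ((x ^ k - (ρ : ℂ) ^ k) / (β : ℂ) ^ k)

/-- The ansatz
`Υ = τ (P U₁ + P V₁ / p + P W₁ / p²) - τ η (P U₂ + P V₂ / p + P W₂ / p²)`. -/
def ansatz (Ω : Set ℂ) (k : ℕ) (p η τ α β ρ : ℝ) (x : ℂ) : ℝ :=
  τ * (proj Ω (U₁ α) x + proj Ω (V₁ α) x / p + proj Ω (W₁ α) x / p ^ 2)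
    - τ * η * (proj Ω (U₂ k β ρ) x + proj Ω (V₂ k β ρ) x / p + proj Ω (W₂ k β ρ) x / p ^ 2)

/-- The error `Δ Υ + |Υ|^{p-1} Υ`. -/
def error (Ω : Set ℂ) (k : ℕ) (p η τ α β ρ : ℝ) (x : ℂ) : ℝ :=
  Δ (ansatz Ω k p η τ α β ρ) x
    + |ansatz Ω k p η τ α β ρ x| ^ (p - 1) * ansatz Ω k p η τ α β ρ x

/-! ### The parameters -/

/-- The factor `4 - 𝒞₁ / p - 𝒞₂ / p²`. -/
def coeffM (p : ℝ) : ℝ := 4 - C₁ / p - C₂ / p ^ 2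

/-- The four relations between the five positive parameters. The last two say that
`Υ(α y) = τ p (1 + U(y) / p + V(y) / p² + W(y) / p³ + …)` near the positive peak and that the
analogous expansion, with factor `-τ η p`, holds near the negative ones. -/
structure ParamRelations (Ω : Set ℂ) (k : ℕ) (p η τ α β ρ : ℝ) : Prop where
  η_pos : 0 < η
  τ_pos : 0 < τ
  α_pos : 0 < α
  β_pos : 0 < β
  ρ_pos : 0 < ρ
  rel₁ : τ / α ^ 2 = (p * τ) ^ p
  rel₂ : τ * η * ((k : ℝ) ^ 2 * ρ ^ (2 * k - 2) / β ^ (2 * k)) = (p * τ * η) ^ p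
  rel₃ : coeffM p * Real.log (ρ ^ (k * η) / α) - Real.log 8
    - 2 * (k * η - 1) * Real.pi * coeffM p * greenRegularPart Ω 0 0 = p
  rel₄ : coeffM p * Real.log (ρ ^ (1 / η) / β ^ k) - Real.log 8
    + 2 * (k - 1 / η) * Real.pi * coeffM p * greenRegularPart Ω 0 0 = p

/-! ### The weighted norm -/

/-- The weight
`α^{2δ} / (|x|² + α²)^{1+δ} + β^{2kδ} |x|^{2k-2} / (|x^k - ρ^k|² + β^{2k})^{1+δ}`. -/
def weight (k : ℕ) (δ α β ρ : ℝ) (x : ℂ) : ℝ :=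
  α ^ (2 * δ) / (‖x‖ ^ 2 + α ^ 2) ^ (1 + δ)
    + β ^ (2 * k * δ) * ‖x‖ ^ (2 * k - 2)
      / (‖x ^ k - (ρ : ℂ) ^ k‖ ^ 2 + β ^ (2 * k)) ^ (1 + δ)

/-- The weighted norm `sup_{x ∈ Ω} |h(x) / weight(x)|`, with values in `[0, ∞]`. -/
def starNorm (Ω : Set ℂ) (k : ℕ) (δ α β ρ : ℝ) (h : ℂ → ℝ) : ℝ≥0∞ :=
  ⨆ x ∈ Ω, ENNReal.ofReal |h x / weight k δ α β ρ x|

end LaneEmden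

end

/-!
The ansatz is a sum of one bubble at the origin and of bubbles at the `k` points `x ^ k = ρ ^ k`,
the latter with the factor `-η`. The error is estimated region by region.

*The projections.* The Dirichlet problem is solved by Perron's method, with logarithmic barriers at
the boundary (`exists_harmonic_extension`), so that the projections and the regular part of the
Green function are genuine solutions. By the maximum principle the projection of a rescaled profile
is the profile plus a multiple of the regular part, up to a constant and a small uniform error
(`exists_ansatz_bound`), and the Laplacian of the ansatz is explicit (`laplacian_ansatz`). The
profiles are obtained from the radial equation in the variable `‖x‖²` by variation of parameters
(`exists_profile`), with their growth at infinity (`exists_profile_bounds`).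

*The parameters.* The four relations force `α`, `β ^ k` and `ρ` to decay exponentially in `p`, with
rates that are explicit functions of `η` (`exists_param_bounds`). At `η = 2 / (k - 1)` with
`k = 4, 5` these rates satisfy strict inequalities, which persist for nearby `η`
(`exists_admissibleRatio`). They say that the peaks are well separated and that the power of the
ansatz is smaller than the weight at the distance `ρ` from the origin; for `k = 5` the last one
holds with little room, `(2 / 3) log 2 · exp (1 / 2 + (log 2) / 3) ≈ 0.96 < 1`.

*Near a peak*, the relations turn the ansatz into a constant multiple of
`1 + (U + V / p + W / p² + e) / p` in the rescaled variable (`exists_ansatz_bound_origin`,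
`exists_ansatz_bound_circle`), where `e` is exponentially small at a bounded distance. The equations
of `V` and `W` are exactly such that the `p`-th power of this expression agrees with the Laplacian
to the order `p⁻³` (`abs_power_sub_expansion_le`); far from the peak, where the expansion fails,
both terms are exponentially smaller than the weight (`exists_bubble_error`). As the multiple `τ` is
`O(1 / p)`, the error is `O(p⁻⁴)` in the weighted norm.

*Away from all peaks*, the ansatz is at most `τ` times a multiple of `1 + |log ‖x‖|`, and its power
is exponentially smaller than the weight (`exists_error_bound_far`).
-/

open scoped Topology Laplacian ContDiff ENNReal ComplexConjugate

noncomputable section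

namespace LaneEmden

open Metric Set Filter InnerProductSpace Bornology

/-! ### The maximum principle and the Poisson integral -/

/-- `v` satisfies the sub-mean value inequality on all small circles about each point of `U`. For
continuous functions this is subharmonicity; being local, it is stable under pasting. -/
def LocalSubmean (v : ℂ → ℝ) (U : Set ℂ) : Prop :=
  ∀ x ∈ U, ∃ r₀ > 0, ∀ r, 0 < r → r < r₀ → v x ≤ Real.circleAverage v x r

lemma exists_closedBall_subset_of_lt {U : Set ℂ} (hU : IsOpen U) {x : ℂ} (hx : x ∈ U) :
    ∃ r₀ > 0, ∀ r, r < r₀ → closedBall x r ⊆ U := by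
  obtain ⟨e, he, h⟩ := Metric.isOpen_iff.1 hU x hx
  exact ⟨e, he, fun r hr => (closedBall_subset_ball hr).trans h⟩

lemma circleIntegrable_of_closedBall {v : ℂ → ℝ} {x : ℂ} {r : ℝ} (hr : 0 ≤ r)
    (h : ContinuousOn v (closedBall x r)) : CircleIntegrable v x r :=
  (h.mono sphere_subset_closedBall).circleIntegrable hr

lemma harmonicOnNhd_re_affine (a b : ℂ) (s : Set ℂ) :
    HarmonicOnNhd (fun z : ℂ => (a + b * z).re) s := fun x _ =>
  AnalyticAt.harmonicAt_re (f := fun z : ℂ => a + b * z) (by fun_prop)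

lemma circleAverage_norm_sq (c : ℂ) {r : ℝ} (hr : 0 ≤ r) :
    Real.circleAverage (fun z : ℂ => ‖z‖ ^ 2) c r = ‖c‖ ^ 2 + r ^ 2 := by
  have h1 : Real.circleAverage (fun z : ℂ => ‖z‖ ^ 2) c r =
      Real.circleAverage (fun z : ℂ => (((r ^ 2 - ‖c‖ ^ 2 : ℝ) : ℂ) + 2 * conj c * z).re) c r := by
    apply Real.circleAverage_congr_sphere
    intro z hz
    rw [abs_of_nonneg hr, mem_sphere, dist_eq_norm] at hz
    have e : r ^ 2 = ‖z - c‖ ^ 2 := by rw [hz]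
    simp only [e, Complex.sq_norm, Complex.normSq_apply]
    simp
    ring
  rw [h1, InnerProductSpace.HarmonicOnNhd.circleAverage_eq (harmonicOnNhd_re_affine _ _ _)]
  simp only [Complex.add_re, Complex.ofReal_re, Complex.sq_norm, Complex.normSq_apply]
  simp
  ring

theorem LocalSubmean.le_of_frontier {U : Set ℂ} (hU : IsOpen U) (hb : IsBounded U) {v : ℂ → ℝ}
    (hc : ContinuousOn v (closure U)) (hs : LocalSubmean v U) {M : ℝ}
    (hM : ∀ x ∈ frontier U, v x ≤ M) : ∀ x ∈ closure U, v x ≤ M := by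
  intro x₁ hx₁
  by_contra! hlt
  obtain ⟨D, hD⟩ := hb.closure.exists_norm_le
  -- A small multiple of `‖x‖²` makes the sub-mean value inequality strict.
  set ε : ℝ := (v x₁ - M) / (2 * (D ^ 2 + 1)) with hε
  have hD1 : (0 : ℝ) < 2 * (D ^ 2 + 1) := by positivity
  have hε0 : 0 < ε := div_pos (by linarith) hD1
  have hεD : ε * (2 * (D ^ 2 + 1)) = v x₁ - M := by rw [hε]; field_simp
  have hsq : ∀ x ∈ closure U, ‖x‖ ^ 2 ≤ D ^ 2 := fun x hx =>
    pow_le_pow_left₀ (norm_nonneg _) (hD x hx) 2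
  have hcw : ContinuousOn (fun x => v x + ε * ‖x‖ ^ 2) (closure U) := by fun_prop
  obtain ⟨x₂, hx₂, hmax⟩ := hb.isCompact_closure.exists_isMaxOn ⟨x₁, hx₁⟩ hcw
  have h12 := hmax hx₁
  simp only [mem_ofPred_eq] at h12
  have hx₂U : x₂ ∈ U := by
    by_contra hn
    have : x₂ ∈ frontier U := ⟨hx₂, by rwa [hU.interior_eq]⟩
    have h1 := hM x₂ this
    have h2 := mul_le_mul_of_nonneg_left (hsq x₂ hx₂) hε0.le
    have h3 : 0 ≤ ε * ‖x₁‖ ^ 2 := by positivity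
    nlinarith
  obtain ⟨r₁, hr₁, hv⟩ := hs x₂ hx₂U
  obtain ⟨r₂, hr₂, hball⟩ := exists_closedBall_subset_of_lt hU hx₂U
  set r := min r₁ r₂ / 2 with hr
  have hr0 : 0 < r := by positivity
  have hrr : r < min r₁ r₂ := by rw [hr]; linarith [lt_min hr₁ hr₂]
  have hrr1 := hrr.trans_le (min_le_left _ _)
  have hrr2 := hrr.trans_le (min_le_right _ _)
  have hsub := (hball r hrr2).trans subset_closure
  have i1 : CircleIntegrable v x₂ r := circleIntegrable_of_closedBall hr0.le (hc.mono hsub)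
  have i2 : CircleIntegrable (fun x : ℂ => ε • ‖x‖ ^ 2) x₂ r :=
    circleIntegrable_of_closedBall hr0.le (by fun_prop)
  have havg : Real.circleAverage (fun x => v x + ε • ‖x‖ ^ 2) x₂ r ≤ v x₂ + ε * ‖x₂‖ ^ 2 := by
    apply Real.circleAverage_mono_on_of_le_circle (i1.add i2)
    intro x hx
    rw [abs_of_pos hr0] at hx
    exact hmax (hsub (sphere_subset_closedBall hx))
  rw [Real.circleAverage_fun_add i1 i2, Real.circleAverage_fun_smul,
    circleAverage_norm_sq _ hr0.le, smul_eq_mul] at havg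
  have := hv r hr0 hrr1
  have : 0 < ε * r ^ 2 := by positivity
  nlinarith

lemma LocalSubmean.sub_harmonic {U : Set ℂ} (hU : IsOpen U) {v h : ℂ → ℝ}
    (hc : ContinuousOn v U) (hs : LocalSubmean v U) (hh : HarmonicOnNhd h U) :
    LocalSubmean (fun x => v x - h x) U := by
  intro x hx
  obtain ⟨r₁, hr₁, hv⟩ := hs x hx
  obtain ⟨r₂, hr₂, hball⟩ := exists_closedBall_subset_of_lt hU hx
  refine ⟨min r₁ r₂, lt_min hr₁ hr₂, fun r hr0 hr => ?_⟩
  have hsub := hball r (hr.trans_le (min_le_right _ _))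
  rw [Real.circleAverage_fun_sub (circleIntegrable_of_closedBall hr0.le (hc.mono hsub))
    (circleIntegrable_of_closedBall hr0.le (hh.contDiffOn.continuousOn.mono hsub)),
    InnerProductSpace.HarmonicOnNhd.circleAverage_eq (hh.mono (by rwa [abs_of_pos hr0]))]
  linarith [hv r hr0 (hr.trans_le (min_le_left _ _))]

lemma localSubmean_of_harmonic {U : Set ℂ} (hU : IsOpen U) {h : ℂ → ℝ}
    (hh : HarmonicOnNhd h U) : LocalSubmean h U := by
  intro x hx
  obtain ⟨r₂, hr₂, hball⟩ := exists_closedBall_subset_of_lt hU hx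
  refine ⟨r₂, hr₂, fun r hr0 hr => ?_⟩
  rw [InnerProductSpace.HarmonicOnNhd.circleAverage_eq
    (hh.mono (by rw [abs_of_pos hr0]; exact hball r hr))]

theorem LocalSubmean.le_harmonic {U : Set ℂ} (hU : IsOpen U) (hb : IsBounded U) {v h : ℂ → ℝ}
    (hc : ContinuousOn v (closure U)) (hs : LocalSubmean v U) (hh : HarmonicOnNhd h U)
    (hhc : ContinuousOn h (closure U)) (hM : ∀ x ∈ frontier U, v x ≤ h x) :
    ∀ x ∈ closure U, v x ≤ h x := by
  intro x hx
  have := (hs.sub_harmonic hU (hc.mono subset_closure) hh).le_of_frontier hU hb (hc.fun_sub hhc)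
    (M := 0) (fun x hx => by linarith [hM x hx]) x hx
  linarith

/-- The maximum principle for two harmonic functions, in the form of an error estimate. -/
theorem abs_sub_le_of_frontier {U : Set ℂ} (hU : IsOpen U) (hb : IsBounded U) {u h : ℂ → ℝ}
    (hu : HarmonicOnNhd u U) (huc : ContinuousOn u (closure U)) (hh : HarmonicOnNhd h U)
    (hhc : ContinuousOn h (closure U)) {M : ℝ} (hM : ∀ x ∈ frontier U, |u x - h x| ≤ M) :
    ∀ x ∈ closure U, |u x - h x| ≤ M := by
  intro x hx
  rw [abs_le]
  constructor
  · have := ((localSubmean_of_harmonic hU hh).sub_harmonic hU (hhc.mono subset_closure)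
      hu).le_of_frontier hU hb (hhc.fun_sub huc) (M := M)
      (fun x hx => by linarith [(abs_le.1 (hM x hx)).1]) x hx
    linarith
  · exact ((localSubmean_of_harmonic hU hu).sub_harmonic hU (huc.mono subset_closure)
      hh).le_of_frontier hU hb (huc.fun_sub hhc) (M := M)
      (fun x hx => (abs_le.1 (hM x hx)).2) x hx

/-- The Poisson integral over the circle of centre `c` and radius `R`. -/
def poissonInt (f : ℂ → ℝ) (c : ℂ) (R : ℝ) (w : ℂ) : ℝ :=
  Real.circleAverage (poissonKernel c w • f) c R

lemma continuousOn_poissonKernel {c w : ℂ} {R : ℝ} (hw : w ∈ ball c R) :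
    ContinuousOn (poissonKernel c w) (sphere c R) := by
  have : ∀ z ∈ sphere c R, ‖(z - c) - (w - c)‖ ^ 2 ≠ 0 := by
    intro z hz h
    have : z = w := by
      rw [pow_eq_zero_iff two_ne_zero, norm_eq_zero] at h
      linear_combination h
    subst this
    rw [mem_sphere] at hz
    rw [mem_ball] at hw
    linarith
  unfold poissonKernel
  fun_prop (disch := assumption)

lemma circleIntegrable_poissonKernel_smul {f : ℂ → ℝ} {c w : ℂ} {R : ℝ} (hw : w ∈ ball c R)
    (hf : ContinuousOn f (sphere c R)) : CircleIntegrable (poissonKernel c w • f) c R :=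
  ((continuousOn_poissonKernel hw).smul hf).circleIntegrable (pos_of_mem_ball hw).le

lemma poissonKernel_nonneg {c w z : ℂ} {R : ℝ} (hw : w ∈ ball c R) (hz : z ∈ sphere c R) :
    0 ≤ poissonKernel c w z := by
  rw [mem_ball, dist_eq_norm] at hw
  rw [mem_sphere, dist_eq_norm] at hz
  rw [poissonKernel_def, hz]
  have := pow_le_pow_left₀ (norm_nonneg _) hw.le 2
  exact div_nonneg (by linarith) (by positivity)

lemma poissonInt_mono {f g : ℂ → ℝ} {c w : ℂ} {R : ℝ} (hw : w ∈ ball c R)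
    (hf : ContinuousOn f (sphere c R)) (hg : ContinuousOn g (sphere c R))
    (h : ∀ z ∈ sphere c R, f z ≤ g z) : poissonInt f c R w ≤ poissonInt g c R w := by
  apply Real.circleAverage_mono (circleIntegrable_poissonKernel_smul hw hf)
    (circleIntegrable_poissonKernel_smul hw hg)
  intro z hz
  rw [abs_of_pos (pos_of_mem_ball hw)] at hz
  exact mul_le_mul_of_nonneg_left (h z hz) (poissonKernel_nonneg hw hz)

lemma poissonInt_harmonic_eq {f : ℂ → ℝ} {c w : ℂ} {R : ℝ} (hw : w ∈ ball c R)
    (hf : HarmonicOnNhd f (closedBall c R)) : poissonInt f c R w = f w :=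
  hf.circleAverage_poissonKernel_smul hw

lemma poissonInt_const {c w : ℂ} {R : ℝ} (hw : w ∈ ball c R) (a : ℝ) :
    poissonInt (fun _ => a) c R w = a :=
  poissonInt_harmonic_eq hw (harmonicOnNhd_const a)

lemma poissonInt_sub {f g : ℂ → ℝ} {c w : ℂ} {R : ℝ} (hw : w ∈ ball c R)
    (hf : ContinuousOn f (sphere c R)) (hg : ContinuousOn g (sphere c R)) :
    poissonInt (f - g) c R w = poissonInt f c R w - poissonInt g c R w := by
  unfold poissonInt
  rw [smul_sub, Real.circleAverage_sub (circleIntegrable_poissonKernel_smul hw hf)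
    (circleIntegrable_poissonKernel_smul hw hg)]

lemma poissonInt_harmonic {f : ℂ → ℝ} {c : ℂ} {R : ℝ} (hR : 0 ≤ R)
    (hf : ContinuousOn f (sphere c R)) : HarmonicOnNhd (poissonInt f c R) (ball c R) := by
  set g : ℂ → ℝ := fun z => f (z + c) with hg
  have hgi : CircleIntegrable g 0 R := by
    apply ContinuousOn.circleIntegrable hR
    apply hf.comp (by fun_prop)
    intro z hz
    simpa [mem_sphere, dist_eq_norm] using hz
  have hgi' : CircleIntegrable (fun z => (g z : ℂ)) 0 R := by
    apply ContinuousOn.circleIntegrable hR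
    apply Complex.continuous_ofReal.comp_continuousOn
    apply hf.comp (by fun_prop)
    intro z hz
    simpa [mem_sphere, dist_eq_norm] using hz
  set F : ℂ → ℂ := fun w =>
    Real.circleAverage (fun ζ ↦ herglotzRieszKernel 0 w ζ • (g ζ : ℂ)) 0 R with hF
  have hFa : AnalyticOnNhd ℂ F (ball 0 R) :=
    analyticOnNhd_circleAverage_herglotzRieszKernel_smul hgi'
  have key : ∀ w ∈ ball c R, poissonInt f c R w = (F (w - c)).re := by
    intro w hw
    have hw' : w - c ∈ ball (0 : ℂ) R := by simpa [mem_ball, dist_eq_norm] using hw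
    rw [hF]
    simp only
    rw [re_circleAverage_herglotzRieszKernel_smul hgi hw', poissonInt,
      ← Real.circleAverage_map_add_const]
    congr 1
    ext z
    simp [poissonKernel_eq_re_herglotzRieszKernel, herglotzRieszKernel_add_const, hg]
  intro w hw
  have hw' : w - c ∈ ball (0 : ℂ) R := by simpa [mem_ball, dist_eq_norm] using hw
  have ha : AnalyticAt ℂ (fun w => F (w - c)) w :=
    (hFa (w - c) hw').fun_comp (f := fun w => w - c) (by fun_prop)
  refine (harmonicAt_congr_nhds ?_).2 ha.harmonicAt_re
  filter_upwards [isOpen_ball.mem_nhds hw] with y hy using key y hy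

/-- The boundary behaviour of the Poisson integral: on the circle, `‖z - ζ‖²` agrees with an affine
function, which the Poisson integral reproduces. -/
lemma abs_poissonInt_sub_le {f : ℂ → ℝ} {c w ζ : ℂ} {R ε K : ℝ} (hw : w ∈ ball c R)
    (hζ : ζ ∈ sphere c R) (hf : ContinuousOn f (sphere c R))
    (h : ∀ z ∈ sphere c R, |f z - f ζ| ≤ ε + K * ‖z - ζ‖ ^ 2) :
    |poissonInt f c R w - f ζ| ≤
      ε + K * (2 * R ^ 2 - 2 * (conj (ζ - c) * (w - c)).re) := by
  set q : ℂ → ℝ := fun z => 2 * R ^ 2 - 2 * (conj (ζ - c) * (z - c)).re with hq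
  have hζ' : ‖ζ - c‖ = R := by rwa [mem_sphere, dist_eq_norm] at hζ
  have hqs : ∀ z ∈ sphere c R, ‖z - ζ‖ ^ 2 = q z := by
    intro z hz
    have hz' : ‖z - c‖ = R := by rwa [mem_sphere, dist_eq_norm] at hz
    have e1 : R ^ 2 = ‖z - c‖ ^ 2 := by rw [hz']
    have e2 : R ^ 2 = ‖ζ - c‖ ^ 2 := by rw [hζ']
    have e3 : 2 * R ^ 2 = ‖z - c‖ ^ 2 + ‖ζ - c‖ ^ 2 := by linarith
    rw [hq]
    simp only [e3, Complex.sq_norm, Complex.normSq_apply]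
    simp
    ring
  have hh : ∀ a b : ℝ, HarmonicOnNhd (fun z => a + b * q z) (closedBall c R) := by
    intro a b
    have : (fun z => a + b * q z) = fun z : ℂ =>
        (((a + b * (2 * R ^ 2) : ℝ) : ℂ) + b * 2 * (conj (ζ - c) * c)
          + (-(b * 2) * conj (ζ - c) : ℂ) * z).re := by
      ext z
      simp only [hq, Complex.add_re, Complex.ofReal_re]
      simp
      ring
    rw [this]
    exact harmonicOnNhd_re_affine _ _ _
  have hcont : ∀ a b : ℝ, ContinuousOn (fun z => a + b * q z) (sphere c R) := fun a b =>
    (hh a b).contDiffOn.continuousOn.mono sphere_subset_closedBall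
  have up : poissonInt f c R w ≤ (f ζ + ε) + K * q w := by
    rw [← poissonInt_harmonic_eq hw (hh _ _)]
    apply poissonInt_mono hw hf (hcont _ _)
    intro z hz
    have := (abs_le.1 (h z hz)).2
    rw [hqs z hz] at this
    linarith
  have lo : (f ζ - ε) + (-K) * q w ≤ poissonInt f c R w := by
    rw [← poissonInt_harmonic_eq hw (hh _ _)]
    apply poissonInt_mono hw (hcont _ _) hf
    intro z hz
    have := (abs_le.1 (h z hz)).1
    rw [hqs z hz] at this
    linarith
  rw [abs_le]
  constructor <;> simp only [hq] at up lo <;> linarith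

lemma exists_modulus {f : ℂ → ℝ} {s : Set ℂ} (hs : IsCompact s) {ζ : ℂ} (hζ : ζ ∈ s)
    (hf : ContinuousOn f s) {b : ℂ → ℝ} (hb : ContinuousOn b s)
    (hpos : ∀ z ∈ s, z ≠ ζ → 0 < b z) (h0 : 0 ≤ b ζ) {ε : ℝ} (hε : 0 < ε) :
    ∃ K, 0 ≤ K ∧ ∀ z ∈ s, |f z - f ζ| ≤ ε + K * b z := by
  obtain ⟨δ, hδ, hd⟩ := Metric.continuousOn_iff.1 hf ζ hζ ε hε
  have hnn : ∀ z ∈ s, 0 ≤ b z := fun z hz => by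
    by_cases h : z = ζ
    · rwa [h]
    · exact (hpos z hz h).le
  have hcpt : IsCompact (s \ ball ζ δ) := hs.diff isOpen_ball
  obtain ⟨A, hA⟩ := hs.exists_bound_of_continuousOn (f := fun z => f z - f ζ) (by fun_prop)
  by_cases hne : (s \ ball ζ δ).Nonempty
  · obtain ⟨z₀, hz₀, hmin⟩ := hcpt.exists_isMinOn hne (hb.mono sdiff_subset)
    have hb0 : 0 < b z₀ := hpos z₀ hz₀.1 (by
      rintro rfl
      exact hz₀.2 (mem_ball_self hδ))
    refine ⟨|A| / b z₀, by positivity, fun z hz => ?_⟩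
    by_cases hzb : z ∈ ball ζ δ
    · have := hd z hz hzb
      rw [Real.dist_eq] at this
      have := mul_nonneg (div_nonneg (abs_nonneg A) hb0.le) (hnn z hz)
      linarith
    · have h1 : b z₀ ≤ b z := hmin ⟨hz, hzb⟩
      have h2 := hA z hz
      rw [Real.norm_eq_abs] at h2
      have h3 : |A| ≤ |A| / b z₀ * b z := by
        rw [div_mul_eq_mul_div, le_div_iff₀ hb0]
        exact mul_le_mul_of_nonneg_left h1 (abs_nonneg _)
      linarith [le_abs_self A]
  · refine ⟨0, le_rfl, fun z hz => ?_⟩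
    have hzb : z ∈ ball ζ δ := by
      by_contra hn
      exact hne ⟨z, hz, hn⟩
    have := hd z hz hzb
    rw [Real.dist_eq] at this
    linarith

/-- `v` with its values in the disc replaced by the Poisson integral of its values on the circle. -/
def poissonMod (v : ℂ → ℝ) (c : ℂ) (R : ℝ) : ℂ → ℝ :=
  open Classical in fun w => if w ∈ ball c R then poissonInt v c R w else v w

lemma poissonMod_of_mem {v : ℂ → ℝ} {c w : ℂ} {R : ℝ} (hw : w ∈ ball c R) :
    poissonMod v c R w = poissonInt v c R w := if_pos hw

lemma poissonMod_of_notMem {v : ℂ → ℝ} {c w : ℂ} {R : ℝ} (hw : w ∉ ball c R) :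
    poissonMod v c R w = v w := if_neg hw

lemma continuousOn_poissonMod {v : ℂ → ℝ} {c : ℂ} {R : ℝ} {s : Set ℂ} (hR : 0 < R)
    (hv : ContinuousOn v s) (hs : closedBall c R ⊆ s) : ContinuousOn (poissonMod v c R) s := by
  have hvs : ContinuousOn v (sphere c R) := hv.mono (sphere_subset_closedBall.trans hs)
  intro ζ hζ
  rcases lt_trichotomy (dist ζ c) R with hlt | heq | hgt
  · have hm : ζ ∈ ball c R := hlt
    have h1 : ContinuousAt (poissonInt v c R) ζ :=
      ((poissonInt_harmonic hR.le hvs) ζ hm).1.continuousAt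
    refine (h1.congr ?_).continuousWithinAt
    filter_upwards [isOpen_ball.mem_nhds hm] with y hy using (poissonMod_of_mem hy).symm
  · have hζs : ζ ∈ sphere c R := heq
    have hζn : ζ ∉ ball c R := by simp [heq]
    rw [ContinuousWithinAt, poissonMod_of_notMem hζn, Metric.tendsto_nhds]
    intro ε hε
    obtain ⟨K, hK0, hK⟩ := exists_modulus (isCompact_sphere c R) hζs hvs
      (b := fun z => ‖z - ζ‖ ^ 2) (by fun_prop)
      (fun z _ hne => by have := norm_pos_iff.2 (sub_ne_zero.2 hne); positivity)
      (by positivity) (half_pos hε)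
    have t1 : Tendsto (fun w => ε / 2 + K * (2 * R ^ 2 - 2 * (conj (ζ - c) * (w - c)).re))
        (𝓝[s] ζ) (𝓝 (ε / 2)) := by
      have hc : Continuous fun w : ℂ =>
          ε / 2 + K * (2 * R ^ 2 - 2 * (conj (ζ - c) * (w - c)).re) := by fun_prop
      have := (hc.tendsto ζ).mono_left (nhdsWithin_le_nhds (s := s))
      have e : ε / 2 + K * (2 * R ^ 2 - 2 * (conj (ζ - c) * (ζ - c)).re) = ε / 2 := by
        rw [mul_comm (conj (ζ - c)), Complex.mul_conj, Complex.ofReal_re, ← Complex.sq_norm,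
          ← dist_eq_norm, heq]
        ring
      rwa [e] at this
    have t2 := Metric.tendsto_nhds.1 (hv ζ hζ) ε hε
    filter_upwards [t1.eventually_lt_const (half_lt_self hε), t2] with w hw1 hw2
    by_cases hwb : w ∈ ball c R
    · rw [poissonMod_of_mem hwb, Real.dist_eq]
      exact (abs_poissonInt_sub_le hwb hζs hvs hK).trans_lt hw1
    · rwa [poissonMod_of_notMem hwb]
  · have hm : ζ ∈ (closedBall c R)ᶜ := by simpa using hgt
    refine (hv ζ hζ).congr_of_eventuallyEq ?_ ?_
    · filter_upwards [nhdsWithin_le_nhds (isClosed_closedBall.isOpen_compl.mem_nhds hm)] with y hy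
      exact poissonMod_of_notMem fun h => hy (ball_subset_closedBall h)
    · exact poissonMod_of_notMem fun h => hm (ball_subset_closedBall h)

lemma le_poissonMod {v : ℂ → ℝ} {c : ℂ} {R : ℝ} {U : Set ℂ} (hR : 0 < R)
    (hv : ContinuousOn v U) (hs : closedBall c R ⊆ U) (hsub : LocalSubmean v U) (w : ℂ) :
    v w ≤ poissonMod v c R w := by
  by_cases hw : w ∈ ball c R
  · have hcl : closure (ball c R) = closedBall c R := closure_ball c hR.ne'
    have hvs : ContinuousOn v (sphere c R) := hv.mono (sphere_subset_closedBall.trans hs)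
    refine LocalSubmean.le_harmonic isOpen_ball isBounded_ball ?_
      (fun x hx => hsub x (hs (ball_subset_closedBall hx))) (h := poissonMod v c R) ?_ ?_ ?_ w
      (subset_closure hw)
    · rw [hcl]; exact hv.mono hs
    · intro x hx
      refine (harmonicAt_congr_nhds ?_).2 (poissonInt_harmonic hR.le hvs x hx)
      filter_upwards [isOpen_ball.mem_nhds hx] with y hy using poissonMod_of_mem hy
    · rw [hcl]; exact continuousOn_poissonMod hR (hv.mono hs) Subset.rfl
    · intro x hx
      rw [frontier_ball c hR.ne', mem_sphere] at hx
      rw [poissonMod_of_notMem (by simp [hx])]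
  · rw [poissonMod_of_notMem hw]

lemma LocalSubmean.poissonMod {v : ℂ → ℝ} {c : ℂ} {R : ℝ} {U : Set ℂ} (hU : IsOpen U) (hR : 0 < R)
    (hv : ContinuousOn v U) (hs : closedBall c R ⊆ U) (hsub : LocalSubmean v U) :
    LocalSubmean (poissonMod v c R) U := by
  intro x hx
  by_cases hxb : x ∈ ball c R
  · have hvs : ContinuousOn v (sphere c R) := hv.mono (sphere_subset_closedBall.trans hs)
    refine localSubmean_of_harmonic isOpen_ball (fun y hy => ?_) x hxb
    refine (harmonicAt_congr_nhds ?_).2 (poissonInt_harmonic hR.le hvs y hy)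
    filter_upwards [isOpen_ball.mem_nhds hy] with y hy using poissonMod_of_mem hy
  · obtain ⟨r₁, hr₁, h1⟩ := hsub x hx
    obtain ⟨r₂, hr₂, hball⟩ := exists_closedBall_subset_of_lt hU hx
    refine ⟨min r₁ r₂, lt_min hr₁ hr₂, fun r hr0 hr => ?_⟩
    have hb := hball r (hr.trans_le (min_le_right _ _))
    rw [poissonMod_of_notMem hxb]
    refine (h1 r hr0 (hr.trans_le (min_le_left _ _))).trans ?_
    exact Real.circleAverage_mono (circleIntegrable_of_closedBall hr0.le (hv.mono hb))
      (circleIntegrable_of_closedBall hr0.le ((continuousOn_poissonMod hR hv hs).mono hb))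
      fun z _ => le_poissonMod hR hv hs hsub z

lemma LocalSubmean.max {v w : ℂ → ℝ} {U : Set ℂ} (hU : IsOpen U)
    (hv : ContinuousOn v U) (hw : ContinuousOn w U) (hsv : LocalSubmean v U)
    (hsw : LocalSubmean w U) : LocalSubmean (fun x => max (v x) (w x)) U := by
  intro x hx
  obtain ⟨r₁, hr₁, h1⟩ := hsv x hx
  obtain ⟨r₂, hr₂, h2⟩ := hsw x hx
  obtain ⟨r₃, hr₃, hball⟩ := exists_closedBall_subset_of_lt hU hx
  refine ⟨min (min r₁ r₂) r₃, lt_min (lt_min hr₁ hr₂) hr₃, fun r hr0 hr => ?_⟩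
  have hb := hball r (hr.trans_le (min_le_right _ _))
  have hr12 := hr.trans_le (min_le_left _ _)
  have iv := circleIntegrable_of_closedBall hr0.le (hv.mono hb)
  have iw := circleIntegrable_of_closedBall hr0.le (hw.mono hb)
  have im := circleIntegrable_of_closedBall hr0.le ((hv.sup hw).mono hb)
  apply max_le
  · exact (h1 r hr0 (hr12.trans_le (min_le_left _ _))).trans
      (Real.circleAverage_mono iv im fun z _ => le_max_left _ _)
  · exact (h2 r hr0 (hr12.trans_le (min_le_right _ _))).trans
      (Real.circleAverage_mono iw im fun z _ => le_max_right _ _)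

/-! ### Perron's method -/

/-- The subharmonic functions on `Ω` lying below `φ` on the boundary. -/
structure IsPerronSub (Ω : Set ℂ) (φ v : ℂ → ℝ) : Prop where
  continuousOn : ContinuousOn v (closure Ω)
  submean : LocalSubmean v Ω
  le_boundary : ∀ x ∈ frontier Ω, v x ≤ φ x

/-- The upper envelope of the Perron family. -/
def perronSup (Ω : Set ℂ) (φ : ℂ → ℝ) (x : ℂ) : ℝ :=
  ⨆ v : {v : ℂ → ℝ // IsPerronSub Ω φ v}, v.1 x

section Perron

variable {Ω : Set ℂ} {φ : ℂ → ℝ}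

lemma isPerronSub_harmonic (hΩ : IsOpen Ω) {h : ℂ → ℝ} (hh : HarmonicOnNhd h Ω)
    (hc : ContinuousOn h (closure Ω)) (hle : ∀ x ∈ frontier Ω, h x ≤ φ x) : IsPerronSub Ω φ h :=
  ⟨hc, localSubmean_of_harmonic hΩ hh, hle⟩

lemma exists_bound_frontier (hb : IsBounded Ω) (hφ : ContinuousOn φ (frontier Ω)) :
    ∃ M, ∀ x ∈ frontier Ω, |φ x| ≤ M := by
  have : IsCompact (frontier Ω) :=
    hb.isCompact_closure.of_isClosed_subset isClosed_frontier frontier_subset_closure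
  exact this.exists_bound_of_continuousOn hφ

lemma nonempty_perron (hΩ : IsOpen Ω) (hb : IsBounded Ω) (hφ : ContinuousOn φ (frontier Ω)) :
    Nonempty {v : ℂ → ℝ // IsPerronSub Ω φ v} := by
  obtain ⟨M, hM⟩ := exists_bound_frontier hb hφ
  exact ⟨⟨fun _ => -M, isPerronSub_harmonic hΩ (harmonicOnNhd_const _) continuousOn_const
    fun x hx => (abs_le.1 (hM x hx)).1⟩⟩

lemma bddAbove_perron (hΩ : IsOpen Ω) (hb : IsBounded Ω) (hφ : ContinuousOn φ (frontier Ω))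
    {x : ℂ} (hx : x ∈ closure Ω) :
    BddAbove (range fun v : {v : ℂ → ℝ // IsPerronSub Ω φ v} => v.1 x) := by
  obtain ⟨M, hM⟩ := exists_bound_frontier hb hφ
  refine ⟨M, ?_⟩
  rintro _ ⟨v, rfl⟩
  exact v.2.submean.le_of_frontier hΩ hb v.2.continuousOn
    (fun y hy => (v.2.le_boundary y hy).trans (abs_le.1 (hM y hy)).2) x hx

lemma IsPerronSub.max {v w : ℂ → ℝ} (hΩ : IsOpen Ω) (hv : IsPerronSub Ω φ v)
    (hw : IsPerronSub Ω φ w) : IsPerronSub Ω φ fun x => max (v x) (w x) :=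
  ⟨hv.continuousOn.sup hw.continuousOn,
    hv.submean.max hΩ (hv.continuousOn.mono subset_closure) (hw.continuousOn.mono subset_closure)
      hw.submean,
    fun x hx => max_le (hv.le_boundary x hx) (hw.le_boundary x hx)⟩

lemma IsPerronSub.poissonMod {v : ℂ → ℝ} (hΩ : IsOpen Ω) (hv : IsPerronSub Ω φ v) {c : ℂ} {R : ℝ}
    (hR : 0 < R) (hs : closedBall c R ⊆ Ω) : IsPerronSub Ω φ (poissonMod v c R) := by
  refine ⟨continuousOn_poissonMod hR hv.continuousOn (hs.trans subset_closure),
    hv.submean.poissonMod hΩ hR (hv.continuousOn.mono subset_closure) hs, fun x hx => ?_⟩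
  rw [poissonMod_of_notMem]
  · exact hv.le_boundary x hx
  · intro h
    exact (hΩ.frontier_eq ▸ hx).2 (hs (ball_subset_closedBall h))

/-- Harnack's inequality on the half disc. -/
lemma poissonInt_le_three_mul {g : ℂ → ℝ} {c w : ℂ} {R : ℝ} (hR : 0 < R)
    (hg : ContinuousOn g (sphere c R)) (h0 : ∀ z ∈ sphere c R, 0 ≤ g z)
    (hw : w ∈ closedBall c (R / 2)) : poissonInt g c R w ≤ 3 * poissonInt g c R c := by
  have hwb : w ∈ ball c R := closedBall_subset_ball (by linarith) hw
  have hcb : c ∈ ball c R := mem_ball_self hR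
  have e : 3 * poissonInt g c R c = Real.circleAverage (fun z => 3 * g z) c R := by
    rw [poissonInt, ← smul_eq_mul, ← Real.circleAverage_smul]
    apply Real.circleAverage_congr_sphere
    intro z hz
    rw [abs_of_pos hR, mem_sphere, dist_eq_norm] at hz
    have : R ^ 2 ≠ 0 := by positivity
    simp [poissonKernel_def, hz, this]
  rw [e, poissonInt]
  apply Real.circleAverage_mono (circleIntegrable_poissonKernel_smul hwb hg)
    ((continuousOn_const.mul hg).circleIntegrable hR.le)
  intro z hz
  rw [abs_of_pos hR] at hz
  apply mul_le_mul_of_nonneg_right _ (h0 z hz)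
  have h1 := re_herglotzRieszKernel_le hz hwb
  have h2 : poissonKernel c w z = ((z - c + (w - c)) / ((z - c) - (w - c))).re := by
    rw [poissonKernel_eq_re_herglotzRieszKernel]; rfl
  rw [h2]
  refine h1.trans ?_
  have h3 : ‖w - c‖ ≤ R / 2 := by rwa [mem_closedBall, dist_eq_norm] at hw
  rw [div_le_iff₀ (by linarith)]
  linarith

lemma perronSup_harmonic (hΩ : IsOpen Ω) (hb : IsBounded Ω) (hφ : ContinuousOn φ (frontier Ω)) :
    HarmonicOnNhd (perronSup Ω φ) Ω := by
  intro c hc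
  have := nonempty_perron hΩ hb hφ
  obtain ⟨r₀, hr₀, hball⟩ := exists_closedBall_subset_of_lt hΩ hc
  set R := r₀ / 2 with hRdef
  have hR : 0 < R := by positivity
  have hsub : closedBall c R ⊆ Ω := hball R (by linarith)
  have hcb : c ∈ ball c R := mem_ball_self hR
  have le_sup : ∀ v, IsPerronSub Ω φ v → ∀ x ∈ Ω, v x ≤ perronSup Ω φ x := fun v hv x hx =>
    le_ciSup (bddAbove_perron hΩ hb hφ (subset_closure hx)) ⟨v, hv⟩
  have hcs : ∀ v, IsPerronSub Ω φ v → ContinuousOn v (sphere c R) := fun v hv =>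
    hv.continuousOn.mono ((sphere_subset_closedBall.trans hsub).trans subset_closure)
  -- By Harnack's inequality, a Poisson integral nearly optimal at the centre is nearly optimal on
  -- the half disc.
  have approx : ∀ ε > 0, ∃ v, IsPerronSub Ω φ v ∧ ∀ w ∈ closedBall c (R / 2),
      |perronSup Ω φ w - poissonInt v c R w| ≤ 3 * ε := by
    intro ε hε
    obtain ⟨v, hv⟩ := exists_lt_of_lt_ciSup (show perronSup Ω φ c - ε < perronSup Ω φ c by linarith)
    refine ⟨v.1, v.2, fun w hw => ?_⟩
    have hwb : w ∈ ball c R := closedBall_subset_ball (by linarith) hw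
    have hwΩ : w ∈ Ω := hsub (ball_subset_closedBall hwb)
    have hup : poissonInt v.1 c R w ≤ perronSup Ω φ w := by
      rw [← poissonMod_of_mem hwb]
      exact le_sup _ (v.2.poissonMod hΩ hR hsub) w hwΩ
    have hvc : perronSup Ω φ c - ε ≤ poissonInt v.1 c R c := by
      rw [← poissonMod_of_mem hcb]
      exact hv.le.trans (le_poissonMod hR (v.2.continuousOn.mono subset_closure) hsub v.2.submean c)
    have hlo : perronSup Ω φ w ≤ poissonInt v.1 c R w + 3 * ε := by
      apply ciSup_le
      intro v'
      have hm := v'.2.max hΩ v.2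
      set m : ℂ → ℝ := fun x => max (v'.1 x) (v.1 x)
      have h1 : v'.1 w ≤ poissonInt m c R w := by
        rw [← poissonMod_of_mem hwb]
        exact (le_max_left _ _).trans
          (le_poissonMod hR (hm.continuousOn.mono subset_closure) hsub hm.submean w)
      have h2 : poissonInt m c R c ≤ perronSup Ω φ c := by
        rw [← poissonMod_of_mem hcb]
        exact le_sup _ (hm.poissonMod hΩ hR hsub) c hc
      have h3 := poissonInt_le_three_mul hR ((hcs _ hm).sub (hcs _ v.2))
        (fun z _ => sub_nonneg.2 (le_max_right _ _)) hw
      rw [poissonInt_sub hwb (hcs _ hm) (hcs _ v.2),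
        poissonInt_sub hcb (hcs _ hm) (hcs _ v.2)] at h3
      linarith
    rw [abs_le]
    constructor <;> linarith
  have hR2 : 0 < R / 2 := by positivity
  have hPc : ∀ v, IsPerronSub Ω φ v → ContinuousOn (poissonInt v c R) (closedBall c (R / 2)) :=
    fun v hv => (poissonInt_harmonic hR.le (hcs v hv)).contDiffOn.continuousOn.mono
      (closedBall_subset_ball (by linarith))
  have hcont : ContinuousOn (perronSup Ω φ) (closedBall c (R / 2)) := by
    apply continuousOn_of_uniform_approx_of_continuousOn
    intro s hs
    obtain ⟨ε, hε, hεs⟩ := Metric.mem_uniformity_dist.1 hs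
    obtain ⟨v, hv, hv'⟩ := approx (ε / 6) (by positivity)
    refine ⟨_, hPc v hv, fun y hy => hεs ?_⟩
    rw [Real.dist_eq]
    have := hv' y hy
    linarith
  have hss : sphere c (R / 2) ⊆ closedBall c (R / 2) := sphere_subset_closedBall
  have hP : ∀ w ∈ ball c (R / 2), perronSup Ω φ w = poissonInt (perronSup Ω φ) c (R / 2) w := by
    intro w hw
    apply eq_of_abs_sub_le_all
    intro ε hε
    obtain ⟨v, hv, hv'⟩ := approx (ε / 6) (by positivity)
    have h1 := hv' w (ball_subset_closedBall hw)
    have hh : HarmonicOnNhd (poissonInt v c R) (closedBall c (R / 2)) :=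
      (poissonInt_harmonic hR.le (hcs v hv)).mono (closedBall_subset_ball (by linarith))
    have h2 := poissonInt_harmonic_eq hw hh
    have h3 := poissonInt_sub hw (hcont.mono hss) ((hPc v hv).mono hss)
    have h4 : poissonInt (perronSup Ω φ - poissonInt v c R) c (R / 2) w ≤ ε / 2 := by
      rw [← poissonInt_const hw (ε / 2)]
      apply poissonInt_mono hw ((hcont.mono hss).sub ((hPc v hv).mono hss)) continuousOn_const
      intro z hz
      have := (abs_le.1 (hv' z (hss hz))).2
      simp only [Pi.sub_apply]
      linarith
    have h5 : -(ε / 2) ≤ poissonInt (perronSup Ω φ - poissonInt v c R) c (R / 2) w := by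
      rw [← poissonInt_const hw (-(ε / 2))]
      apply poissonInt_mono hw continuousOn_const ((hcont.mono hss).sub ((hPc v hv).mono hss))
      intro z hz
      have := (abs_le.1 (hv' z (hss hz))).1
      simp only [Pi.sub_apply]
      linarith
    rw [abs_le] at h1 ⊢
    constructor <;> linarith [h1.1, h1.2]
  refine (harmonicAt_congr_nhds ?_).2
    (poissonInt_harmonic hR2.le (hcont.mono hss) c (mem_ball_self hR2))
  filter_upwards [isOpen_ball.mem_nhds (mem_ball_self hR2)] with y hy using hP y hy

/-- A barrier controls the envelope near the boundary point `ζ`. -/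
lemma abs_perronSup_sub_le (hΩ : IsOpen Ω) (hb : IsBounded Ω) (hφ : ContinuousOn φ (frontier Ω))
    {b : ℂ → ℝ} (hbh : HarmonicOnNhd b Ω) (hbc : ContinuousOn b (closure Ω)) {ζ : ℂ} {ε K : ℝ}
    (h : ∀ x ∈ frontier Ω, |φ x - φ ζ| ≤ ε + K * b x) {x : ℂ} (hx : x ∈ closure Ω) :
    |perronSup Ω φ x - φ ζ| ≤ ε + K * b x := by
  have := nonempty_perron hΩ hb hφ
  have har : ∀ s t : ℝ, HarmonicOnNhd (fun x => s + t * b x) Ω := fun s t =>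
    (harmonicOnNhd_const s).add (hbh.const_smul (c := t))
  have hcn : ∀ s t : ℝ, ContinuousOn (fun x => s + t * b x) (closure Ω) := fun s t => by fun_prop
  have lo : (φ ζ - ε) + (-K) * b x ≤ perronSup Ω φ x :=
    le_ciSup (bddAbove_perron hΩ hb hφ hx) ⟨_, isPerronSub_harmonic hΩ (har _ _) (hcn _ _)
      fun y hy => by linarith [(abs_le.1 (h y hy)).1]⟩
  have up : perronSup Ω φ x ≤ (φ ζ + ε) + K * b x := by
    apply ciSup_le
    intro v
    exact v.2.submean.le_harmonic hΩ hb v.2.continuousOn (har _ _) (hcn _ _)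
      (fun y hy => (v.2.le_boundary y hy).trans (by linarith [(abs_le.1 (h y hy)).2])) x hx
  rw [abs_le]
  constructor <;> linarith

end Perron

lemma exists_exterior_ball {Ω : Set ℂ} (h : IsSmoothBoundedDomain Ω) {ζ : ℂ}
    (hζ : ζ ∈ frontier Ω) :
    ∃ (a : ℂ) (r : ℝ), 0 < r ∧ ‖ζ - a‖ = r ∧ ∀ x ∈ closure Ω, x ≠ ζ → r < ‖x - a‖ := by
  obtain ⟨N, hN, f, hf, hdf, hfN⟩ := h.smooth_boundary ζ hζ
  have hf2 : ContDiff ℝ 2 f := contDiff_infty.1 hf 2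
  have hζΩ : ζ ∉ Ω := (h.isOpen.frontier_eq ▸ hζ).2
  have hfζ : 0 ≤ f ζ := by
    by_contra! hn
    exact hζΩ ((hfN ζ (mem_of_mem_nhds hN)).2 hn)
  -- the second order Taylor bound, from the Lipschitz continuity of the differential
  have hlip : ∃ K : ℝ, 0 < K ∧ ∃ δ > 0, ∀ y ∈ ball ζ δ,
      f ζ + fderiv ℝ f ζ (y - ζ) - K * ‖y - ζ‖ ^ 2 ≤ f y := by
    have h1 : ContDiff ℝ 1 (fderiv ℝ f) := hf2.fderiv_right (by norm_num)
    obtain ⟨K, t, ht, hK⟩ := h1.contDiffAt (x := ζ).exists_lipschitzOnWith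
    obtain ⟨δ, hδ, hδt⟩ := Metric.mem_nhds_iff.1 ht
    refine ⟨K + 1, by positivity, δ, hδ, fun y hy => ?_⟩
    have hmv := Convex.norm_image_sub_le_of_norm_hasFDerivWithin_le
      (f := fun x => f x - fderiv ℝ f ζ x) (f' := fun x => fderiv ℝ f x - fderiv ℝ f ζ)
      (s := ball ζ δ ∩ closedBall ζ ‖y - ζ‖) (C := K * ‖y - ζ‖) (x := ζ) (y := y)
      (fun x _ => (((hf2.differentiable (by norm_num) x).hasFDerivAt.sub
        (fderiv ℝ f ζ).hasFDerivAt)).hasFDerivWithinAt)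
      (fun x hx => by
        have h1 := hK.dist_le_mul x (hδt hx.1) ζ (hδt (mem_ball_self hδ))
        rw [dist_eq_norm, dist_eq_norm] at h1
        have h2 : ‖x - ζ‖ ≤ ‖y - ζ‖ := by simpa [dist_eq_norm] using hx.2
        exact h1.trans (mul_le_mul_of_nonneg_left h2 K.2))
      ((convex_ball _ _).inter (convex_closedBall _ _))
      ⟨mem_ball_self hδ, by simp⟩ ⟨hy, by simp [dist_eq_norm]⟩
    rw [Real.norm_eq_abs] at hmv
    have := (abs_le.1 hmv).1
    rw [map_sub]
    nlinarith [sq_nonneg ‖y - ζ‖]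
  obtain ⟨K, hK, δ, hδ, hT⟩ := hlip
  obtain ⟨δ', hδ', hNδ⟩ := Metric.mem_nhds_iff.1 hN
  -- `n` is the gradient of `f` at `ζ`
  set n : ℂ := (InnerProductSpace.toDual ℝ ℂ).symm (fderiv ℝ f ζ) with hn
  have hnf : ∀ v, fderiv ℝ f ζ v = inner ℝ n v := fun v => by
    rw [hn, InnerProductSpace.toDual_symm_apply]
  have hn0 : n ≠ 0 := by
    rw [hn]
    simpa using hdf
  have hnn : 0 < ‖n‖ := norm_pos_iff.2 hn0
  set t : ℝ := min (1 / (4 * K)) (min δ δ' / (4 * ‖n‖)) with ht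
  have ht0 : 0 < t := by positivity
  have htK : t * (4 * K) ≤ 1 := by
    rw [← le_div_iff₀ (by positivity)]; exact min_le_left _ _
  have htδ : t * (4 * ‖n‖) ≤ min δ δ' := by
    rw [← le_div_iff₀ (by positivity)]; exact min_le_right _ _
  refine ⟨ζ + t • n, t * ‖n‖, by positivity, by simp [abs_of_pos ht0], ?_⟩
  intro x hx hne
  by_contra! hle
  have hxζ : 0 < ‖x - ζ‖ := norm_pos_iff.2 (sub_ne_zero.2 hne)
  have hsq : ‖x - ζ‖ ^ 2 ≤ 2 * t * inner ℝ n (x - ζ) := by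
    have e : x - (ζ + t • n) = (x - ζ) - t • n := by abel
    have h2 := pow_le_pow_left₀ (norm_nonneg _) hle 2
    rw [e, norm_sub_sq_real, inner_smul_right, norm_smul, Real.norm_eq_abs, abs_of_pos ht0,
      real_inner_comm] at h2
    linarith
  have hlt : ‖x - ζ‖ < min δ δ' := by
    have e : x - ζ = (x - (ζ + t • n)) + t • n := by abel
    have h1 := norm_add_le (x - (ζ + t • n)) (t • n)
    rw [← e, norm_smul, Real.norm_eq_abs, abs_of_pos ht0] at h1
    have : 0 < t * ‖n‖ := by positivity
    linarith
  have hxδ : x ∈ ball ζ δ := by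
    rw [mem_ball, dist_eq_norm]; exact hlt.trans_le (min_le_left _ _)
  have hxδ' : x ∈ ball ζ δ' := by
    rw [mem_ball, dist_eq_norm]; exact hlt.trans_le (min_le_right _ _)
  have hfx : 0 < f x := by
    have h1 := hT x hxδ
    rw [hnf] at h1
    have h3 : K * ‖x - ζ‖ ^ 2 ≤ inner ℝ n (x - ζ) / 2 := by
      have hin : 0 ≤ inner ℝ n (x - ζ) := by
        by_contra! hneg
        have : 2 * t * inner ℝ n (x - ζ) < 0 := mul_neg_of_pos_of_neg (by positivity) hneg
        linarith [sq_nonneg ‖x - ζ‖]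
      calc K * ‖x - ζ‖ ^ 2 ≤ K * (2 * t * inner ℝ n (x - ζ)) :=
            mul_le_mul_of_nonneg_left hsq hK.le
        _ = (t * (4 * K)) * (inner ℝ n (x - ζ) / 2) := by ring
        _ ≤ 1 * (inner ℝ n (x - ζ) / 2) := mul_le_mul_of_nonneg_right htK (by linarith)
        _ = _ := one_mul _
    have : 0 < K * ‖x - ζ‖ ^ 2 := by positivity
    linarith
  -- `f` is positive near `x`, so `x` is not even in the closure
  have hnh : {y | 0 < f y} ∩ ball ζ δ' ∈ 𝓝 x :=
    inter_mem ((isOpen_lt continuous_const hf.continuous).mem_nhds hfx)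
      (isOpen_ball.mem_nhds hxδ')
  obtain ⟨y, hy, hyΩ⟩ := mem_closure_iff_nhds.1 hx _ hnh
  have := (hfN y (hNδ hy.2)).1 hyΩ
  have h0 : 0 < f y := hy.1
  linarith

/-- Solvability of the Dirichlet problem on a smooth bounded domain. -/
theorem exists_harmonic_extension {Ω : Set ℂ} (h : IsSmoothBoundedDomain Ω) {φ : ℂ → ℝ}
    (hφ : ContinuousOn φ (frontier Ω)) :
    ∃ u : ℂ → ℝ, HarmonicOnNhd u Ω ∧ ContinuousOn u (closure Ω) ∧
      ∀ x ∈ frontier Ω, u x = φ x := by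
  have hcpt : IsCompact (frontier Ω) :=
    h.isBounded.isCompact_closure.of_isClosed_subset isClosed_frontier frontier_subset_closure
  have hharm := perronSup_harmonic h.isOpen h.isBounded hφ
  have key : ∀ ζ ∈ frontier Ω, ∃ b : ℂ → ℝ, ContinuousOn b (closure Ω) ∧ b ζ = 0 ∧
      ∀ ε > 0, ∃ K, ∀ x ∈ closure Ω, |perronSup Ω φ x - φ ζ| ≤ ε + K * b x := by
    intro ζ hζ
    obtain ⟨a, r, hr, hζa, hout⟩ := exists_exterior_ball h hζ
    have hge : ∀ x ∈ closure Ω, r ≤ ‖x - a‖ := fun x hx => by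
      by_cases hxe : x = ζ
      · rw [hxe, hζa]
      · exact (hout x hx hxe).le
    have hne : ∀ x ∈ closure Ω, x - a ≠ 0 := fun x hx h0 => by
      have := hge x hx
      rw [h0, norm_zero] at this
      linarith
    set b : ℂ → ℝ := fun x => Real.log ‖x - a‖ - Real.log r with hb
    have hbc : ContinuousOn b (closure Ω) := by
      have : ∀ x ∈ closure Ω, ‖x - a‖ ≠ 0 := fun x hx => norm_ne_zero_iff.2 (hne x hx)
      rw [hb]
      fun_prop (disch := assumption)
    have hbh : HarmonicOnNhd b Ω := fun x hx =>
      (AnalyticAt.harmonicAt_log_norm (f := fun x => x - a) (by fun_prop)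
        (hne x (subset_closure hx))).sub (harmonicAt_const (Real.log r))
    have hbpos : ∀ x ∈ closure Ω, x ≠ ζ → 0 < b x := fun x hx hxe =>
      sub_pos.2 (Real.log_lt_log hr (hout x hx hxe))
    have hb0 : b ζ = 0 := by simp [hb, hζa]
    refine ⟨b, hbc, hb0, fun ε hε => ?_⟩
    obtain ⟨K, -, hK⟩ := exists_modulus hcpt hζ hφ (hbc.mono frontier_subset_closure)
      (fun z hz => hbpos z (frontier_subset_closure hz)) hb0.ge hε
    exact ⟨K, fun x hx => abs_perronSup_sub_le h.isOpen h.isBounded hφ hbh hbc hK hx⟩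
  have hbd : ∀ ζ ∈ frontier Ω, perronSup Ω φ ζ = φ ζ := by
    intro ζ hζ
    obtain ⟨b, -, hb0, hb⟩ := key ζ hζ
    apply eq_of_abs_sub_le_all
    intro ε hε
    obtain ⟨K, hK⟩ := hb ε hε
    simpa [hb0] using hK ζ (frontier_subset_closure hζ)
  refine ⟨perronSup Ω φ, hharm, fun ζ hζ => ?_, hbd⟩
  by_cases hζΩ : ζ ∈ Ω
  · exact (hharm ζ hζΩ).1.continuousAt.continuousWithinAt
  · have hζf : ζ ∈ frontier Ω := by rw [h.isOpen.frontier_eq]; exact ⟨hζ, hζΩ⟩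
    obtain ⟨b, hbc, hb0, hb⟩ := key ζ hζf
    rw [ContinuousWithinAt, hbd ζ hζf, Metric.tendsto_nhds]
    intro ε hε
    obtain ⟨K, hK⟩ := hb (ε / 2) (half_pos hε)
    have ht : Tendsto (fun x => ε / 2 + K * b x) (𝓝[closure Ω] ζ) (𝓝 (ε / 2 + K * b ζ)) :=
      (hbc ζ hζ).const_mul K |>.const_add (ε / 2)
    rw [hb0, mul_zero, add_zero] at ht
    filter_upwards [ht.eventually_lt_const (half_lt_self hε), self_mem_nhdsWithin] with x h1 h2
    rw [Real.dist_eq]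
    exact (hK x h2).trans_lt h1

/-! ### Laplacians of compositions -/

lemma laplacian_eq_fderiv_fderiv (f : ℂ → ℝ) (x : ℂ) :
    Δ f x = fderiv ℝ (fderiv ℝ f) x 1 1 + fderiv ℝ (fderiv ℝ f) x Complex.I Complex.I := by
  rw [laplacian_eq_iteratedFDeriv_complexPlane]
  simp [iteratedFDeriv_two_apply]

/-- The Laplacian in the variable `s = ‖x‖²`: `Δ (F(‖x‖²)) = 4 (s F'' + F')`. -/
lemma laplacian_comp_norm_sq {F F' : ℝ → ℝ} {F'' : ℝ} {x : ℂ}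
    (hF : ∀ᶠ s in 𝓝 (‖x‖ ^ 2), HasDerivAt F (F' s) s) (hF' : HasDerivAt F' F'' (‖x‖ ^ 2)) :
    Δ (fun y : ℂ => F (‖y‖ ^ 2)) x = 4 * (‖x‖ ^ 2 * F'' + F' (‖x‖ ^ 2)) := by
  have hn : ∀ y : ℂ, HasFDerivAt (fun y : ℂ => ‖y‖ ^ 2) (2 • innerSL ℝ y) y := fun y =>
    (hasStrictFDerivAt_norm_sq y).hasFDerivAt
  have hcont : Tendsto (fun y : ℂ => ‖y‖ ^ 2) (𝓝 x) (𝓝 (‖x‖ ^ 2)) :=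
    (continuous_norm.pow 2).tendsto x
  have h1 : fderiv ℝ (fun y : ℂ => F (‖y‖ ^ 2)) =ᶠ[𝓝 x]
      fun y => F' (‖y‖ ^ 2) • ((2 : ℝ) • innerSL ℝ y) := by
    filter_upwards [hcont.eventually hF] with y hy
    have := (hy.comp_hasFDerivAt y (hn y)).fderiv
    rw [Function.comp_def] at this
    rw [this, ← Nat.cast_smul_eq_nsmul ℝ]
    simp
  have h2 : HasFDerivAt (fun y : ℂ => F' (‖y‖ ^ 2)) (F'' • (2 • innerSL ℝ x)) x :=
    hF'.comp_hasFDerivAt x (hn x)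
  have h3 : HasFDerivAt (fun y : ℂ => (2 : ℝ) • innerSL ℝ y)
      ((2 : ℝ) • (innerSL ℝ : ℂ →L[ℝ] ℂ →L[ℝ] ℝ)) x :=
    ((innerSL ℝ : ℂ →L[ℝ] ℂ →L[ℝ] ℝ).hasFDerivAt).const_smul (2 : ℝ)
  rw [laplacian_eq_fderiv_fderiv, h1.fderiv_eq, (h2.fun_smul h3).fderiv]
  have e : ‖x‖ ^ 2 = x.re * x.re + x.im * x.im := by
    rw [Complex.sq_norm, Complex.normSq_apply]
  have e1 : (innerSL ℝ (1 : ℂ)) (1 : ℂ) = 1 := by rw [innerSL_apply_apply]; simp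
  have e2 : (innerSL ℝ Complex.I) Complex.I = 1 := by rw [innerSL_apply_apply]; simp
  simp [Complex.inner, e, e1, e2]
  ring

/-- The conformal covariance of the Laplacian. -/
lemma laplacian_comp_holomorphic {Φ : ℂ → ℝ} (hΦ : ContDiff ℝ 2 Φ) {g g' : ℂ → ℂ} {g'' x : ℂ}
    (hg : ∀ y, HasDerivAt g (g' y) y) (hg' : HasDerivAt g' g'' x) :
    Δ (fun y => Φ (g y)) x = ‖g' x‖ ^ 2 * Δ Φ (g x) := by
  have hd : ∀ y, HasFDerivAt Φ (fderiv ℝ Φ y) y := fun y =>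
    (hΦ.differentiable (by norm_num) y).hasFDerivAt
  have hd2 : ∀ y, HasFDerivAt (fderiv ℝ Φ) (fderiv ℝ (fderiv ℝ Φ) y) y := fun y =>
    ((hΦ.fderiv_right (m := 1) (by norm_num)).differentiable (by norm_num) y).hasFDerivAt
  have hgr : ∀ y, HasFDerivAt g ((g' y) • (1 : ℂ →L[ℝ] ℂ)) y := fun y =>
    (hg y).complexToReal_fderiv
  have h1 : fderiv ℝ (fun y => Φ (g y)) =
      fun y => (fderiv ℝ Φ (g y)).comp ((g' y) • (1 : ℂ →L[ℝ] ℂ)) := by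
    ext1 y
    exact ((hd (g y)).comp y (hgr y)).fderiv
  have hsm : HasFDerivAt (fun y => (g' y) • (1 : ℂ →L[ℝ] ℂ))
      ((g'' • (1 : ℂ →L[ℝ] ℂ)).smulRight (1 : ℂ →L[ℝ] ℂ)) x :=
    hg'.complexToReal_fderiv.smul_const (1 : ℂ →L[ℝ] ℂ)
  have h2 := ((hd2 (g x)).comp x (hgr x)).clm_comp hsm
  simp only [Function.comp_def] at h2
  rw [laplacian_eq_fderiv_fderiv, h1, h2.fderiv, laplacian_eq_fderiv_fderiv]
  set B := fderiv ℝ (fderiv ℝ Φ) (g x)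
  set L := fderiv ℝ Φ (g x)
  have e1 : g' x = (g' x).re • (1 : ℂ) + (g' x).im • Complex.I := by
    simp [Complex.re_add_im]
  have e2 : g' x * Complex.I = (-(g' x).im) • (1 : ℂ) + (g' x).re • Complex.I := by
    apply Complex.ext <;> simp
  have e3 : L (g'' * Complex.I * Complex.I) = - L g'' := by
    rw [mul_assoc, Complex.I_mul_I, mul_neg, mul_one, map_neg]
  have e4 : ‖g' x‖ ^ 2 = (g' x).re * (g' x).re + (g' x).im * (g' x).im := by
    rw [Complex.sq_norm, Complex.normSq_apply]
  simp only [_root_.add_apply, ContinuousLinearMap.comp_apply,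
    ContinuousLinearMap.compL_apply, ContinuousLinearMap.flip_apply,
    _root_.smul_apply, ContinuousLinearMap.smulRight_apply,
    one_apply_eq_self, smul_eq_mul, mul_one, e3, e4]
  rw [e2]
  generalize (g' x).re = a at *
  generalize (g' x).im = b at *
  rw [e1]
  simp only [map_add, map_smul, _root_.add_apply, _root_.smul_apply,
    smul_eq_mul]
  ring

/-! ### The Dirichlet projection and the regular part of the Green function -/

lemma isDirichletProjection_proj {Ω : Set ℂ} (h : IsSmoothBoundedDomain Ω) {φ : ℂ → ℝ}
    (hφ : ContDiff ℝ 2 φ) : IsDirichletProjection Ω φ (proj Ω φ) := by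
  apply Classical.epsilon_spec (p := IsDirichletProjection Ω φ)
  obtain ⟨u, hu, huc, hub⟩ := exists_harmonic_extension h (φ := φ) hφ.continuous.continuousOn
  refine ⟨φ - u, hφ.contDiffOn.sub hu.contDiffOn, hφ.continuous.continuousOn.sub huc, ?_, ?_⟩
  · intro x hx
    rw [ContDiffAt.laplacian_sub hφ.contDiffAt (hu x hx).1, (hu x hx).2.eq_of_nhds]
    simp
  · intro x hx
    simp [hub x hx]

/-- `φ - P φ` is the harmonic function with the boundary values of `φ`. -/
lemma harmonicOnNhd_sub_proj {Ω : Set ℂ} (h : IsSmoothBoundedDomain Ω) {φ : ℂ → ℝ}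
    (hφ : ContDiff ℝ 2 φ) : HarmonicOnNhd (φ - proj Ω φ) Ω := by
  have hp := isDirichletProjection_proj h hφ
  have hca : ∀ x ∈ Ω, ContDiffAt ℝ 2 (proj Ω φ) x := fun x hx =>
    hp.contDiffOn.contDiffAt (h.isOpen.mem_nhds hx)
  intro x hx
  refine ⟨hφ.contDiffAt.sub (hca x hx), ?_⟩
  filter_upwards [h.isOpen.mem_nhds hx] with y hy
  rw [ContDiffAt.laplacian_sub hφ.contDiffAt (hca y hy)]
  have := hp.laplacian_eq y hy
  simp only [Pi.zero_apply]
  linarith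

/-- Comparison of `P φ` with `φ` corrected by a multiple of a fixed harmonic function. -/
lemma abs_proj_sub_le {Ω : Set ℂ} (h : IsSmoothBoundedDomain Ω) {φ H : ℂ → ℝ}
    (hφ : ContDiff ℝ 2 φ) (hH : HarmonicOnNhd H Ω) (hHc : ContinuousOn H (closure Ω)) {a c M : ℝ}
    (hM : ∀ x ∈ frontier Ω, |φ x - (a + c * H x)| ≤ M) :
    ∀ x ∈ closure Ω, |proj Ω φ x - (φ x - (a + c * H x))| ≤ M := by
  have hp := isDirichletProjection_proj h hφ
  intro x hx
  have := abs_sub_le_of_frontier h.isOpen h.isBounded (harmonicOnNhd_sub_proj h hφ)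
    (hφ.continuous.continuousOn.sub hp.continuousOn) (h := fun x => a + c * H x)
    ((harmonicOnNhd_const a).add (hH.const_smul (c := c))) (by fun_prop) (M := M)
    (fun x hx => by simpa [hp.boundary x hx] using hM x hx) x hx
  rw [← abs_neg] at this
  convert this using 2
  simp only [Pi.sub_apply]
  ring

lemma zero_notMem_frontier {Ω : Set ℂ} (h : IsSmoothBoundedDomain Ω) (h0 : (0 : ℂ) ∈ Ω) :
    (0 : ℂ) ∉ frontier Ω := fun hf => (h.isOpen.frontier_eq ▸ hf).2 h0

lemma isGreenRegularPart_zero {Ω : Set ℂ} (h : IsSmoothBoundedDomain Ω) (h0 : (0 : ℂ) ∈ Ω) :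
    IsGreenRegularPart Ω 0 fun x => greenRegularPart Ω x 0 := by
  apply Classical.epsilon_spec (p := IsGreenRegularPart Ω 0)
  have hne : ∀ x ∈ frontier Ω, ‖x - 0‖ ≠ 0 := fun x hx h => by
    rw [sub_zero, norm_eq_zero] at h
    exact zero_notMem_frontier ‹_› h0 (h ▸ hx)
  obtain ⟨u, hu, huc, hub⟩ := exists_harmonic_extension h
    (φ := fun x => 1 / (2 * Real.pi) * Real.log ‖x - 0‖) (by fun_prop (disch := assumption))
  exact ⟨u, hu, huc, hub⟩

lemma exists_norm_bounds {Ω : Set ℂ} (h : IsSmoothBoundedDomain Ω) (h0 : (0 : ℂ) ∈ Ω) :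
    ∃ d D : ℝ, 0 < d ∧ d ≤ 1 ∧ 1 ≤ D ∧ (∀ x ∈ frontier Ω, d ≤ ‖x‖) ∧ ∀ x ∈ closure Ω, ‖x‖ ≤ D := by
  obtain ⟨D, hD⟩ := h.isBounded.closure.exists_norm_le
  obtain ⟨d, hd, hball⟩ := Metric.isOpen_iff.1 h.isOpen 0 h0
  refine ⟨min d 1, max D 1, by positivity, min_le_right _ _, le_max_right _ _, fun x hx => ?_,
    fun x hx => (hD x hx).trans (le_max_left _ _)⟩
  by_contra! hlt
  exact (h.isOpen.frontier_eq ▸ hx).2 (hball (by simpa using hlt.trans_le (min_le_left _ _)))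

lemma exists_green_lipschitz {Ω : Set ℂ} (h : IsSmoothBoundedDomain Ω) (h0 : (0 : ℂ) ∈ Ω) :
    ∃ K : ℝ, 0 < K ∧ (∀ x ∈ closure Ω, |greenRegularPart Ω x 0| ≤ K) ∧
      ∀ x ∈ closure Ω, |greenRegularPart Ω x 0 - greenRegularPart Ω 0 0| ≤ K * ‖x‖ := by
  have hG := isGreenRegularPart_zero h h0
  set H : ℂ → ℝ := fun x => greenRegularPart Ω x 0 with hH
  obtain ⟨A, hA⟩ := h.isBounded.isCompact_closure.exists_bound_of_continuousOn hG.continuousOn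
  have hA0 : 0 ≤ A := (norm_nonneg _).trans (hA 0 (subset_closure h0))
  obtain ⟨L, t, ht, hL⟩ :=
    (((hG.harmonic 0 h0).1).of_le (m := 1) (by norm_num)).exists_lipschitzOnWith
  obtain ⟨δ, hδ, hδt⟩ := Metric.mem_nhds_iff.1 ht
  have hdiv : 0 ≤ 2 * A / δ := by positivity
  refine ⟨A + L + 2 * A / δ + 1, by positivity, fun x hx => ?_, fun x hx => ?_⟩
  · have := hA x hx
    rw [Real.norm_eq_abs] at this
    have : (0 : ℝ) ≤ L := L.2
    linarith
  · by_cases hxδ : ‖x‖ < δ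
    · have h1 := hL.dist_le_mul x (hδt (by simpa using hxδ)) 0 (hδt (mem_ball_self hδ))
      rw [Real.dist_eq, dist_zero_right] at h1
      refine h1.trans (mul_le_mul_of_nonneg_right ?_ (norm_nonneg _))
      linarith
    · have h1 := hA x hx
      have h2 := hA 0 (subset_closure h0)
      rw [Real.norm_eq_abs] at h1 h2
      have h3 : 2 * A ≤ 2 * A / δ * ‖x‖ := by
        rw [div_mul_eq_mul_div, le_div_iff₀ hδ]
        exact mul_le_mul_of_nonneg_left (not_lt.1 hxδ) (by positivity)
      have h4 := abs_sub (H x) (H 0)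
      have h5 : 2 * A / δ * ‖x‖ ≤ (A + L + 2 * A / δ + 1) * ‖x‖ :=
        mul_le_mul_of_nonneg_right (by linarith [L.2, show (0 : ℝ) ≤ L from L.2]) (norm_nonneg _)
      linarith

open MeasureTheory

/-! ### Uniqueness of the profiles -/

/-- The radial homogeneous equation in the variable `s = ‖x‖²` has the solutions
`ψ₀ = (s - 1) / (s + 1)` and `ψ₁ = ½ ψ₀ log s - 1`. A solution is a combination of them by constancy
of the two Wronskians, and it vanishes if it decays, since `ψ₁` is unbounded and `ψ₀ → 1`. -/
lemma eq_zero_of_homogeneous {G G' G'' : ℝ → ℝ} (hG : ∀ s > 0, HasDerivAt G (G' s) s)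
    (hG' : ∀ s > 0, HasDerivAt G' (G'' s) s)
    (heq : ∀ s > 0, s * G'' s + G' s = -2 / (1 + s) ^ 2 * G s) (hlim : Tendsto G atTop (𝓝 0)) :
    ∀ s > 0, G s = 0 := by
  set ψ₀ : ℝ → ℝ := fun s => (s - 1) / (s + 1) with hψ₀
  set ψ₀' : ℝ → ℝ := fun s => 2 / (s + 1) ^ 2 with hψ₀'
  set ψ₁ : ℝ → ℝ := fun s => 1 / 2 * (ψ₀ s * Real.log s) - 1 with hψ₁
  set ψ₁' : ℝ → ℝ := fun s => 1 / 2 * (ψ₀' s * Real.log s + ψ₀ s * s⁻¹) with hψ₁'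
  have d0 : ∀ s > 0, HasDerivAt ψ₀ (ψ₀' s) s := fun s hs => by
    have hne : s + 1 ≠ 0 := by positivity
    convert! ((hasDerivAt_id s).sub_const 1).div ((hasDerivAt_id s).add_const 1) hne using 1
    simp only [hψ₀', id]; ring
  have d0' : ∀ s > 0, HasDerivAt ψ₀' (-4 / (s + 1) ^ 3) s := fun s hs => by
    have hne : (s + 1) ≠ 0 := by positivity
    convert! (((hasDerivAt_id s).add_const 1).pow 2).inv (pow_ne_zero 2 hne) |>.const_mul 2 using 1
    simp only [id, Pi.pow_apply]; field_simp; norm_num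
  have d1 : ∀ s > 0, HasDerivAt ψ₁ (ψ₁' s) s := fun s hs =>
    (((d0 s hs).mul (Real.hasDerivAt_log hs.ne')).const_mul (1 / 2)).sub_const 1
  have d1' : ∀ s > 0, HasDerivAt ψ₁' (1 / 2 * ((-4 / (s + 1) ^ 3 * Real.log s + ψ₀' s * s⁻¹)
      + (ψ₀' s * s⁻¹ + ψ₀ s * -(s ^ 2)⁻¹))) s := fun s hs =>
    (((d0' s hs).mul (Real.hasDerivAt_log hs.ne')).add
      ((d0 s hs).mul (hasDerivAt_inv hs.ne'))).const_mul (1 / 2)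
  -- the two Wronskians are constant
  have const : ∀ (w : ℝ → ℝ), (∀ s > 0, HasDerivAt w 0 s) → ∀ s > 0, w s = w 1 := by
    intro w hw s hs
    exact (isOpen_Ioi (a := (0 : ℝ))).is_const_of_deriv_eq_zero isPreconnected_Ioi
      (fun x hx => (hw x hx).differentiableAt.differentiableWithinAt)
      (fun x hx => (hw x hx).deriv) hs (mem_Ioi.2 one_pos)
  have w0 := const (fun s => s * (ψ₀ s * G' s - ψ₀' s * G s)) fun s hs => by
    convert! (hasDerivAt_id s).mul (((d0 s hs).mul (hG' s hs)).sub ((d0' s hs).mul (hG s hs)))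
      using 1
    have := heq s hs
    have e : s * G'' s = -2 / (1 + s) ^ 2 * G s - G' s := by linarith
    have hne : (1 + s) ≠ 0 := by positivity
    have hne' : (s + 1) ≠ 0 := by positivity
    simp only [id, Pi.sub_apply, Pi.mul_apply]
    trans (1 * (ψ₀ s * G' s - ψ₀' s * G s) + (s * (ψ₀' s * G' s)
      + ψ₀ s * (s * G'' s) - s * (-4 / (s + 1) ^ 3 * G s + ψ₀' s * G' s)))
    · rw [e]
      simp only [hψ₀, hψ₀']
      rw [add_comm 1 s]
      field_simp
      ring
    · ring
  have w1 := const (fun s => s * (ψ₁ s * G' s - ψ₁' s * G s)) fun s hs => by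
    convert! (hasDerivAt_id s).mul (((d1 s hs).mul (hG' s hs)).sub ((d1' s hs).mul (hG s hs)))
      using 1
    have := heq s hs
    have e : s * G'' s = -2 / (1 + s) ^ 2 * G s - G' s := by linarith
    have hne' : (s + 1) ≠ 0 := by positivity
    have hs' : s ≠ 0 := hs.ne'
    simp only [id, Pi.sub_apply, Pi.mul_apply]
    trans (1 * (ψ₁ s * G' s - ψ₁' s * G s) + (s * (ψ₁' s * G' s)
      + ψ₁ s * (s * G'' s) - s * ((1 / 2 * ((-4 / (s + 1) ^ 3 * Real.log s + ψ₀' s * s⁻¹)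
      + (ψ₀' s * s⁻¹ + ψ₀ s * -(s ^ 2)⁻¹))) * G s + ψ₁' s * G' s)))
    · rw [e]
      simp only [hψ₁, hψ₁', hψ₀, hψ₀']
      rw [add_comm 1 s]
      field_simp
      ring
    · ring
  set a := (1 : ℝ) * (ψ₀ 1 * G' 1 - ψ₀' 1 * G 1)
  set b := (1 : ℝ) * (ψ₁ 1 * G' 1 - ψ₁' 1 * G 1)
  have hcomb : ∀ s > 0, G s = 2 * (ψ₁ s * a - ψ₀ s * b) := fun s hs => by
    rw [← w0 s hs, ← w1 s hs]
    simp only [hψ₁, hψ₁', hψ₀, hψ₀']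
    have hne' : (s + 1) ≠ 0 := by positivity
    have hs' : s ≠ 0 := hs.ne'
    field_simp
    ring
  have hψlim : Tendsto ψ₀ atTop (𝓝 1) := by
    have h1 : Tendsto (fun s : ℝ => 1 - 2 * (s + 1)⁻¹) atTop (𝓝 (1 - 2 * 0)) :=
      ((tendsto_inv_atTop_zero.comp (tendsto_atTop_add_const_right atTop 1 tendsto_id)).const_mul
        2).const_sub 1
    rw [mul_zero, sub_zero] at h1
    refine h1.congr' ?_
    filter_upwards [eventually_gt_atTop 0] with s hs
    simp only [hψ₀]
    have hne' : (s + 1) ≠ 0 := by positivity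
    field_simp
    ring
  have hloginv : Tendsto (fun s : ℝ => (Real.log s)⁻¹) atTop (𝓝 0) :=
    tendsto_inv_atTop_zero.comp Real.tendsto_log_atTop
  have ha : a = 0 := by
    have h1 : Tendsto (fun s => G s * (Real.log s)⁻¹) atTop (𝓝 (0 * 0)) := hlim.mul hloginv
    have h2 : Tendsto (fun s => ψ₀ s * a - (2 * a + 2 * (ψ₀ s * b)) * (Real.log s)⁻¹) atTop
        (𝓝 (1 * a - (2 * a + 2 * (1 * b)) * 0)) :=
      (hψlim.mul_const a).sub ((((hψlim.mul_const b).const_mul 2).const_add (2 * a)).mul hloginv)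
    have h3 := tendsto_nhds_unique_of_eventuallyEq h1 h2 (by
      filter_upwards [eventually_gt_atTop 1] with s hs
      have hl : Real.log s ≠ 0 := (Real.log_pos hs).ne'
      rw [hcomb s (by linarith)]
      simp only [hψ₁]
      field_simp
      ring)
    linarith
  have hb : b = 0 := by
    have h2 : Tendsto (fun s => -2 * (ψ₀ s * b)) atTop (𝓝 (-2 * (1 * b))) :=
      (hψlim.mul_const b).const_mul (-2)
    have h3 := tendsto_nhds_unique_of_eventuallyEq hlim h2 (by
      filter_upwards [eventually_gt_atTop 0] with s hs
      rw [hcomb s hs, ha]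
      ring)
    linarith
  intro s hs
  rw [hcomb s hs, ha, hb]
  ring

lemma exp_bubble (x : ℂ) : Real.exp (bubble x) = 8 / (‖x‖ ^ 2 + 1) ^ 2 := by
  rw [bubble, Real.exp_log (by positivity)]

/-- A radial `C²` function as a function of `s = ‖x‖²`. -/
lemma exists_radial_derivs {Φ : ℂ → ℝ} (h : ContDiff ℝ 2 Φ)
    (hr : ∀ x y : ℂ, ‖x‖ = ‖y‖ → Φ x = Φ y) :
    ∃ G G' G'' : ℝ → ℝ, (∀ x, Φ x = G (‖x‖ ^ 2)) ∧ (∀ s > 0, HasDerivAt G (G' s) s) ∧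
      ∀ s > 0, HasDerivAt G' (G'' s) s := by
  set G : ℝ → ℝ := fun s => Φ ((Real.sqrt s : ℝ) : ℂ) with hG
  have hc : ContDiffOn ℝ 2 G (Ioi 0) := by
    intro s hs
    have h1 : ContDiffAt ℝ 2 (fun s : ℝ => ((Real.sqrt s : ℝ) : ℂ)) s :=
      Complex.ofRealCLM.contDiff.contDiffAt.comp s (Real.contDiffAt_sqrt (ne_of_gt hs))
    exact (h.contDiffAt.comp s h1).contDiffWithinAt
  have hd1 : ContDiffOn ℝ 1 (deriv G) (Ioi 0) := hc.deriv_of_isOpen isOpen_Ioi (by norm_num)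
  refine ⟨G, deriv G, deriv (deriv G), fun x => ?_, fun s hs => ?_, fun s hs => ?_⟩
  · apply hr
    rw [Real.sqrt_sq (norm_nonneg _)]
    simp
  · exact ((hc.differentiableOn (by norm_num)).differentiableAt (Ioi_mem_nhds hs)).hasDerivAt
  · exact ((hd1.differentiableOn (by norm_num)).differentiableAt (Ioi_mem_nhds hs)).hasDerivAt

theorem IsProfile.unique {g Φ Ψ : ℂ → ℝ} (h₁ : IsProfile g Φ) (h₂ : IsProfile g Ψ) : Φ = Ψ := by
  obtain ⟨G, G', G'', hG, hd, hd'⟩ := exists_radial_derivs (h₁.contDiff.sub h₂.contDiff)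
    (fun x y hxy => by rw [h₁.radial x y hxy, h₂.radial x y hxy])
  have hfun : (Φ - Ψ) = fun x => G (‖x‖ ^ 2) := by
    ext x; exact hG x
  have hsq : ∀ s > 0, ‖((Real.sqrt s : ℝ) : ℂ)‖ ^ 2 = s := fun s hs => by
    rw [Complex.norm_real, Real.norm_eq_abs, sq_abs, Real.sq_sqrt hs.le]
  have h0 : ∀ s > 0, G s = 0 := by
    refine eq_zero_of_homogeneous hd hd' (fun s hs => ?_) ?_
    · set x : ℂ := ((Real.sqrt s : ℝ) : ℂ) with hx
      have hxs := hsq s hs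
      have e1 := laplacian_comp_norm_sq (F := G) (F' := G') (F'' := G'' s) (x := x)
        (by rw [hxs]; filter_upwards [Ioi_mem_nhds hs] with t ht using hd t ht)
        (by rw [hxs]; exact hd' s hs)
      rw [← hfun, ContDiffAt.laplacian_sub h₁.contDiff.contDiffAt h₂.contDiff.contDiffAt, hxs] at e1
      have e2 := h₁.equation x
      have e3 := h₂.equation x
      rw [exp_bubble, hxs] at e2 e3
      have e4 : G s = Φ x - Ψ x := by
        have := hG x
        rw [hxs] at this
        rw [← this]
      have hne : 1 + s ≠ 0 := by positivity
      have e5 : 4 * (s * G'' s + G' s) = - (8 / (s + 1) ^ 2) * G s := by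
        rw [e4, ← e1]
        linarith
      have : s * G'' s + G' s = - (8 / (s + 1) ^ 2) * G s / 4 := by linarith
      rw [this, add_comm s 1]
      field_simp
      ring
    · have ha := h₁.asymptotic.sub h₂.asymptotic
      have hb : Tendsto (fun x : ℂ => ‖x‖⁻¹) (cobounded ℂ) (𝓝 0) :=
        tendsto_inv_atTop_zero.comp tendsto_norm_cobounded_atTop
      have hc := ha.trans_tendsto hb
      have hsqrt : Tendsto (fun s : ℝ => ((Real.sqrt s : ℝ) : ℂ)) atTop (cobounded ℂ) := by
        rw [← tendsto_norm_atTop_iff_cobounded]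
        refine Real.tendsto_sqrt_atTop.congr fun s => ?_
        simp [abs_of_nonneg (Real.sqrt_nonneg s)]
      refine (hc.comp hsqrt).congr' ?_
      filter_upwards [eventually_gt_atTop 0] with s hs
      have := hG ((Real.sqrt s : ℝ) : ℂ)
      rw [hsq s hs] at this
      rw [← this]
      simp
  ext x
  have hd : Continuous (Φ - Ψ) := h₁.contDiff.continuous.sub h₂.contDiff.continuous
  have : (Φ - Ψ) = fun _ => 0 := by
    refine hd.ext_on (s := {0}ᶜ) (dense_compl_singleton 0) continuous_const fun y hy => ?_
    rw [hfun]
    exact h0 _ (by have := norm_pos_iff.2 hy; positivity)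
  have := congrFun this x
  simp only [Pi.sub_apply] at this
  linarith

/-! ### Existence of the profiles -/

/-- A positive smooth function on the line that equals `1 + s` for `s > -1/4`: it lets the radial
functions below be defined and smooth on the whole line. -/
def onePlus (s : ℝ) : ℝ := 1 + s * Real.smoothTransition (4 * s + 2)

lemma onePlus_eq {s : ℝ} (hs : -1 / 4 ≤ s) : onePlus s = 1 + s := by
  rw [onePlus, Real.smoothTransition.one_of_one_le (by linarith), mul_one]

lemma onePlus_pos (s : ℝ) : 0 < onePlus s := by
  unfold onePlus
  rcases le_total s (-1 / 2) with h | h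
  · rw [Real.smoothTransition.zero_of_nonpos (by linarith)]; norm_num
  · have h0 := Real.smoothTransition.nonneg (4 * s + 2)
    have h1 := Real.smoothTransition.le_one (4 * s + 2)
    nlinarith

lemma contDiff_onePlus {n : ℕ∞} : ContDiff ℝ n onePlus := by
  unfold onePlus
  exact contDiff_const.add (contDiff_id.mul (Real.smoothTransition.contDiff.comp (by fun_prop)))

lemma contDiff_one_average {q : ℝ → ℝ} (hq : ContDiff ℝ 1 q) :
    ContDiff ℝ 1 fun s => ∫ θ in (0 : ℝ)..1, q (θ * s) := by
  have hdq : Continuous (deriv q) := hq.continuous_deriv le_rfl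
  have hder : ∀ s, HasDerivAt (fun s => ∫ θ in (0 : ℝ)..1, q (θ * s))
      (∫ θ in (0 : ℝ)..1, θ * deriv q (θ * s)) s := by
    intro s
    obtain ⟨M, hM⟩ := (isCompact_closedBall (0 : ℝ) (|s| + 1)).exists_bound_of_continuousOn
      hdq.continuousOn
    refine (intervalIntegral.hasDerivAt_integral_of_dominated_loc_of_deriv_le
      (F := fun s θ => q (θ * s)) (F' := fun s θ => θ * deriv q (θ * s)) (bound := fun _ => M)
      (ball_mem_nhds s one_pos) (.of_forall fun x => ?_) ?_ ?_ (.of_forall fun θ hθ x hx => ?_)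
      intervalIntegrable_const (.of_forall fun θ hθ x hx => ?_)).2
    · exact (hq.continuous.comp (by fun_prop)).aestronglyMeasurable
    · exact (hq.continuous.comp (by fun_prop)).intervalIntegrable _ _
    · exact (continuous_id.mul (hdq.comp (by fun_prop))).aestronglyMeasurable
    · rw [uIoc_of_le zero_le_one] at hθ
      have h1 : |θ| ≤ 1 := by rw [abs_of_pos hθ.1]; exact hθ.2
      have h2 : |x| ≤ |s| + 1 := by
        have := mem_ball.1 hx
        rw [Real.dist_eq] at this
        have := abs_sub_abs_le_abs_sub x s
        linarith
      have h3 := hM (θ * x) (by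
        rw [mem_closedBall, dist_zero_right, Real.norm_eq_abs, abs_mul]
        nlinarith [abs_nonneg x, abs_nonneg θ])
      rw [norm_mul, Real.norm_eq_abs]
      nlinarith [norm_nonneg (deriv q (θ * x))]
    · have h1 := (hq.differentiable (by norm_num) (θ * x)).hasDerivAt
      have h2 := h1.comp x ((hasDerivAt_id x).const_mul θ)
      rw [mul_one, mul_comm] at h2
      exact h2
  rw [contDiff_one_iff_deriv]
  refine ⟨fun s => (hder s).differentiableAt, ?_⟩
  have : deriv (fun s => ∫ θ in (0 : ℝ)..1, q (θ * s)) =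
      fun s => ∫ θ in (0 : ℝ)..1, θ * deriv q (θ * s) := funext fun s => (hder s).deriv
  rw [this]
  apply intervalIntegral.continuous_parametric_intervalIntegral_of_continuous'
  simp only [Function.uncurry_def]
  exact continuous_snd.mul (hdq.comp (by fun_prop))

/-- Tails of integrands of size `t ^ (-3/2)`. -/
lemma tail_bound {f : ℝ → ℝ} (hf : Continuous f) {K : ℝ}
    (hK : ∀ t ≥ 1, |f t| ≤ K * t ^ (-3 / 2 : ℝ)) :
    IntegrableOn f (Ioi 1) ∧
      ∀ s ≥ 1, |(∫ t in (1 : ℝ)..s, f t) - ∫ t in Ioi 1, f t| ≤ 2 * K * s ^ (-1 / 2 : ℝ) := by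
  have hint : ∀ s ≥ (1 : ℝ), IntegrableOn (fun t : ℝ => K * t ^ (-3 / 2 : ℝ)) (Ioi s) :=
    fun s hs => (integrableOn_Ioi_rpow_of_lt (by norm_num) (by linarith)).const_mul K
  have hfi : ∀ s ≥ (1 : ℝ), IntegrableOn f (Ioi s) := fun s hs => by
    refine (hint s hs).mono' hf.aestronglyMeasurable ?_
    filter_upwards [ae_restrict_mem measurableSet_Ioi] with t ht
    exact hK t (hs.le.trans (le_of_lt ht))
  refine ⟨hfi 1 le_rfl, fun s hs => ?_⟩
  have h1 := intervalIntegral.integral_Ioi_sub_Ioi (hfi 1 le_rfl) hs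
  have h2 : (∫ t in (1 : ℝ)..s, f t) - ∫ t in Ioi 1, f t = -∫ t in Ioi s, f t := by
    rw [← h1]; ring
  rw [h2, abs_neg]
  have h3 : ‖∫ t in Ioi s, f t‖ ≤ ∫ t in Ioi s, K * t ^ (-3 / 2 : ℝ) := by
    refine norm_integral_le_of_norm_le (hint s hs) ?_
    filter_upwards [ae_restrict_mem measurableSet_Ioi] with t ht
    exact hK t (hs.le.trans (le_of_lt ht))
  refine (Real.norm_eq_abs _ ▸ h3).trans (le_of_eq ?_)
  rw [integral_const_mul, integral_Ioi_rpow_of_lt (by norm_num) (by linarith)]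
  norm_num
  ring

/-- The logarithmic coefficient in the variable `s = r²`. -/
lemma logCoeff_eq {g : ℂ → ℝ} {q : ℝ → ℝ}
    (hq : ∀ s ≥ 0, ∀ x : ℂ, ‖x‖ ^ 2 = s → q s = (s - 1) / (s + 1) * (4 / (s + 1) ^ 2) * g x) :
    logCoeff g = ∫ s in Ioi (0 : ℝ), q s := by
  rw [logCoeff, ← integral_comp_rpow_Ioi_of_pos (g := q) (p := 2) two_pos]
  refine setIntegral_congr_fun measurableSet_Ioi fun r hr => ?_
  have hr0 : (0 : ℝ) < r := hr
  have e : r ^ (2 : ℝ) = r ^ 2 := by exact_mod_cast Real.rpow_natCast r 2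
  have e' : r ^ ((2 : ℝ) - 1) = r := by norm_num
  have hn : ‖(r : ℂ)‖ = r := by rw [Complex.norm_real, Real.norm_eq_abs, abs_of_pos hr0]
  simp only [smul_eq_mul, e, e']
  rw [hq (r ^ 2) (by positivity) (r : ℂ) (by rw [hn]), exp_bubble, hn]
  ring

theorem exists_profile {g : ℂ → ℝ} {γ : ℝ → ℝ} (hγ : ContDiff ℝ 1 γ)
    (hg : ∀ x, g x = γ (‖x‖ ^ 2)) {K : ℝ} (hK : ∀ s ≥ 0, |γ s| ≤ K * (1 + s) ^ (1 / 2 : ℝ)) :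
    ∃ F : ℝ → ℝ, ContDiff ℝ 2 F ∧ IsProfile g fun x => F (‖x‖ ^ 2) := by
  have hK0 : 0 ≤ K := by simpa using (abs_nonneg _).trans (hK 0 le_rfl)
  set ψ : ℝ → ℝ := fun s => 1 - 2 * (onePlus s)⁻¹ with hψ
  set h : ℝ → ℝ := fun s => 4 * ((onePlus s)⁻¹) ^ 2 * γ s with hh
  have hω {n : ℕ∞} : ContDiff ℝ n fun s => (onePlus s)⁻¹ :=
    contDiff_onePlus.inv fun s => (onePlus_pos s).ne'
  have hψc {n : ℕ∞} : ContDiff ℝ n ψ := contDiff_const.sub (contDiff_const.mul hω)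
  have hhc : ContDiff ℝ 1 h := (contDiff_const.mul ((hω (n := 1)).pow 2)).mul hγ
  set q : ℝ → ℝ := fun s => ψ s * h s with hqdef
  have hqc : ContDiff ℝ 1 q := (hψc (n := 1)).mul hhc
  set B : ℝ → ℝ := fun s => ∫ θ in (0 : ℝ)..1, q (θ * s) with hB
  have hBc : ContDiff ℝ 1 B := contDiff_one_average hqc
  set A : ℝ → ℝ := fun s => ∫ t in (0 : ℝ)..s, q t with hA
  have hAB : ∀ s, A s = s * B s := fun s => by
    rw [hA, hB]
    simp only
    rw [intervalIntegral.mul_integral_comp_mul_right]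
    simp
  have hAd : ∀ s, HasDerivAt A (q s) s := fun s =>
    hqc.continuous.integral_hasStrictDerivAt 0 s |>.hasDerivAt
  have hψpos : ∀ s ≥ 0, ψ s = (s - 1) / (s + 1) := fun s hs => by
    have : s + 1 ≠ 0 := by positivity
    simp only [hψ, onePlus_eq (show -1 / 4 ≤ s by linarith), add_comm 1 s]
    field_simp
    ring
  have hhpos : ∀ s ≥ 0, h s = 4 / (s + 1) ^ 2 * γ s := fun s hs => by
    simp only [hh, onePlus_eq (show -1 / 4 ≤ s by linarith), add_comm 1 s]
    field_simp
  have hhK : ∀ s ≥ 1, |h s| ≤ 4 * K * s ^ (-3 / 2 : ℝ) := fun s hs => by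
    have hs0 : (0 : ℝ) < s + 1 := by linarith
    rw [hhpos s (by linarith), abs_mul, abs_of_pos (by positivity)]
    have h1 := hK s (by linarith)
    rw [add_comm 1 s] at h1
    calc 4 / (s + 1) ^ 2 * |γ s| ≤ 4 / (s + 1) ^ 2 * (K * (s + 1) ^ (1 / 2 : ℝ)) := by gcongr
      _ = 4 * K * (s + 1) ^ (-3 / 2 : ℝ) := by
        rw [show (-3 / 2 : ℝ) = 1 / 2 - (2 : ℕ) by norm_num, Real.rpow_sub_natCast hs0.ne']
        ring
      _ ≤ 4 * K * s ^ (-3 / 2 : ℝ) := by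
        apply mul_le_mul_of_nonneg_left _ (by positivity)
        exact Real.rpow_le_rpow_of_nonpos (by linarith) (by linarith) (by norm_num)
  have hψ1 : ∀ s ≥ 1, |ψ s| ≤ 1 := fun s hs => by
    have hs0 : (0 : ℝ) < s + 1 := by linarith
    rw [hψpos s (by linarith), abs_le, le_div_iff₀ hs0, div_le_iff₀ hs0]
    constructor <;> linarith
  have hqK : ∀ s ≥ 1, |q s| ≤ 4 * K * s ^ (-3 / 2 : ℝ) := fun s hs => by
    rw [hqdef]
    simp only
    rw [abs_mul]
    have := hhK s hs
    nlinarith [hψ1 s hs, abs_nonneg (h s), abs_nonneg (ψ s)]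
  obtain ⟨hqi, hqt⟩ := tail_bound hqc.continuous hqK
  set C := logCoeff g with hC
  have hCq : C = (∫ t in (0 : ℝ)..1, q t) + ∫ t in Ioi 1, q t := by
    rw [hC, logCoeff_eq (q := q) fun s hs x hx => by
      rw [hqdef, hg, hx]; simp only; rw [hψpos s hs, hhpos s hs]; ring]
    have hi : IntegrableOn q (Ioi 0) := by
      rw [← Ioc_union_Ioi_eq_Ioi (zero_le_one' ℝ)]
      exact ((hqc.continuous.intervalIntegrable 0 1).1).union hqi
    have := intervalIntegral.integral_Ioi_sub_Ioi hi (zero_le_one' ℝ)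
    linarith
  have hAC : ∀ s ≥ 1, |A s - C| ≤ 8 * K * s ^ (-1 / 2 : ℝ) := fun s hs => by
    have h1 := hqt s hs
    have h2 : A s = (∫ t in (0 : ℝ)..1, q t) + ∫ t in (1 : ℝ)..s, q t :=
      (intervalIntegral.integral_add_adjacent_intervals (hqc.continuous.intervalIntegrable _ _)
        (hqc.continuous.intervalIntegrable _ _)).symm
    rw [h2, hCq]
    convert h1 using 1
    · congr 1; ring
    · ring
  -- `E` is the integrand of `D` without its logarithmic part
  set E : ℝ → ℝ := fun s => B s / 2 + h s - C / 2 * (max s 1)⁻¹ with hE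
  have hEc : Continuous E := by
    have : ∀ s : ℝ, max s 1 ≠ 0 := fun s => by positivity
    have h1 := hBc.continuous
    have h2 := hhc.continuous
    rw [hE]
    fun_prop (disch := assumption)
  have hEK : ∀ s ≥ 1, |E s| ≤ 8 * K * s ^ (-3 / 2 : ℝ) := fun s hs => by
    have hs0 : (0 : ℝ) < s := by linarith
    have e1 : E s = (A s - C) / (2 * s) + h s := by
      rw [hE]
      simp only
      rw [max_eq_left hs, hAB]
      field_simp
      ring
    have e2 : s ^ (-1 / 2 : ℝ) = s ^ (-3 / 2 : ℝ) * s := by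
      rw [← Real.rpow_add_one hs0.ne']; norm_num
    have h1 : |(A s - C) / (2 * s)| ≤ 4 * K * s ^ (-3 / 2 : ℝ) := by
      rw [abs_div, abs_of_pos (by positivity : 0 < 2 * s), div_le_iff₀ (by positivity)]
      have := hAC s hs
      rw [e2] at this
      linarith
    rw [e1]
    have := abs_add_le ((A s - C) / (2 * s)) (h s)
    linarith [hhK s hs]
  obtain ⟨-, hEt⟩ := tail_bound hEc hEK
  -- the constant `c` cancels the constant term at infinity
  set I₀ := ∫ t in (0 : ℝ)..1, (B t / 2 + h t) with hI₀
  set L := ∫ t in Ioi 1, E t with hL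
  set c : ℝ := C - I₀ - L with hc
  set D : ℝ → ℝ := fun s => c + ∫ t in (0 : ℝ)..s, (B t / 2 + h t) with hD
  have hiC : Continuous fun t => B t / 2 + h t := (hBc.continuous.div_const 2).add hhc.continuous
  have hDd : ∀ s, HasDerivAt D (B s / 2 + h s) s := fun s =>
    (hiC.integral_hasStrictDerivAt 0 s).hasDerivAt.const_add c
  have hDlog : ∀ s ≥ 1, |D s - (C + C / 2 * Real.log s)| ≤ 16 * K * s ^ (-1 / 2 : ℝ) := by
    intro s hs
    have h1 := hEt s hs
    have e1 : ∫ t in (1 : ℝ)..s, E t =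
        (∫ t in (1 : ℝ)..s, (B t / 2 + h t)) - C / 2 * Real.log s := by
      have hmax : ∫ t in (1 : ℝ)..s, C / 2 * (max t 1)⁻¹ = C / 2 * Real.log s := by
        rw [intervalIntegral.integral_const_mul]
        have : ∫ t in (1 : ℝ)..s, (max t 1)⁻¹ = ∫ t in (1 : ℝ)..s, t⁻¹ := by
          apply intervalIntegral.integral_congr
          intro t ht
          rw [uIcc_of_le hs] at ht
          simp only
          rw [max_eq_left ht.1]
        rw [this, integral_inv_of_pos one_pos (by linarith), div_one]
      have hmc : Continuous fun t : ℝ => C / 2 * (max t 1)⁻¹ := by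
        have : ∀ s : ℝ, max s 1 ≠ 0 := fun s => by positivity
        fun_prop (disch := assumption)
      rw [← hmax, hE, intervalIntegral.integral_sub (hiC.intervalIntegrable _ _)
        (hmc.intervalIntegrable _ _)]
    have e2 : ∫ t in (0 : ℝ)..s, (B t / 2 + h t) = I₀ + ∫ t in (1 : ℝ)..s, (B t / 2 + h t) :=
      (intervalIntegral.integral_add_adjacent_intervals (hiC.intervalIntegrable _ _)
        (hiC.intervalIntegrable _ _)).symm
    have e3 : D s - (C + C / 2 * Real.log s) = (∫ t in (1 : ℝ)..s, E t) - L := by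
      rw [hD]
      simp only
      rw [e1, e2, hc]
      ring
    rw [e3]
    linarith
  set F : ℝ → ℝ := fun s => ψ s * D s - A s with hF
  have hA2 : ContDiff ℝ 2 A := by
    rw [show (2 : WithTop ℕ∞) = 1 + 1 by norm_num, contDiff_succ_iff_deriv]
    refine ⟨fun s => (hAd s).differentiableAt, by simp, ?_⟩
    rw [show deriv A = q from funext fun s => (hAd s).deriv]
    exact hqc
  have hD2 : ContDiff ℝ 2 D := by
    rw [show (2 : WithTop ℕ∞) = 1 + 1 by norm_num, contDiff_succ_iff_deriv]
    refine ⟨fun s => (hDd s).differentiableAt, by simp, ?_⟩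
    rw [show deriv D = fun t => B t / 2 + h t from funext fun s => (hDd s).deriv]
    exact (hBc.div_const 2).add hhc
  have hF2 : ContDiff ℝ 2 F := ((hψc (n := 2)).mul hD2).sub hA2
  have hn2 : ContDiff ℝ 2 fun x : ℂ => ‖x‖ ^ 2 := contDiff_norm_sq ℝ
  refine ⟨F, hF2, hF2.comp hn2, fun x y hxy => by simp only [hxy], fun x => ?_, ?_⟩
  · have hs0 : 0 ≤ ‖x‖ ^ 2 := by positivity
    have dψ : ∀ s > (-1 / 4 : ℝ), HasDerivAt ψ (2 / (s + 1) ^ 2) s := fun s hs => by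
      have hne : 1 + s ≠ 0 := by linarith
      have h1 : HasDerivAt (fun s : ℝ => 1 - 2 * (1 + s)⁻¹) (2 / (s + 1) ^ 2) s := by
        convert! ((((hasDerivAt_id s).const_add 1).inv hne).const_mul 2).const_sub 1 using 1
        simp only [id]
        rw [add_comm 1 s]
        ring
      refine h1.congr_of_eventuallyEq ?_
      filter_upwards [Ioi_mem_nhds hs] with t ht
      simp only [hψ, onePlus_eq (le_of_lt ht)]
    have dψ' : ∀ s > (-1 / 4 : ℝ), HasDerivAt (fun s : ℝ => 2 / (s + 1) ^ 2) (-4 / (s + 1) ^ 3) s :=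
      fun s hs => by
        have hne : (s + 1) ≠ 0 := by linarith
        convert! (((hasDerivAt_id s).add_const 1).pow 2).inv (pow_ne_zero 2 hne) |>.const_mul 2
          using 1
        simp only [id, Pi.pow_apply]; field_simp; norm_num
    have dF : ∀ s > (-1 / 4 : ℝ), HasDerivAt F (2 / (s + 1) ^ 2 * D s + ψ s * (B s / 2)) s :=
      fun s hs => by
        convert! ((dψ s hs).mul (hDd s)).sub (hAd s) using 1
        simp only [hqdef]
        ring
    have hBd : ∀ s, HasDerivAt B (deriv B s) s := fun s =>
      (hBc.differentiable (by norm_num) s).hasDerivAt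
    have hBq : ∀ s, s * deriv B s = q s - B s := fun s => by
      have h1 := (hasDerivAt_id s).mul (hBd s)
      have h2 : HasDerivAt (id * B) (q s) s := by
        refine (hAd s).congr_of_eventuallyEq (.of_forall fun t => ?_)
        simp [hAB]
      have := h1.unique h2
      simp only [id] at this
      linarith
    have hs' : (-1 / 4 : ℝ) < ‖x‖ ^ 2 := by linarith
    have dF' := ((dψ' _ hs').mul (hDd _)).add ((dψ _ hs').mul ((hBd (‖x‖ ^ 2)).div_const 2))
    rw [laplacian_comp_norm_sq (F := F)
      (F' := fun s => 2 / (s + 1) ^ 2 * D s + ψ s * (B s / 2))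
      (by filter_upwards [Ioi_mem_nhds hs'] with s hs using dF s hs) dF', exp_bubble, hg]
    have hb := hBq (‖x‖ ^ 2)
    have e1 : F (‖x‖ ^ 2) = ψ (‖x‖ ^ 2) * D (‖x‖ ^ 2) - ‖x‖ ^ 2 * B (‖x‖ ^ 2) := by
      rw [hF, ← hAB]
    have e2 : q (‖x‖ ^ 2) = ψ (‖x‖ ^ 2) * h (‖x‖ ^ 2) := rfl
    rw [e1, hhpos _ hs0]
    rw [e2, hhpos _ hs0] at hb
    rw [hψpos _ hs0] at hb ⊢
    generalize ‖x‖ ^ 2 = s at *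
    have hne : s + 1 ≠ 0 := by positivity
    have hsplit : s * (-4 / (s + 1) ^ 3 * D s + 2 / (s + 1) ^ 2 * (B s / 2 + 4 / (s + 1) ^ 2 * γ s)
        + (2 / (s + 1) ^ 2 * (B s / 2) + (s - 1) / (s + 1) * (deriv B s / 2))) =
        s * (-4 / (s + 1) ^ 3 * D s + 2 / (s + 1) ^ 2 * (B s / 2 + 4 / (s + 1) ^ 2 * γ s)
        + 2 / (s + 1) ^ 2 * (B s / 2)) + (s - 1) / (s + 1) * ((s * deriv B s) / 2) := by ring
    rw [hsplit, hb]
    field_simp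
    ring
  · rw [Asymptotics.isBigO_iff]
    refine ⟨24 * K + 4 * |C|, ?_⟩
    have hev : ∀ᶠ x : ℂ in cobounded ℂ, 1 ≤ ‖x‖ :=
      tendsto_norm_cobounded_atTop.eventually_ge_atTop 1
    filter_upwards [hev] with x hx
    have hx0 : 0 < ‖x‖ := by linarith
    have hs1 : 1 ≤ ‖x‖ ^ 2 := one_le_pow₀ hx
    have er : (‖x‖ ^ 2) ^ (-1 / 2 : ℝ) = ‖x‖⁻¹ := by
      rw [← Real.rpow_natCast, ← Real.rpow_mul hx0.le]
      norm_num
      exact Real.rpow_neg_one _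
    have h1 := hAC _ hs1
    have h2 := hDlog _ hs1
    rw [er] at h1 h2
    rw [Real.log_pow] at h2
    rw [norm_inv, norm_norm, Real.norm_eq_abs]
    set s := ‖x‖ ^ 2 with hs
    set d := D s - (C + C / 2 * ((2 : ℕ) * Real.log ‖x‖)) with hd
    have hlog : Real.log ‖x‖ ≤ ‖x‖ := (Real.log_le_sub_one_of_pos hx0).trans (by linarith)
    have hlog0 : 0 ≤ Real.log ‖x‖ := Real.log_nonneg hx
    have hne : s + 1 ≠ 0 := by positivity
    have e1 : F s - C * Real.log ‖x‖ = -(A s - C) + ψ s * d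
        - 2 / (s + 1) * (C + C * Real.log ‖x‖) := by
      rw [hd]
      simp only [hF]
      rw [hψpos s (by positivity)]
      push_cast
      field_simp
      ring
    have h3 : |2 / (s + 1) * (C + C * Real.log ‖x‖)| ≤ 3 * |C| * ‖x‖⁻¹ + |C| * ‖x‖⁻¹ := by
      have e : 2 / (s + 1) * (C + C * Real.log ‖x‖) =
          2 / (s + 1) * (1 + Real.log ‖x‖) * C := by ring
      rw [e, abs_mul, abs_of_nonneg (by positivity)]
      have : 2 / (s + 1) * (1 + Real.log ‖x‖) ≤ 4 * ‖x‖⁻¹ := by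
        rw [← div_eq_mul_inv, div_mul_eq_mul_div, div_le_div_iff₀ (by positivity) hx0]
        nlinarith
      nlinarith [abs_nonneg C]
    have h4 : |ψ s * d| ≤ 16 * K * ‖x‖⁻¹ := by
      rw [abs_mul]
      nlinarith [hψ1 s hs1, abs_nonneg d, abs_nonneg (ψ s)]
    rw [e1]
    have t1 := abs_sub (-(A s - C) + ψ s * d) (2 / (s + 1) * (C + C * Real.log ‖x‖))
    have t2 := abs_add_le (-(A s - C)) (ψ s * d)
    rw [abs_neg] at t2
    have hinv : 0 < ‖x‖⁻¹ := by positivity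
    have : 0 ≤ K * ‖x‖⁻¹ := by positivity
    have : 0 ≤ |C| * ‖x‖⁻¹ := by positivity
    linarith

/-! ### Growth of the profiles -/

/-- The logarithmic weight in which the profiles are measured. -/
def logWeight (x : ℂ) : ℝ := 1 + Real.log (1 + ‖x‖ ^ 2)

lemma one_le_logWeight (x : ℂ) : 1 ≤ logWeight x := by
  have := Real.log_nonneg (show 1 ≤ 1 + ‖x‖ ^ 2 by nlinarith [sq_nonneg ‖x‖])
  rw [logWeight]; linarith

lemma log_norm_le_logWeight {x : ℂ} (hx : 1 ≤ ‖x‖) : Real.log ‖x‖ ≤ logWeight x := by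
  have := Real.log_le_log (by linarith) (show ‖x‖ ≤ 1 + ‖x‖ ^ 2 by nlinarith)
  rw [logWeight]; linarith

lemma IsProfile.exists_far {g Φ : ℂ → ℝ} (h : IsProfile g Φ) :
    ∃ K, 0 ≤ K ∧ ∀ x : ℂ, 1 ≤ ‖x‖ → |Φ x - (0 + logCoeff g * Real.log ‖x‖)| ≤ K / ‖x‖ := by
  obtain ⟨c, hc⟩ := Asymptotics.isBigO_iff.1 h.asymptotic
  obtain ⟨R, hR⟩ := ((hasBasis_cobounded_norm (E := ℂ)).eventually_iff.1 hc)
  obtain ⟨A, hA⟩ := (isCompact_closedBall (0 : ℂ) R).exists_bound_of_continuousOn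
    h.contDiff.continuous.continuousOn
  refine ⟨|c| + (|A| + |logCoeff g| * |R|) * |R|, by positivity, fun x hx => ?_⟩
  have hx0 : 0 < ‖x‖ := by linarith
  rw [zero_add, le_div_iff₀ hx0]
  have hnn : 0 ≤ (|A| + |logCoeff g| * |R|) * |R| := by positivity
  rcases le_total R ‖x‖ with hRx | hRx
  · have h1 := hR.2 hRx
    rw [Real.norm_eq_abs, norm_inv, norm_norm, ← div_eq_mul_inv, le_div_iff₀ hx0] at h1
    linarith [le_abs_self c]
  · have h1 := hA x (by simpa using hRx)
    rw [Real.norm_eq_abs] at h1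
    have hlog0 := Real.log_nonneg hx
    have hlog : Real.log ‖x‖ ≤ |R| := by
      have := Real.log_le_sub_one_of_pos hx0
      linarith [le_abs_self R]
    have h2 := abs_sub (Φ x) (logCoeff g * Real.log ‖x‖)
    rw [abs_mul, abs_of_nonneg hlog0] at h2
    have h3 : |Φ x - logCoeff g * Real.log ‖x‖| ≤ |A| + |logCoeff g| * |R| := by
      have := mul_le_mul_of_nonneg_left hlog (abs_nonneg (logCoeff g))
      linarith [le_abs_self A]
    have h4 := mul_le_mul h3 (hRx.trans (le_abs_self R)) hx0.le (by positivity)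
    linarith [abs_nonneg c]

lemma exists_growth_of_far {Φ : ℂ → ℝ} (hc : Continuous Φ) {c₀ c₁ K : ℝ} (hK : 0 ≤ K)
    (h : ∀ x : ℂ, 1 ≤ ‖x‖ → |Φ x - (c₀ + c₁ * Real.log ‖x‖)| ≤ K / ‖x‖) :
    ∃ K', 0 < K' ∧ ∀ x, |Φ x| ≤ K' * logWeight x := by
  obtain ⟨A, hA⟩ := (isCompact_closedBall (0 : ℂ) 1).exists_bound_of_continuousOn hc.continuousOn
  refine ⟨|A| + K + |c₀| + |c₁| + 1, by positivity, fun x => ?_⟩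
  have hw := one_le_logWeight x
  rcases le_total ‖x‖ 1 with hx | hx
  · have h1 := hA x (by simpa using hx)
    rw [Real.norm_eq_abs] at h1
    nlinarith [le_abs_self A, abs_nonneg A, abs_nonneg c₀, abs_nonneg c₁]
  · have h1 := h x hx
    have h2 : K / ‖x‖ ≤ K := div_le_self hK hx
    have h3 := log_norm_le_logWeight hx
    have h4 := Real.log_nonneg hx
    have h5 := abs_add_le (Φ x - (c₀ + c₁ * Real.log ‖x‖)) (c₀ + c₁ * Real.log ‖x‖)
    rw [sub_add_cancel] at h5
    have h6 := abs_add_le c₀ (c₁ * Real.log ‖x‖)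
    rw [abs_mul, abs_of_nonneg h4] at h6
    have h7 := mul_le_mul_of_nonneg_left h3 (abs_nonneg c₁)
    nlinarith [abs_nonneg A, abs_nonneg c₀, abs_nonneg c₁]

lemma bubble_far : ∀ x : ℂ, 1 ≤ ‖x‖ →
    |bubble x - (Real.log 8 + (-4) * Real.log ‖x‖)| ≤ 2 / ‖x‖ := by
  intro x hx
  have hx0 : 0 < ‖x‖ := by linarith
  have e : bubble x - (Real.log 8 + (-4) * Real.log ‖x‖) =
      -(2 * Real.log (1 + (‖x‖ ^ 2)⁻¹)) := by
    have : ‖x‖ ^ 2 + 1 = ‖x‖ ^ 2 * (1 + (‖x‖ ^ 2)⁻¹) := by field_simp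
    rw [bubble, Real.log_div (by norm_num) (by positivity), Real.log_pow, this,
      Real.log_mul (by positivity) (by positivity), Real.log_pow]
    push_cast
    ring
  have h0 : 0 < (‖x‖ ^ 2)⁻¹ := by positivity
  have h1 : 0 ≤ Real.log (1 + (‖x‖ ^ 2)⁻¹) := Real.log_nonneg (by linarith)
  have h2 : Real.log (1 + (‖x‖ ^ 2)⁻¹) ≤ (‖x‖ ^ 2)⁻¹ := by
    have := Real.log_le_sub_one_of_pos (show 0 < 1 + (‖x‖ ^ 2)⁻¹ by linarith)
    linarith
  rw [e, abs_neg, abs_of_nonneg (by positivity)]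
  have h3 : (‖x‖ ^ 2)⁻¹ ≤ 1 / ‖x‖ := by
    rw [← one_div]
    exact one_div_le_one_div_of_le hx0 (by nlinarith)
  calc 2 * Real.log (1 + (‖x‖ ^ 2)⁻¹) ≤ 2 * (1 / ‖x‖) := by linarith
    _ = 2 / ‖x‖ := by ring

lemma contDiff_bubble : ContDiff ℝ 2 bubble := by
  unfold bubble
  have h1 : ContDiff ℝ 2 fun x : ℂ => ‖x‖ ^ 2 := contDiff_norm_sq ℝ
  have h2 : ∀ x : ℂ, (‖x‖ ^ 2 + 1) ^ 2 ≠ 0 := fun x => by positivity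
  exact ((contDiff_const.div ((h1.add contDiff_const).pow 2) h2).log fun x =>
    (by positivity : (8 : ℝ) / (‖x‖ ^ 2 + 1) ^ 2 ≠ 0))

lemma laplacian_bubble (x : ℂ) : Δ bubble x = -Real.exp (bubble x) := by
  have hd : ∀ s > (-1 : ℝ),
      HasDerivAt (fun s : ℝ => Real.log (8 / (s + 1) ^ 2)) (-2 * (s + 1)⁻¹) s :=
    fun s hs => by
      have hne : s + 1 ≠ 0 := by linarith
      have hpos : 0 < s + 1 := by linarith
      have h1 : HasDerivAt (fun s : ℝ => Real.log 8 - 2 * Real.log (s + 1)) (-2 * (s + 1)⁻¹) s := by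
        convert! ((((hasDerivAt_id s).add_const 1).log hne).const_mul 2).const_sub (Real.log 8)
          using 1
        simp only [id]; ring
      refine h1.congr_of_eventuallyEq ?_
      filter_upwards [Ioi_mem_nhds hs] with t ht
      have : 0 < t + 1 := by linarith [mem_Ioi.1 ht]
      rw [Real.log_div (by norm_num) (by positivity), Real.log_pow]
      push_cast; ring
  have hs : (-1 : ℝ) < ‖x‖ ^ 2 := by linarith [sq_nonneg ‖x‖]
  have hne : ‖x‖ ^ 2 + 1 ≠ 0 := by positivity
  have hd' : HasDerivAt (fun s : ℝ => -2 * (s + 1)⁻¹) (2 / (‖x‖ ^ 2 + 1) ^ 2) (‖x‖ ^ 2) := by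
    convert! (((hasDerivAt_id (‖x‖ ^ 2)).add_const 1).inv hne).const_mul (-2) using 1
    simp only [id]; ring
  have := laplacian_comp_norm_sq (F := fun s : ℝ => Real.log (8 / (s + 1) ^ 2))
    (F' := fun s => -2 * (s + 1)⁻¹) (x := x)
    (by filter_upwards [Ioi_mem_nhds hs] with s hs using hd s hs) hd'
  rw [exp_bubble]
  change Δ (fun y : ℂ => Real.log (8 / (‖y‖ ^ 2 + 1) ^ 2)) x = _
  rw [this]
  field_simp
  ring

/-- The bubble as a smooth function of `s = ‖x‖²`. -/
def radialBubble (s : ℝ) : ℝ := Real.log (8 / onePlus s ^ 2)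

lemma bubble_eq_radial (x : ℂ) : bubble x = radialBubble (‖x‖ ^ 2) := by
  rw [bubble, radialBubble, onePlus_eq (by linarith [sq_nonneg ‖x‖]), add_comm]

lemma contDiff_radialBubble : ContDiff ℝ 1 radialBubble := by
  unfold radialBubble
  have h2 : ∀ s, onePlus s ^ 2 ≠ 0 := fun s => by have := onePlus_pos s; positivity
  exact (contDiff_const.div ((contDiff_onePlus (n := 1)).pow 2) h2).log fun s =>
    (div_pos (by norm_num) (pow_pos (onePlus_pos s) 2)).ne'

lemma logWeight_le_rpow (x : ℂ) : logWeight x ≤ 9 * (1 + ‖x‖ ^ 2) ^ (1 / 8 : ℝ) := by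
  have h1 := Real.log_le_rpow_div (show 0 ≤ 1 + ‖x‖ ^ 2 by positivity)
    (show (0 : ℝ) < 1 / 8 by norm_num)
  have h2 := Real.one_le_rpow (show 1 ≤ 1 + ‖x‖ ^ 2 by linarith [sq_nonneg ‖x‖])
    (show (0 : ℝ) ≤ 1 / 8 by norm_num)
  rw [logWeight]
  linarith

lemma f₁_le {u a : ℝ} (hu : |u| ≤ a) (ha : 1 ≤ a) : |f₁ u| ≤ a ^ 4 := by
  have h1 : u ^ 2 ≤ a ^ 2 := by rw [← sq_abs]; exact pow_le_pow_left₀ (abs_nonneg u) hu 2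
  have h2 : a ^ 2 ≤ a ^ 4 := pow_le_pow_right₀ ha (by norm_num)
  rw [f₁, abs_of_nonneg (by positivity)]
  linarith [sq_nonneg u]

lemma f₂_le {u v a : ℝ} (hu : |u| ≤ a) (hv : |v| ≤ a) (ha : 1 ≤ a) : |f₂ u v| ≤ 4 * a ^ 4 := by
  have h2 : |u| ^ 2 ≤ a ^ 2 := pow_le_pow_left₀ (abs_nonneg u) hu 2
  have h3 : |u| ^ 3 ≤ a ^ 3 := pow_le_pow_left₀ (abs_nonneg u) hu 3
  have a12 : a ≤ a ^ 2 := by nlinarith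
  have a24 : a ^ 2 ≤ a ^ 4 := pow_le_pow_right₀ ha (by norm_num)
  have a34 : a ^ 3 ≤ a ^ 4 := pow_le_pow_right₀ ha (by norm_num)
  have b1 : |u * v| ≤ a ^ 4 := by
    rw [abs_mul]; nlinarith [abs_nonneg u, abs_nonneg v]
  have b2 : |u ^ 3 / 3| ≤ a ^ 4 := by
    rw [abs_div, abs_pow, abs_of_pos (by norm_num : (0 : ℝ) < 3)]
    linarith [pow_nonneg (abs_nonneg u) 3]
  have b3 : |v - u ^ 2 / 2| ≤ 2 * a ^ 2 := by
    have := abs_sub v (u ^ 2 / 2)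
    rw [abs_div, abs_pow, abs_of_pos (by norm_num : (0 : ℝ) < 2)] at this
    linarith [sq_nonneg a]
  have b4 : |1 / 2 * (v - u ^ 2 / 2) ^ 2| ≤ 2 * a ^ 4 := by
    rw [abs_mul, abs_pow, abs_of_pos (by norm_num : (0 : ℝ) < 1 / 2)]
    have := pow_le_pow_left₀ (abs_nonneg _) b3 2
    nlinarith
  have t1 := abs_sub (u * v - u ^ 3 / 3) (1 / 2 * (v - u ^ 2 / 2) ^ 2)
  have t2 := abs_sub (u * v) (u ^ 3 / 3)
  rw [f₂]
  linarith

lemma exists_bubble_growth : ∃ K, 0 < K ∧ ∀ x, |bubble x| ≤ K * logWeight x :=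
  exists_growth_of_far contDiff_bubble.continuous two_pos.le bubble_far

/-- Quartic expressions in quantities of logarithmic growth are `O((1 + s)^{1/2})`. -/
lemma quartic_growth {K : ℝ} (hK : 0 < K) {s : ℝ} (hs : 0 ≤ s) :
    ∃ x : ℂ, ‖x‖ ^ 2 = s ∧
      ((K + 1) * logWeight x) ^ 4 ≤ ((K + 1) * 9) ^ 4 * (1 + s) ^ (1 / 2 : ℝ) := by
  refine ⟨(Real.sqrt s : ℝ), by simp [Real.sq_sqrt hs], ?_⟩
  have hn : ‖((Real.sqrt s : ℝ) : ℂ)‖ ^ 2 = s := by simp [Real.sq_sqrt hs]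
  have h1 := logWeight_le_rpow ((Real.sqrt s : ℝ) : ℂ)
  have h0 := one_le_logWeight ((Real.sqrt s : ℝ) : ℂ)
  rw [hn] at h1
  have e : ((1 + s) ^ (1 / 8 : ℝ)) ^ 4 = (1 + s) ^ (1 / 2 : ℝ) := by
    rw [← Real.rpow_natCast, ← Real.rpow_mul (by positivity)]
    norm_num
  rw [← e, ← mul_pow]
  apply pow_le_pow_left₀ (by positivity)
  rw [mul_assoc]
  exact mul_le_mul_of_nonneg_left h1 (by positivity)

theorem isProfile_V : IsProfile rhsV V := by
  apply Classical.epsilon_spec (p := IsProfile rhsV)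
  obtain ⟨K, hK, hb⟩ := exists_bubble_growth
  obtain ⟨F, -, hF⟩ := exists_profile (g := rhsV) (γ := fun s => f₁ (radialBubble s))
    ((contDiff_radialBubble.pow 2).div_const 2) (fun x => by rw [rhsV, bubble_eq_radial])
    (K := ((K + 1) * 9) ^ 4) (fun s hs => by
      obtain ⟨x, rfl, hx⟩ := quartic_growth hK hs
      have := one_le_logWeight x
      have h1 := hb x
      rw [bubble_eq_radial] at h1
      exact (f₁_le (h1.trans (by nlinarith)) (by nlinarith)).trans hx)
  exact ⟨_, hF⟩

theorem isProfile_W : IsProfile rhsW W := by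
  apply Classical.epsilon_spec (p := IsProfile rhsW)
  obtain ⟨K₁, hK₁, hb⟩ := exists_bubble_growth
  obtain ⟨K₂, hK₂, hv⟩ := isProfile_V.exists_far
  obtain ⟨K₃, hK₃, hv⟩ := exists_growth_of_far isProfile_V.contDiff.continuous hK₂ hv
  -- the profile `V` as a `C²` function of `s`
  have hVF : ∃ F : ℝ → ℝ, ContDiff ℝ 2 F ∧ ∀ x, V x = F (‖x‖ ^ 2) := by
    obtain ⟨F, hF2, hF⟩ := exists_profile (g := rhsV) (γ := fun s => f₁ (radialBubble s))
      ((contDiff_radialBubble.pow 2).div_const 2) (fun x => by rw [rhsV, bubble_eq_radial])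
      (K := ((K₁ + 1) * 9) ^ 4) (fun s hs => by
        obtain ⟨x, rfl, hx⟩ := quartic_growth hK₁ hs
        have := one_le_logWeight x
        have h1 := hb x
        rw [bubble_eq_radial] at h1
        exact (f₁_le (h1.trans (by nlinarith)) (by nlinarith)).trans hx)
    exact ⟨F, hF2, fun x => congrFun (isProfile_V.unique hF) x⟩
  obtain ⟨F, hF2, hVF⟩ := hVF
  have hF1 : ContDiff ℝ 1 F := hF2.of_le (by norm_num)
  have hγ : ContDiff ℝ 1 fun s => f₂ (radialBubble s) (F s) :=
    ((contDiff_radialBubble.mul hF1).sub ((contDiff_radialBubble.pow 3).div_const 3)).sub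
      (contDiff_const.mul ((hF1.sub ((contDiff_radialBubble.pow 2).div_const 2)).pow 2))
  obtain ⟨F', -, hF'⟩ := exists_profile (g := rhsW) hγ
    (fun x => by rw [rhsW, ← bubble_eq_radial, ← hVF])
    (K := 4 * ((K₁ + K₃ + 1) * 9) ^ 4) (fun s hs => by
      obtain ⟨x, rfl, hx⟩ := quartic_growth (show 0 < K₁ + K₃ by positivity) hs
      have := one_le_logWeight x
      have h1 := hb x
      have h2 := hv x
      rw [bubble_eq_radial] at h1
      rw [hVF] at h2
      refine (f₂_le (h1.trans ?_) (h2.trans ?_) ?_).trans ((mul_le_mul_of_nonneg_left hx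
        (by norm_num : (0 : ℝ) ≤ 4)).trans (le_of_eq (by ring)))
      · nlinarith [mul_nonneg hK₃.le (zero_le_one.trans this)]
      · nlinarith [mul_nonneg hK₁.le (zero_le_one.trans this)]
      · nlinarith [mul_nonneg hK₃.le (zero_le_one.trans this),
          mul_nonneg hK₁.le (zero_le_one.trans this)])
  exact ⟨_, hF'⟩

/-- A common constant for the growth and the far field of `U`, `V` and `W`. -/
lemma exists_profile_bounds : ∃ K, 1 ≤ K ∧ (∀ x, |bubble x| ≤ K * logWeight x) ∧
    (∀ x, |V x| ≤ K * logWeight x) ∧ (∀ x, |W x| ≤ K * logWeight x) ∧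
    (∀ x : ℂ, 1 ≤ ‖x‖ → |bubble x - (Real.log 8 + (-4) * Real.log ‖x‖)| ≤ K / ‖x‖) ∧
    (∀ x : ℂ, 1 ≤ ‖x‖ → |V x - (0 + C₁ * Real.log ‖x‖)| ≤ K / ‖x‖) ∧
    ∀ x : ℂ, 1 ≤ ‖x‖ → |W x - (0 + C₂ * Real.log ‖x‖)| ≤ K / ‖x‖ := by
  obtain ⟨K₁, hK₁, h₁⟩ := exists_bubble_growth
  obtain ⟨K₂, hK₂, h₂⟩ := isProfile_V.exists_far
  obtain ⟨K₃, hK₃, h₃⟩ := isProfile_W.exists_far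
  obtain ⟨K₄, hK₄, h₄⟩ := exists_growth_of_far isProfile_V.contDiff.continuous hK₂ h₂
  obtain ⟨K₅, hK₅, h₅⟩ := exists_growth_of_far isProfile_W.contDiff.continuous hK₃ h₃
  have hw : ∀ x, 0 ≤ logWeight x := fun x => zero_le_one.trans (one_le_logWeight x)
  refine ⟨2 + K₁ + K₂ + K₃ + K₄ + K₅, by linarith, fun x => ?_, fun x => ?_, fun x => ?_,
    fun x hx => ?_, fun x hx => ?_, fun x hx => ?_⟩
  · exact (h₁ x).trans (mul_le_mul_of_nonneg_right (by linarith) (hw x))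
  · exact (h₄ x).trans (mul_le_mul_of_nonneg_right (by linarith) (hw x))
  · exact (h₅ x).trans (mul_le_mul_of_nonneg_right (by linarith) (hw x))
  · exact (bubble_far x hx).trans (by gcongr; linarith)
  · exact (h₂ x hx).trans (by gcongr; linarith)
  · exact (h₃ x hx).trans (by gcongr; linarith)

/-! ### Expansion of the ansatz -/

lemma abs_log_norm_sub_le {a b : ℂ} (ha : a ≠ 0) (hb : ‖b‖ ≤ ‖a‖ / 2) :
    |Real.log ‖a - b‖ - Real.log ‖a‖| ≤ 2 * (‖b‖ / ‖a‖) := by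
  have ha0 : 0 < ‖a‖ := norm_pos_iff.2 ha
  have h1 : ‖a‖ - ‖b‖ ≤ ‖a - b‖ := norm_sub_norm_le a b
  have h2 : ‖a - b‖ ≤ ‖a‖ + ‖b‖ := norm_sub_le a b
  have h0 : 0 < ‖a - b‖ := by linarith
  have h3 : ‖a‖ / 2 ≤ ‖a - b‖ := by linarith
  have hb0 := norm_nonneg b
  rw [abs_le]
  constructor
  · have := Real.log_le_sub_one_of_pos (div_pos ha0 h0)
    rw [Real.log_div ha0.ne' h0.ne'] at this
    have h4 : ‖a‖ / ‖a - b‖ - 1 ≤ 2 * (‖b‖ / ‖a‖) := by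
      rw [div_sub_one h0.ne', ← mul_div_assoc, div_le_div_iff₀ h0 ha0]
      nlinarith
    linarith
  · have := Real.log_le_sub_one_of_pos (div_pos h0 ha0)
    rw [Real.log_div h0.ne' ha0.ne'] at this
    have h4 : ‖a - b‖ / ‖a‖ - 1 ≤ 2 * (‖b‖ / ‖a‖) := by
      rw [div_sub_one ha0.ne', ← mul_div_assoc]
      gcongr
      linarith
    linarith

/-- Projection of a function of logarithmic growth rescaled by `x ↦ (x ^ m - a) / b`. -/
lemma exists_proj_bound {Ω : Set ℂ} (h : IsSmoothBoundedDomain Ω) (h0 : (0 : ℂ) ∈ Ω) {m : ℕ}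
    {Φ : ℂ → ℝ} (hΦ : ContDiff ℝ 2 Φ) {c₀ c₁ K : ℝ}
    (hfar : ∀ x : ℂ, 1 ≤ ‖x‖ → |Φ x - (c₀ + c₁ * Real.log ‖x‖)| ≤ K / ‖x‖) :
    ∃ K' e₀ : ℝ, 0 < K' ∧ 0 < e₀ ∧ ∀ (a : ℂ) (b e : ℝ), 0 < b → b ≤ e₀ → ‖a‖ ≤ e₀ →
      ∀ φ : ℂ → ℝ, (∀ x, φ x = Φ ((x ^ m - a) / b) + e) → ∀ x ∈ closure Ω,
        |proj Ω φ x - (Φ ((x ^ m - a) / b) - (c₀ - c₁ * Real.log b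
          + 2 * Real.pi * c₁ * m * greenRegularPart Ω x 0))| ≤ K' * (b + ‖a‖) := by
  obtain ⟨d, D, hd, hd1, hD, hdx, -⟩ := exists_norm_bounds h h0
  have hG := isGreenRegularPart_zero h h0
  have hdm : 0 < d ^ m := by positivity
  refine ⟨2 * |K| / d ^ m + |c₁| * (2 / d ^ m) + 1, d ^ m / 2, by positivity, by positivity, ?_⟩
  intro a b e hb hbe hae φ hφ x hx
  have hφc : ContDiff ℝ 2 φ := by
    rw [show φ = fun x => Φ ((x ^ m - a) / b) + e from funext hφ]
    have h1 : ContDiff ℝ 2 fun x : ℂ => (x ^ m - a) / (b : ℂ) :=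
      ((contDiff_id.pow m).sub contDiff_const).div_const _
    exact (hΦ.comp h1).add contDiff_const
  have key := abs_proj_sub_le h hφc hG.harmonic hG.continuousOn
    (a := e + c₀ - c₁ * Real.log b) (c := 2 * Real.pi * c₁ * m)
    (M := (2 * |K| / d ^ m + |c₁| * (2 / d ^ m) + 1) * (b + ‖a‖)) (fun y hy => ?_) x hx
  · rw [hφ x] at key
    convert key using 2
    ring
  · have hyd := hdx y hy
    have hym : d ^ m ≤ ‖y ^ m‖ := by rw [norm_pow]; exact pow_le_pow_left₀ hd.le hyd m
    have hym0 : 0 < ‖y ^ m‖ := hdm.trans_le hym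
    have hya : ‖y ^ m‖ / 2 ≤ ‖y ^ m - a‖ := by
      have := norm_sub_norm_le (y ^ m) a
      linarith
    have hya0 : 0 < ‖y ^ m - a‖ := by linarith
    have hnb : ‖(b : ℂ)‖ = b := by rw [Complex.norm_real, Real.norm_eq_abs, abs_of_pos hb]
    have hz : ‖(y ^ m - a) / b‖ = ‖y ^ m - a‖ / b := by rw [norm_div, hnb]
    have hz1 : 1 ≤ ‖(y ^ m - a) / b‖ := by rw [hz, le_div_iff₀ hb]; linarith
    have h1 := hfar _ hz1
    have h2 := abs_log_norm_sub_le (a := y ^ m) (b := a) (norm_pos_iff.1 hym0) (by linarith)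
    have hlogz : Real.log ‖(y ^ m - a) / b‖ = Real.log ‖y ^ m - a‖ - Real.log b := by
      rw [hz, Real.log_div hya0.ne' hb.ne']
    rw [hlogz] at h1
    have hlogy : Real.log ‖y ^ m‖ = m * Real.log ‖y‖ := by rw [norm_pow, Real.log_pow]
    rw [hlogy] at h2
    have hbd := hG.boundary y hy
    simp only [sub_zero] at hbd
    have hpi : 2 * Real.pi * c₁ * m * greenRegularPart Ω y 0 = c₁ * (m * Real.log ‖y‖) := by
      rw [hbd]; field_simp
    rw [hφ y, hpi]
    have e1 : Φ ((y ^ m - a) / b) + e - (e + c₀ - c₁ * Real.log b + c₁ * (m * Real.log ‖y‖)) =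
        (Φ ((y ^ m - a) / b) - (c₀ + c₁ * (Real.log ‖y ^ m - a‖ - Real.log b)))
        + c₁ * (Real.log ‖y ^ m - a‖ - m * Real.log ‖y‖) := by ring
    rw [e1]
    have t1 := abs_add_le (Φ ((y ^ m - a) / b) - (c₀ + c₁ * (Real.log ‖y ^ m - a‖ - Real.log b)))
      (c₁ * (Real.log ‖y ^ m - a‖ - m * Real.log ‖y‖))
    rw [abs_mul] at t1
    have t2 : K / ‖(y ^ m - a) / b‖ ≤ 2 * |K| / d ^ m * b := by
      rw [hz, div_div_eq_mul_div, div_mul_eq_mul_div, div_le_div_iff₀ hya0 hdm]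
      have h5 : K * b ≤ |K| * b := mul_le_mul_of_nonneg_right (le_abs_self K) hb.le
      have h6 : d ^ m ≤ 2 * ‖y ^ m - a‖ := by linarith
      have h7 : K * b * d ^ m ≤ |K| * b * d ^ m := mul_le_mul_of_nonneg_right h5 hdm.le
      have h8 : |K| * b * d ^ m ≤ |K| * b * (2 * ‖y ^ m - a‖) :=
        mul_le_mul_of_nonneg_left h6 (by positivity)
      linarith
    have t3 : |c₁| * |Real.log ‖y ^ m - a‖ - m * Real.log ‖y‖| ≤ |c₁| * (2 / d ^ m) * ‖a‖ := by
      have h5 : ‖a‖ / ‖y ^ m‖ ≤ ‖a‖ / d ^ m := by gcongr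
      have h6 : |Real.log ‖y ^ m - a‖ - m * Real.log ‖y‖| ≤ 2 / d ^ m * ‖a‖ := by
        refine h2.trans ((mul_le_mul_of_nonneg_left h5 two_pos.le).trans (le_of_eq ?_))
        ring
      rw [mul_assoc]
      exact mul_le_mul_of_nonneg_left h6 (abs_nonneg _)
    have p1 : 0 ≤ 2 * |K| / d ^ m * ‖a‖ := by positivity
    have p2 : 0 ≤ |c₁| * (2 / d ^ m) * b := by positivity
    have p3 := norm_nonneg a
    linarith

/-- `U + V / p + W / p²`. -/
def bubbleSum (p : ℝ) (x : ℂ) : ℝ := bubble x + V x / p + W x / p ^ 2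

/-- The density `e^U (1 + (V - f₁(U)) / p + (W - f₂(U, V)) / p²)`, so that
`-Δ (U + V / p + W / p²)` is this density. -/
def bubbleDensity (p : ℝ) (x : ℂ) : ℝ :=
  Real.exp (bubble x) * (1 + (V x - rhsV x) / p + (W x - rhsW x) / p ^ 2)

lemma laplacian_bubbleSum_comp {p : ℝ} {m : ℕ} (a : ℂ) (b : ℝ) (x : ℂ) :
    Δ (fun y : ℂ => bubble ((y ^ m - a) / b)) x + Δ (fun y : ℂ => V ((y ^ m - a) / b)) x / p
      + Δ (fun y : ℂ => W ((y ^ m - a) / b)) x / p ^ 2 =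
      -(‖m * x ^ (m - 1) / (b : ℂ)‖ ^ 2 * bubbleDensity p ((x ^ m - a) / b)) := by
  have hg : ∀ y : ℂ,
      HasDerivAt (fun y : ℂ => (y ^ m - a) / (b : ℂ)) (m * y ^ (m - 1) / (b : ℂ)) y :=
    fun y => ((hasDerivAt_pow m y).sub_const a).div_const _
  have hg' : HasDerivAt (fun y : ℂ => (m : ℂ) * y ^ (m - 1) / (b : ℂ))
      (m * (((m - 1 : ℕ) : ℂ) * x ^ (m - 1 - 1)) / (b : ℂ)) x :=
    ((hasDerivAt_pow (m - 1) x).const_mul _).div_const _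
  rw [laplacian_comp_holomorphic contDiff_bubble hg hg',
    laplacian_comp_holomorphic isProfile_V.contDiff hg hg',
    laplacian_comp_holomorphic isProfile_W.contDiff hg hg', laplacian_bubble]
  have hV := isProfile_V.equation ((x ^ m - a) / b)
  have hW := isProfile_W.equation ((x ^ m - a) / b)
  rw [eq_sub_of_add_eq hV, eq_sub_of_add_eq hW, bubbleDensity]
  ring

/-- The rescaled `p`-expansion of a bubble together with its regular part. -/
def bubbleProj (Ω : Set ℂ) (p : ℝ) (m : ℕ) (a : ℂ) (b : ℝ) (x : ℂ) : ℝ :=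
  bubbleSum p ((x ^ m - a) / b) - Real.log 8 - coeffM p * Real.log b
    + 2 * Real.pi * coeffM p * m * greenRegularPart Ω x 0

lemma exists_bubbleProj_bound {Ω : Set ℂ} (h : IsSmoothBoundedDomain Ω) (h0 : (0 : ℂ) ∈ Ω) (m : ℕ) :
    ∃ K' e₀ : ℝ, 0 < K' ∧ 0 < e₀ ∧ ∀ (a : ℂ) (b e p : ℝ), 0 < b → b ≤ e₀ → ‖a‖ ≤ e₀ → 1 ≤ p →
      ∀ φ₀ φ₁ φ₂ : ℂ → ℝ, (∀ x, φ₀ x = bubble ((x ^ m - a) / b) + e) →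
      (∀ x, φ₁ x = V ((x ^ m - a) / b)) → (∀ x, φ₂ x = W ((x ^ m - a) / b)) → ∀ x ∈ closure Ω,
        |(proj Ω φ₀ x + proj Ω φ₁ x / p + proj Ω φ₂ x / p ^ 2) - bubbleProj Ω p m a b x| ≤
          K' * (b + ‖a‖) := by
  obtain ⟨K, hK1, -, -, -, hU, hV, hW⟩ := exists_profile_bounds
  obtain ⟨K₀, e₀, hK₀, he₀, H₀⟩ := exists_proj_bound h h0 (m := m) contDiff_bubble hU
  obtain ⟨K₁, e₁, hK₁, he₁, H₁⟩ := exists_proj_bound h h0 (m := m) isProfile_V.contDiff hV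
  obtain ⟨K₂, e₂, hK₂, he₂, H₂⟩ := exists_proj_bound h h0 (m := m) isProfile_W.contDiff hW
  refine ⟨K₀ + K₁ + K₂, min e₀ (min e₁ e₂), by positivity, by positivity, ?_⟩
  intro a b e p hb hbe hae hp φ₀ φ₁ φ₂ hφ₀ hφ₁ hφ₂ x hx
  have b0 := H₀ a b e hb (hbe.trans (min_le_left _ _)) (hae.trans (min_le_left _ _)) φ₀ hφ₀ x hx
  have b1 := H₁ a b 0 hb (hbe.trans ((min_le_right _ _).trans (min_le_left _ _)))
    (hae.trans ((min_le_right _ _).trans (min_le_left _ _))) φ₁ (by simpa using hφ₁) x hx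
  have b2 := H₂ a b 0 hb (hbe.trans ((min_le_right _ _).trans (min_le_right _ _)))
    (hae.trans ((min_le_right _ _).trans (min_le_right _ _))) φ₂ (by simpa using hφ₂) x hx
  set t₀ := proj Ω φ₀ x - (bubble ((x ^ m - a) / b) - (Real.log 8 - (-4) * Real.log b
          + 2 * Real.pi * (-4) * m * greenRegularPart Ω x 0)) with ht₀
  set t₁ := proj Ω φ₁ x - (V ((x ^ m - a) / b) - (0 - C₁ * Real.log b
          + 2 * Real.pi * C₁ * m * greenRegularPart Ω x 0)) with ht₁
  set t₂ := proj Ω φ₂ x - (W ((x ^ m - a) / b) - (0 - C₂ * Real.log b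
          + 2 * Real.pi * C₂ * m * greenRegularPart Ω x 0)) with ht₂
  have hp0 : 0 < p := by linarith
  have e1 : (proj Ω φ₀ x + proj Ω φ₁ x / p + proj Ω φ₂ x / p ^ 2) - bubbleProj Ω p m a b x =
      t₀ + t₁ / p + t₂ / p ^ 2 := by
    rw [ht₀, ht₁, ht₂, bubbleProj, bubbleSum, coeffM]
    ring
  rw [e1]
  have q1 : |t₁ / p| ≤ |t₁| := by
    rw [abs_div, abs_of_pos hp0]; exact div_le_self (abs_nonneg _) hp
  have q2 : |t₂ / p ^ 2| ≤ |t₂| := by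
    rw [abs_div, abs_of_pos (by positivity : 0 < p ^ 2)]
    exact div_le_self (abs_nonneg _) (one_le_pow₀ hp)
  have := abs_add_three t₀ (t₁ / p) (t₂ / p ^ 2)
  linarith

lemma exists_bubbleSum_far : ∃ K, 0 < K ∧ ∀ p : ℝ, 1 ≤ p → ∀ x : ℂ, 1 ≤ ‖x‖ →
    |bubbleSum p x - Real.log 8 + coeffM p * Real.log ‖x‖| ≤ K / ‖x‖ := by
  obtain ⟨K, hK1, -, -, -, hU, hV, hW⟩ := exists_profile_bounds
  refine ⟨3 * K, by linarith, fun p hp x hx => ?_⟩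
  have b0 := hU x hx
  have b1 := hV x hx
  have b2 := hW x hx
  set t₀ := bubble x - (Real.log 8 + (-4) * Real.log ‖x‖) with ht₀
  set t₁ := V x - (0 + C₁ * Real.log ‖x‖) with ht₁
  set t₂ := W x - (0 + C₂ * Real.log ‖x‖) with ht₂
  have hp0 : 0 < p := by linarith
  have e1 : bubbleSum p x - Real.log 8 + coeffM p * Real.log ‖x‖ = t₀ + t₁ / p + t₂ / p ^ 2 := by
    rw [ht₀, ht₁, ht₂, bubbleSum, coeffM]
    ring
  rw [e1]
  have q1 : |t₁ / p| ≤ |t₁| := by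
    rw [abs_div, abs_of_pos hp0]; exact div_le_self (abs_nonneg _) hp
  have q2 : |t₂ / p ^ 2| ≤ |t₂| := by
    rw [abs_div, abs_of_pos (by positivity : 0 < p ^ 2)]
    exact div_le_self (abs_nonneg _) (one_le_pow₀ hp)
  have := abs_add_three t₀ (t₁ / p) (t₂ / p ^ 2)
  have e2 : 3 * K / ‖x‖ = K / ‖x‖ + K / ‖x‖ + K / ‖x‖ := by ring
  rw [e2]
  linarith

lemma U₁_eq {α : ℝ} (hα : 0 < α) (x : ℂ) :
    U₁ α x = bubble ((x ^ 1 - 0) / α) + -2 * Real.log α := by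
  have hn : ‖(x ^ 1 - 0) / (α : ℂ)‖ = ‖x‖ / α := by
    rw [pow_one, sub_zero, norm_div, Complex.norm_real, Real.norm_eq_abs, abs_of_pos hα]
  have e : 8 * α ^ 2 / (‖x‖ ^ 2 + α ^ 2) ^ 2 = 8 / ((‖x‖ / α) ^ 2 + 1) ^ 2 / α ^ 2 := by
    field_simp
  rw [U₁, bubble, hn, e, Real.log_div (by positivity) (by positivity), Real.log_pow]
  push_cast; ring

lemma U₂_eq {k : ℕ} {β ρ : ℝ} (hk : 0 < k) (hβ : 0 < β) (x : ℂ) :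
    U₂ k β ρ x = bubble ((x ^ k - (ρ : ℂ) ^ k) / (β ^ k : ℝ))
      + (2 * Real.log k - 2 * Real.log (β ^ k)) := by
  have hb : 0 < β ^ k := by positivity
  have hk' : (0 : ℝ) < k := by exact_mod_cast hk
  have hn : ‖(x ^ k - (ρ : ℂ) ^ k) / ((β ^ k : ℝ) : ℂ)‖ = ‖x ^ k - (ρ : ℂ) ^ k‖ / β ^ k := by
    rw [norm_div, Complex.norm_real, Real.norm_eq_abs, abs_of_pos hb]
  have e : 8 * (k : ℝ) ^ 2 * β ^ (2 * k) / (‖x ^ k - (ρ : ℂ) ^ k‖ ^ 2 + β ^ (2 * k)) ^ 2 =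
      8 / ((‖x ^ k - (ρ : ℂ) ^ k‖ / β ^ k) ^ 2 + 1) ^ 2 * ((k : ℝ) ^ 2 / (β ^ k) ^ 2) := by
    rw [pow_mul']
    field_simp
  have e2 : Real.log ((k : ℝ) ^ 2 / (β ^ k) ^ 2) = 2 * Real.log k - 2 * Real.log (β ^ k) := by
    rw [Real.log_div (by positivity) (by positivity), Real.log_pow (n := 2) (x := (k : ℝ)),
      Real.log_pow (n := 2) (x := β ^ k)]
    push_cast; ring
  rw [U₂, bubble, hn, e, Real.log_mul (by positivity) (by positivity), e2]

/-- Pointwise expansion of the ansatz. -/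
lemma exists_ansatz_bound {Ω : Set ℂ} (h : IsSmoothBoundedDomain Ω) (h0 : (0 : ℂ) ∈ Ω) {k : ℕ}
    (hk : 0 < k) :
    ∃ K' e₀ : ℝ, 0 < K' ∧ 0 < e₀ ∧ ∀ p η τ α β ρ : ℝ, 1 ≤ p → 0 < η → η ≤ 1 → 0 < τ → 0 < α →
      0 < β → 0 < ρ → α ≤ e₀ → β ^ k ≤ e₀ → ρ ^ k ≤ e₀ → ∀ x ∈ closure Ω,
        |ansatz Ω k p η τ α β ρ x / τ - (bubbleProj Ω p 1 0 α x
          - η * bubbleProj Ω p k ((ρ : ℂ) ^ k) (β ^ k) x)| ≤ K' * (α + β ^ k + ρ ^ k) := by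
  obtain ⟨K₁, e₁, hK₁, he₁, H₁⟩ := exists_bubbleProj_bound h h0 1
  obtain ⟨K₂, e₂, hK₂, he₂, H₂⟩ := exists_bubbleProj_bound h h0 k
  refine ⟨K₁ + K₂, min e₁ e₂, by positivity, by positivity, ?_⟩
  intro p η τ α β ρ hp hη hη1 hτ hα hβ hρ hαe hβe hρe x hx
  have hρn : ‖(ρ : ℂ) ^ k‖ = ρ ^ k := by
    rw [norm_pow, Complex.norm_real, Real.norm_eq_abs, abs_of_pos hρ]
  have hβk : 0 < β ^ k := by positivity
  have hρk : 0 < ρ ^ k := by positivity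
  have b1 := H₁ 0 α _ p hα (hαe.trans (min_le_left _ _)) (by simpa using he₁.le) hp
    (U₁ α) (V₁ α) (W₁ α) (U₁_eq hα) (fun x => by simp [V₁]) (fun x => by simp [W₁]) x hx
  have b2 := H₂ ((ρ : ℂ) ^ k) (β ^ k) _ p hβk (hβe.trans (min_le_right _ _))
    (by rw [hρn]; exact hρe.trans (min_le_right _ _)) hp
    (U₂ k β ρ) (V₂ k β ρ) (W₂ k β ρ) (U₂_eq hk hβ) (fun x => by simp [V₂]) (fun x => by simp [W₂])
    x hx
  rw [norm_zero, add_zero] at b1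
  rw [hρn] at b2
  set t₁ := (proj Ω (U₁ α) x + proj Ω (V₁ α) x / p + proj Ω (W₁ α) x / p ^ 2)
    - bubbleProj Ω p 1 0 α x with ht₁
  set t₂ := (proj Ω (U₂ k β ρ) x + proj Ω (V₂ k β ρ) x / p + proj Ω (W₂ k β ρ) x / p ^ 2)
    - bubbleProj Ω p k ((ρ : ℂ) ^ k) (β ^ k) x with ht₂
  have e1 : ansatz Ω k p η τ α β ρ x / τ - (bubbleProj Ω p 1 0 α x
          - η * bubbleProj Ω p k ((ρ : ℂ) ^ k) (β ^ k) x) = t₁ - η * t₂ := by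
    rw [ansatz, ht₁, ht₂]
    field_simp
    ring
  rw [e1]
  have := abs_sub t₁ (η * t₂)
  rw [abs_mul, abs_of_pos hη] at this
  have h3 : η * |t₂| ≤ |t₂| := mul_le_of_le_one_left (abs_nonneg _) hη1
  nlinarith [mul_pos hK₁ hβk, mul_pos hK₁ hρk, mul_pos hK₂ hα]

lemma laplacian_ansatz {Ω : Set ℂ} (h : IsSmoothBoundedDomain Ω) {k : ℕ} (hk : 0 < k)
    {p η τ α β ρ : ℝ} (hα : 0 < α) (hβ : 0 < β) {x : ℂ} (hx : x ∈ Ω) :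
    Δ (ansatz Ω k p η τ α β ρ) x =
      -(τ / α ^ 2 * bubbleDensity p (x / α)) + τ * η * (k ^ 2 * ‖x‖ ^ (2 * k - 2) / β ^ (2 * k))
        * bubbleDensity p ((x ^ k - (ρ : ℂ) ^ k) / (β ^ k : ℝ)) := by
  have hcomp : ∀ {Φ : ℂ → ℝ}, ContDiff ℝ 2 Φ → ∀ (m : ℕ) (a : ℂ) (b e : ℝ),
      ContDiff ℝ 2 fun x : ℂ => Φ ((x ^ m - a) / b) + e := fun hΦ m a b e => by
    have h1 : ContDiff ℝ 2 fun x : ℂ => (x ^ m - a) / (b : ℂ) :=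
      ((contDiff_id.pow m).sub contDiff_const).div_const _
    exact (hΦ.comp h1).add contDiff_const
  have hcU := contDiff_bubble
  have hcV := isProfile_V.contDiff
  have hcW := isProfile_W.contDiff
  have eU₁ : U₁ α = fun x => bubble ((x ^ 1 - 0) / α) + -2 * Real.log α := funext (U₁_eq hα)
  have eV₁ : V₁ α = fun x => V ((x ^ 1 - 0) / α) + 0 := by ext x; simp [V₁]
  have eW₁ : W₁ α = fun x => W ((x ^ 1 - 0) / α) + 0 := by ext x; simp [W₁]
  have eU₂ : U₂ k β ρ = fun x => bubble ((x ^ k - (ρ : ℂ) ^ k) / (β ^ k : ℝ))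
      + (2 * Real.log k - 2 * Real.log (β ^ k)) := funext (U₂_eq hk hβ)
  have eV₂ : V₂ k β ρ = fun x => V ((x ^ k - (ρ : ℂ) ^ k) / (β ^ k : ℝ)) + 0 := by
    ext x; simp [V₂]
  have eW₂ : W₂ k β ρ = fun x => W ((x ^ k - (ρ : ℂ) ^ k) / (β ^ k : ℝ)) + 0 := by
    ext x; simp [W₂]
  have hp : ∀ {φ : ℂ → ℝ}, ContDiff ℝ 2 φ → ContDiffAt ℝ 2 (proj Ω φ) x ∧ Δ (proj Ω φ) x = Δ φ x :=
    fun hφ => by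
      have := isDirichletProjection_proj h hφ
      exact ⟨this.contDiffOn.contDiffAt (h.isOpen.mem_nhds hx), neg_inj.1 (this.laplacian_eq x hx)⟩
  have hadd : ∀ {Φ : ℂ → ℝ}, ContDiff ℝ 2 Φ → ∀ (m : ℕ) (a : ℂ) (b e : ℝ),
      Δ (fun x : ℂ => Φ ((x ^ m - a) / b) + e) x = Δ (fun x : ℂ => Φ ((x ^ m - a) / b)) x :=
    fun {Φ} hΦ m a b e => by
      have h1 := hcomp hΦ m a b 0
      simp only [add_zero] at h1
      have := ContDiffAt.laplacian_add h1.contDiffAt (contDiffAt_const (c := e) (x := x))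
      have e2 : ((fun x : ℂ => Φ ((x ^ m - a) / b)) + fun _ => e) =
        fun x : ℂ => Φ ((x ^ m - a) / b) + e := rfl
      rw [e2] at this
      rw [this]
      simp
  have u1 := hp (eU₁ ▸ hcomp hcU 1 0 α _ : ContDiff ℝ 2 (U₁ α))
  have v1 := hp (eV₁ ▸ hcomp hcV 1 0 α 0 : ContDiff ℝ 2 (V₁ α))
  have w1 := hp (eW₁ ▸ hcomp hcW 1 0 α 0 : ContDiff ℝ 2 (W₁ α))
  have u2 := hp (eU₂ ▸ hcomp hcU k _ _ _ : ContDiff ℝ 2 (U₂ k β ρ))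
  have v2 := hp (eV₂ ▸ hcomp hcV k _ _ 0 : ContDiff ℝ 2 (V₂ k β ρ))
  have w2 := hp (eW₂ ▸ hcomp hcW k _ _ 0 : ContDiff ℝ 2 (W₂ k β ρ))
  have hlin : ∀ {a b c : ℂ → ℝ}, ContDiffAt ℝ 2 a x → ContDiffAt ℝ 2 b x → ContDiffAt ℝ 2 c x →
      ∀ t : ℝ, ContDiffAt ℝ 2 (t • (a + p⁻¹ • b + (p ^ 2)⁻¹ • c)) x ∧
      Δ (t • (a + p⁻¹ • b + (p ^ 2)⁻¹ • c)) x = t * (Δ a x + Δ b x / p + Δ c x / p ^ 2) := by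
    intro a b c ha hb hc t
    have hb' : ContDiffAt ℝ 2 (p⁻¹ • b) x := hb.const_smul p⁻¹
    have hc' : ContDiffAt ℝ 2 ((p ^ 2)⁻¹ • c) x := hc.const_smul (p ^ 2)⁻¹
    have hab : ContDiffAt ℝ 2 (a + p⁻¹ • b) x := ha.add hb'
    have habc : ContDiffAt ℝ 2 (a + p⁻¹ • b + (p ^ 2)⁻¹ • c) x := hab.add hc'
    refine ⟨habc.const_smul t, ?_⟩
    rw [laplacian_smul t habc, ContDiffAt.laplacian_add hab hc',
      ContDiffAt.laplacian_add ha hb', laplacian_smul _ hb, laplacian_smul _ hc]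
    simp only [smul_eq_mul]
    ring
  have l1 := hlin u1.1 v1.1 w1.1 τ
  have l2 := hlin u2.1 v2.1 w2.1 (τ * η)
  have ea : ansatz Ω k p η τ α β ρ =
      τ • (proj Ω (U₁ α) + p⁻¹ • proj Ω (V₁ α) + (p ^ 2)⁻¹ • proj Ω (W₁ α))
      - (τ * η) •
        (proj Ω (U₂ k β ρ) + p⁻¹ • proj Ω (V₂ k β ρ) + (p ^ 2)⁻¹ • proj Ω (W₂ k β ρ)) := by
    ext y
    simp only [ansatz, Pi.sub_apply, Pi.add_apply, Pi.smul_apply, smul_eq_mul]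
    ring
  rw [ea, ContDiffAt.laplacian_sub l1.1 l2.1, l1.2, l2.2, u1.2, v1.2, w1.2, u2.2, v2.2, w2.2,
    eU₁, eV₁, eW₁, eU₂, eV₂, eW₂, hadd hcU, hadd hcV, hadd hcW, hadd hcU, hadd hcV, hadd hcW,
    laplacian_bubbleSum_comp, laplacian_bubbleSum_comp]
  have hn : ∀ r : ℝ, ‖(r : ℂ)‖ ^ 2 = r ^ 2 := fun r => by
    rw [Complex.norm_real, Real.norm_eq_abs, sq_abs]
  have n1 : ‖((1 : ℕ) : ℂ) * x ^ (1 - 1) / (α : ℂ)‖ ^ 2 = 1 / α ^ 2 := by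
    rw [norm_div, div_pow, hn]; simp
  have n2 : ‖(k : ℂ) * x ^ (k - 1) / ((β ^ k : ℝ) : ℂ)‖ ^ 2 =
      k ^ 2 * ‖x‖ ^ (2 * k - 2) / β ^ (2 * k) := by
    rw [norm_div, div_pow, hn, norm_mul, mul_pow, norm_pow, ← pow_mul, ← pow_mul,
      show (k - 1) * 2 = 2 * k - 2 by omega, mul_comm k 2]
    simp
  rw [n1, n2, pow_one, sub_zero]
  ring

/-! ### The power nonlinearity near a bubble -/

lemma abs_exp_sub_taylor_le {ζ : ℝ} (h : ζ ≤ 3) :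
    |Real.exp ζ - 1 - ζ - ζ ^ 2 / 2| ≤ 21 * |ζ| ^ 3 := by
  rcases le_or_gt (-1) ζ with h1 | h1
  · have h2 : |ζ| ≤ 3 := abs_le.2 ⟨by linarith, h⟩
    have h3 := Complex.norm_exp_sub_sum_le_norm_mul_exp (ζ : ℂ) 3
    have e : (Complex.exp ζ - ∑ m ∈ Finset.range 3, (ζ : ℂ) ^ m / (m.factorial : ℂ)) =
        ((Real.exp ζ - 1 - ζ - ζ ^ 2 / 2 : ℝ) : ℂ) := by
      simp [Finset.sum_range_succ, Nat.factorial]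
      ring
    rw [e, Complex.norm_real, Complex.norm_real, Real.norm_eq_abs, Real.norm_eq_abs] at h3
    refine h3.trans ?_
    have h4 : Real.exp |ζ| ≤ 21 := by
      calc Real.exp |ζ| ≤ Real.exp ((3 : ℕ) * 1) := Real.exp_le_exp.2 (by simpa using h2)
        _ = Real.exp 1 ^ 3 := Real.exp_nat_mul 1 3
        _ ≤ (2.7182818286 : ℝ) ^ 3 :=
          pow_le_pow_left₀ (Real.exp_pos 1).le Real.exp_one_lt_d9.le 3
        _ ≤ 21 := by norm_num
    rw [mul_comm]
    exact mul_le_mul_of_nonneg_right h4 (by positivity)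
  · have h2 : Real.exp ζ ≤ 1 := Real.exp_le_one_iff.2 (by linarith)
    have h3 := Real.exp_pos ζ
    rw [abs_of_neg (by linarith : ζ < 0)]
    obtain ⟨t, rfl⟩ : ∃ t, ζ = -t := ⟨-ζ, by ring⟩
    have ht1 : 1 < t := by linarith
    have t2 : t ≤ t ^ 2 := by nlinarith
    have t3 : t ^ 2 ≤ t ^ 3 := pow_le_pow_right₀ ht1.le (by norm_num)
    rw [neg_neg, neg_sq, abs_le]
    constructor <;> linarith

lemma abs_log_one_add_taylor_le {σ : ℝ} (h : |σ| ≤ 1 / 2) :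
    |Real.log (1 + σ) - (σ - σ ^ 2 / 2 + σ ^ 3 / 3)| ≤ 2 * σ ^ 4 := by
  have h1 := Real.abs_log_sub_add_sum_range_le (x := -σ) (by rw [abs_neg]; linarith) 3
  rw [abs_neg] at h1
  have e : (∑ i ∈ Finset.range 3, (-σ) ^ (i + 1) / ((i : ℝ) + 1)) + Real.log (1 - -σ) =
      Real.log (1 + σ) - (σ - σ ^ 2 / 2 + σ ^ 3 / 3) := by
    simp [Finset.sum_range_succ]
    ring
  rw [e] at h1
  refine h1.trans ?_
  rw [div_le_iff₀ (by linarith)]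
  have e4 : |σ| ^ (3 + 1) = σ ^ 4 := by
    rw [show (3 + 1 : ℕ) = 2 * 2 by norm_num, pow_mul, sq_abs]; ring
  rw [e4]
  have : 0 ≤ σ ^ 4 := by positivity
  nlinarith

lemma abs_rpow_sub_one_mul {s p : ℝ} (hp : 0 < p) : abs (|s| ^ (p - 1) * s) = |s| ^ p := by
  by_cases hs : s = 0
  · simp [hs, Real.zero_rpow hp.ne']
  · have h0 : 0 < |s| := abs_pos.2 hs
    rw [abs_mul, abs_of_nonneg (Real.rpow_nonneg h0.le _), Real.rpow_sub_one h0.ne']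
    field_simp

lemma abs_expansion_remainder_le {L t u e q x₁ x₂ X : ℝ} (hL : 1 ≤ L) (ht0 : 0 < t) (hu : |u| ≤ L)
    (he : |e| ≤ L * t ^ 3) (hq : |q| ≤ 32 * L ^ 4 * t ^ 3) (b2 : |x₂| ≤ 2 * L * t ^ 2)
    (b1 : |x₁| ≤ 3 * L * t) (bX : |X| ≤ 2 * L) :
    |e - (2 * u * x₂ + x₁ ^ 2) / 2 * t + x₁ * (X ^ 2 + X * u + u ^ 2) / 3 * t ^ 2 + q| ≤
      100 * L ^ 4 * t ^ 3 := by
  have hL0 : 0 < L := by linarith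
  have L14 : L ≤ L ^ 4 := le_self_pow₀ hL (by norm_num)
  have L24 : L ^ 2 ≤ L ^ 4 := pow_le_pow_right₀ hL (by norm_num)
  have L34 : L ^ 3 ≤ L ^ 4 := pow_le_pow_right₀ hL (by norm_num)
  have h1 : |(2 * u * x₂ + x₁ ^ 2) / 2 * t| ≤ 7 * L ^ 2 * t ^ 3 := by
    rw [abs_mul, abs_div, abs_of_pos ht0, abs_of_pos (by norm_num : (0 : ℝ) < 2)]
    have h2 := abs_add_le (2 * u * x₂) (x₁ ^ 2)
    rw [abs_mul, abs_mul, abs_of_pos (by norm_num : (0 : ℝ) < 2), abs_pow] at h2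
    have h3 : |u| * |x₂| ≤ L * (2 * L * t ^ 2) := mul_le_mul hu b2 (abs_nonneg _) hL0.le
    have h4 : |x₁| ^ 2 ≤ (3 * L * t) ^ 2 := pow_le_pow_left₀ (abs_nonneg _) b1 2
    have h6 : (3 * L * t) ^ 2 = 9 * (L ^ 2 * t ^ 2) := by ring
    have h7 : L * (2 * L * t ^ 2) = 2 * (L ^ 2 * t ^ 2) := by ring
    have h8 : 0 ≤ L ^ 2 * t ^ 2 := by positivity
    have h5 : |2 * u * x₂ + x₁ ^ 2| / 2 ≤ 7 * L ^ 2 * t ^ 2 := by linarith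
    calc |2 * u * x₂ + x₁ ^ 2| / 2 * t ≤ 7 * L ^ 2 * t ^ 2 * t :=
          mul_le_mul_of_nonneg_right h5 ht0.le
      _ = 7 * L ^ 2 * t ^ 3 := by ring
  have h2 : |x₁ * (X ^ 2 + X * u + u ^ 2) / 3 * t ^ 2| ≤ 7 * L ^ 3 * t ^ 3 := by
    have h3 : |X ^ 2 + X * u + u ^ 2| ≤ 7 * L ^ 2 := by
      have h4 := abs_add_three (X ^ 2) (X * u) (u ^ 2)
      rw [abs_pow, abs_mul, abs_pow] at h4
      have h5 : |X| ^ 2 ≤ (2 * L) ^ 2 := pow_le_pow_left₀ (abs_nonneg _) bX 2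
      have h6 : |X| * |u| ≤ 2 * L * L := mul_le_mul bX hu (abs_nonneg _) (by linarith)
      have h7 : |u| ^ 2 ≤ L ^ 2 := pow_le_pow_left₀ (abs_nonneg u) hu 2
      have h8 : (2 * L) ^ 2 = 4 * L ^ 2 := by ring
      have h9 : 2 * L * L = 2 * L ^ 2 := by ring
      linarith
    have h4 : |x₁| * |X ^ 2 + X * u + u ^ 2| ≤ 3 * L * t * (7 * L ^ 2) :=
      mul_le_mul b1 h3 (abs_nonneg _) (by positivity)
    rw [abs_mul, abs_div, abs_mul, abs_of_pos (by norm_num : (0 : ℝ) < 3),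
      abs_of_pos (by positivity : 0 < t ^ 2)]
    calc |x₁| * |X ^ 2 + X * u + u ^ 2| / 3 * t ^ 2
        ≤ 3 * L * t * (7 * L ^ 2) / 3 * t ^ 2 := by gcongr
      _ = 7 * L ^ 3 * t ^ 3 := by ring
  have h3 := abs_add_le (e - (2 * u * x₂ + x₁ ^ 2) / 2 * t
    + x₁ * (X ^ 2 + X * u + u ^ 2) / 3 * t ^ 2) q
  have h4 := abs_add_le (e - (2 * u * x₂ + x₁ ^ 2) / 2 * t)
    (x₁ * (X ^ 2 + X * u + u ^ 2) / 3 * t ^ 2)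
  have h5 := abs_sub e ((2 * u * x₂ + x₁ ^ 2) / 2 * t)
  have ht3 : 0 ≤ t ^ 3 := by positivity
  have q1 : L * t ^ 3 ≤ L ^ 4 * t ^ 3 := mul_le_mul_of_nonneg_right L14 ht3
  have q2 : L ^ 2 * t ^ 3 ≤ L ^ 4 * t ^ 3 := mul_le_mul_of_nonneg_right L24 ht3
  have q3 : L ^ 3 * t ^ 3 ≤ L ^ 4 * t ^ 3 := mul_le_mul_of_nonneg_right L34 ht3
  have q4 : 0 ≤ L ^ 4 * t ^ 3 := by positivity
  linarith

lemma abs_exp_expansion_le {L t ζ a₁ a₂ r : ℝ} (hL : 1 ≤ L) (ht0 : 0 < t) (hLt : L * t ≤ 1 / 8)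
    (ba₁ : |a₁| ≤ 2 * L ^ 2) (ba₂ : |a₂| ≤ 3 * L ^ 3) (br : |r| ≤ 100 * L ^ 4 * t ^ 3)
    (hζr : ζ = a₁ * t + a₂ * t ^ 2 + r) (hζ3 : ζ ≤ 3) :
    |Real.exp ζ - (1 + a₁ * t + a₂ * t ^ 2 + a₁ ^ 2 * t ^ 2 / 2)| ≤ 30000 * L ^ 6 * t ^ 3 := by
  have hL0 : 0 < L := by linarith
  have L46 : L ^ 4 ≤ L ^ 6 := pow_le_pow_right₀ hL (by norm_num)
  have L56 : L ^ 5 ≤ L ^ 6 := pow_le_pow_right₀ hL (by norm_num)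
  have bd : |ζ - a₁ * t| ≤ 16 * L ^ 3 * t ^ 2 := by
    have e1 : ζ - a₁ * t = a₂ * t ^ 2 + r := by rw [hζr]; ring
    rw [e1]
    have h1 := abs_add_le (a₂ * t ^ 2) r
    rw [abs_mul, abs_of_pos (by positivity : 0 < t ^ 2)] at h1
    have h2 : |a₂| * t ^ 2 ≤ 3 * L ^ 3 * t ^ 2 := mul_le_mul_of_nonneg_right ba₂ (by positivity)
    have h3 : 100 * L ^ 4 * t ^ 3 = 100 * (L ^ 3 * t ^ 2) * (L * t) := by ring
    have h4 : 100 * (L ^ 3 * t ^ 2) * (L * t) ≤ 100 * (L ^ 3 * t ^ 2) * (1 / 8) :=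
      mul_le_mul_of_nonneg_left hLt (by positivity)
    have h5 : 0 ≤ L ^ 3 * t ^ 2 := by positivity
    linarith
  have ba₁t : |a₁ * t| ≤ 2 * L ^ 2 * t := by
    rw [abs_mul, abs_of_pos ht0]; exact mul_le_mul_of_nonneg_right ba₁ ht0.le
  have bζ : |ζ| ≤ 4 * L ^ 2 * t := by
    have h1 := abs_add_le (ζ - a₁ * t) (a₁ * t)
    rw [sub_add_cancel] at h1
    have h3 : 16 * L ^ 3 * t ^ 2 = 16 * (L ^ 2 * t) * (L * t) := by ring
    have h4 : 16 * (L ^ 2 * t) * (L * t) ≤ 16 * (L ^ 2 * t) * (1 / 8) :=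
      mul_le_mul_of_nonneg_left hLt (by positivity)
    linarith
  have bsq : |ζ ^ 2 / 2 - a₁ ^ 2 * t ^ 2 / 2| ≤ 48 * L ^ 5 * t ^ 3 := by
    have e1 : ζ ^ 2 / 2 - a₁ ^ 2 * t ^ 2 / 2 = (ζ - a₁ * t) * (ζ + a₁ * t) / 2 := by ring
    have h1 := abs_add_le ζ (a₁ * t)
    rw [e1, abs_div, abs_mul, abs_of_pos (by norm_num : (0 : ℝ) < 2)]
    have h2 : |ζ - a₁ * t| * |ζ + a₁ * t| ≤ 16 * L ^ 3 * t ^ 2 * (6 * L ^ 2 * t) :=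
      mul_le_mul bd (by linarith) (abs_nonneg _) (by positivity)
    calc |ζ - a₁ * t| * |ζ + a₁ * t| / 2 ≤ 16 * L ^ 3 * t ^ 2 * (6 * L ^ 2 * t) / 2 := by gcongr
      _ = 48 * L ^ 5 * t ^ 3 := by ring
  have bcube : 21 * |ζ| ^ 3 ≤ 1344 * L ^ 6 * t ^ 3 := by
    calc 21 * |ζ| ^ 3 ≤ 21 * (4 * L ^ 2 * t) ^ 3 := by gcongr
      _ = 1344 * L ^ 6 * t ^ 3 := by ring
  have e1 : Real.exp ζ - (1 + a₁ * t + a₂ * t ^ 2 + a₁ ^ 2 * t ^ 2 / 2) =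
      (Real.exp ζ - 1 - ζ - ζ ^ 2 / 2) + (ζ ^ 2 / 2 - a₁ ^ 2 * t ^ 2 / 2) + r := by
    rw [show r = ζ - a₁ * t - a₂ * t ^ 2 by rw [hζr]; ring]; ring
  rw [e1]
  have h1 := abs_add_three (Real.exp ζ - 1 - ζ - ζ ^ 2 / 2) (ζ ^ 2 / 2 - a₁ ^ 2 * t ^ 2 / 2) r
  have h2 := abs_exp_sub_taylor_le hζ3
  have ht3 : 0 ≤ t ^ 3 := by positivity
  have q1 : L ^ 4 * t ^ 3 ≤ L ^ 6 * t ^ 3 := mul_le_mul_of_nonneg_right L46 ht3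
  have q2 : L ^ 5 * t ^ 3 ≤ L ^ 6 * t ^ 3 := mul_le_mul_of_nonneg_right L56 ht3
  have q3 : 0 ≤ L ^ 6 * t ^ 3 := by positivity
  linarith

/-- The expansion of `(1 + (u + v / p + w / p² + e) / p) ^ p` to the order `p⁻²`, as long as `u`,
`v` and `w` are small compared with `p`. -/
lemma abs_power_sub_expansion_le {p L u v w e : ℝ} (hL : 1 ≤ L) (hp : 8 * L ≤ p) (hu : |u| ≤ L)
    (hv : |v| ≤ L) (hw : |w| ≤ L) (he : |e| ≤ L / p ^ 3) :
    abs (|1 + (u + v / p + w / p ^ 2 + e) / p| ^ (p - 1) * (1 + (u + v / p + w / p ^ 2 + e) / p)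
      - Real.exp u * (1 + (v - f₁ u) / p + (w - f₂ u v) / p ^ 2)) ≤
      Real.exp u * (30000 * L ^ 6 / p ^ 3) := by
  have hp0 : 0 < p := by linarith
  have hL0 : 0 < L := by linarith
  -- everything is expressed through `t = 1 / p`
  obtain ⟨t, ht⟩ : ∃ t, t = 1 / p := ⟨_, rfl⟩
  have htp : t * p = 1 := by rw [ht]; field_simp
  have ht0 : 0 < t := by rw [ht]; positivity
  have hLt : L * t ≤ 1 / 8 := by
    rw [ht, mul_one_div, div_le_div_iff₀ hp0 (by norm_num)]; linarith
  have ht1 : t ≤ 1 / 8 := (le_mul_of_one_le_left ht0.le hL).trans hLt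
  obtain ⟨x₂, hx₂⟩ : ∃ x, x = w * t ^ 2 + e := ⟨_, rfl⟩
  obtain ⟨x₁, hx₁⟩ : ∃ x, x = v * t + x₂ := ⟨_, rfl⟩
  obtain ⟨X, hX⟩ : ∃ x, x = u + x₁ := ⟨_, rfl⟩
  obtain ⟨σ, hσ⟩ : ∃ x, x = X * t := ⟨_, rfl⟩
  have het : |e| ≤ L * t ^ 3 := by
    refine he.trans (le_of_eq ?_); rw [ht]; field_simp
  have b2 : |x₂| ≤ 2 * L * t ^ 2 := by
    have h1 := abs_add_le (w * t ^ 2) e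
    rw [abs_mul, abs_of_pos (by positivity : 0 < t ^ 2), ← hx₂] at h1
    have h2 : |w| * t ^ 2 ≤ L * t ^ 2 := mul_le_mul_of_nonneg_right hw (by positivity)
    have h3 : L * t ^ 3 ≤ L * t ^ 2 :=
      mul_le_mul_of_nonneg_left (pow_le_pow_of_le_one ht0.le (by linarith) (by norm_num)) hL0.le
    linarith
  have b1 : |x₁| ≤ 3 * L * t := by
    have h1 := abs_add_le (v * t) x₂
    rw [abs_mul, abs_of_pos ht0, ← hx₁] at h1
    have h2 : |v| * t ≤ L * t := mul_le_mul_of_nonneg_right hv ht0.le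
    have h4 : t ^ 2 ≤ t := pow_le_of_le_one ht0.le (by linarith) (by norm_num)
    have h3 : L * t ^ 2 ≤ L * t := mul_le_mul_of_nonneg_left h4 hL0.le
    linarith
  have bX : |X| ≤ 2 * L := by
    have h1 := abs_add_le u x₁
    rw [← hX] at h1
    linarith
  have bσ : |σ| ≤ 2 * (L * t) := by
    rw [hσ, abs_mul, abs_of_pos ht0, ← mul_assoc]
    exact mul_le_mul_of_nonneg_right bX ht0.le
  have hσ2 : |σ| ≤ 1 / 2 := by linarith
  have hs0 : 0 < 1 + σ := by linarith [(abs_le.1 hσ2).1]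
  obtain ⟨R, hR⟩ : ∃ x, x = Real.log (1 + σ) - (σ - σ ^ 2 / 2 + σ ^ 3 / 3) := ⟨_, rfl⟩
  have bR : |p * R| ≤ 32 * L ^ 4 * t ^ 3 := by
    have h1 := abs_log_one_add_taylor_le hσ2
    rw [← hR] at h1
    rw [abs_mul, abs_of_pos hp0]
    have h2 : σ ^ 4 ≤ (2 * (L * t)) ^ 4 := by
      have := pow_le_pow_left₀ (abs_nonneg σ) bσ 4
      have e4 : |σ| ^ 4 = σ ^ 4 := by
        rw [show (4 : ℕ) = 2 * 2 by norm_num, pow_mul, sq_abs, ← pow_mul]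
      rwa [e4] at this
    have h3 : p * |R| ≤ p * (2 * (2 * (L * t)) ^ 4) :=
      mul_le_mul_of_nonneg_left (h1.trans (by linarith)) hp0.le
    refine h3.trans (le_of_eq ?_)
    have : p * (2 * (2 * (L * t)) ^ 4) = 32 * L ^ 4 * t ^ 3 * (t * p) := by ring
    rw [this, htp, mul_one]
  have br := abs_expansion_remainder_le hL ht0 hu het bR b2 b1 bX
  obtain ⟨r, hr⟩ : ∃ r, r = e - (2 * u * x₂ + x₁ ^ 2) / 2 * t
    + x₁ * (X ^ 2 + X * u + u ^ 2) / 3 * t ^ 2 + p * R := ⟨_, rfl⟩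
  rw [← hr] at br
  obtain ⟨ζ, hζ⟩ : ∃ ζ, ζ = p * Real.log (1 + σ) - u := ⟨_, rfl⟩
  have hζr : ζ = (v - u ^ 2 / 2) * t + (w - u * v + u ^ 3 / 3) * t ^ 2 + r := by
    have e1 : p * Real.log (1 + σ) = p * R + (t * p) * (X - X ^ 2 * t / 2 + X ^ 3 * t ^ 2 / 3) := by
      rw [hR, hσ]; ring
    rw [hζ, e1, htp, hr, hX, hx₁, hx₂]
    ring
  have hζ3 : ζ ≤ 3 := by
    have h1 := Real.log_le_sub_one_of_pos hs0
    have h2 : p * Real.log (1 + σ) ≤ p * σ :=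
      mul_le_mul_of_nonneg_left (by linarith) hp0.le
    have h3 : p * σ = X := by rw [hσ, mul_comm X t, ← mul_assoc, mul_comm p t, htp, one_mul]
    have h4 := (abs_le.1 b1).2
    rw [hζ]
    linarith
  have ba₁ : |v - u ^ 2 / 2| ≤ 2 * L ^ 2 := by
    have h1 := abs_sub v (u ^ 2 / 2)
    rw [abs_div, abs_pow, abs_of_pos (by norm_num : (0 : ℝ) < 2)] at h1
    have hu2 : |u| ^ 2 ≤ L ^ 2 := pow_le_pow_left₀ (abs_nonneg u) hu 2
    have L12 : L ≤ L ^ 2 := le_self_pow₀ hL (by norm_num)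
    linarith [sq_nonneg L]
  have ba₂ : |w - u * v + u ^ 3 / 3| ≤ 3 * L ^ 3 := by
    have h1 := abs_add_le (w - u * v) (u ^ 3 / 3)
    have h2 := abs_sub w (u * v)
    rw [abs_div, abs_pow, abs_of_pos (by norm_num : (0 : ℝ) < 3)] at h1
    rw [abs_mul] at h2
    have h3 : |u| * |v| ≤ L * L := mul_le_mul hu hv (abs_nonneg v) hL0.le
    have hu3 : |u| ^ 3 ≤ L ^ 3 := pow_le_pow_left₀ (abs_nonneg u) hu 3
    have L13 : L ≤ L ^ 3 := le_self_pow₀ hL (by norm_num)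
    have L23 : L ^ 2 ≤ L ^ 3 := pow_le_pow_right₀ hL (by norm_num)
    rw [← sq] at h3
    have : 0 ≤ L ^ 3 := by positivity
    linarith
  have main := abs_exp_expansion_le hL ht0 hLt ba₁ ba₂ br hζr hζ3
  have hXe : (u + v / p + w / p ^ 2 + e) / p = σ := by
    rw [hσ, hX, hx₁, hx₂, ht]; ring
  have hpow : |1 + σ| ^ (p - 1) * (1 + σ) = Real.exp u * Real.exp ζ := by
    rw [abs_of_pos hs0, Real.rpow_sub_one hs0.ne', div_mul_cancel₀ _ hs0.ne',
      Real.rpow_def_of_pos hs0, mul_comm, ← Real.exp_add, hζ]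
    ring_nf
  have hmain : (1 + (v - f₁ u) / p + (w - f₂ u v) / p ^ 2) =
      1 + (v - u ^ 2 / 2) * t + (w - u * v + u ^ 3 / 3) * t ^ 2
        + (v - u ^ 2 / 2) ^ 2 * t ^ 2 / 2 := by
    rw [f₁, f₂, ht]; ring
  rw [hXe, hpow, hmain, ← mul_sub, abs_mul, abs_of_pos (Real.exp_pos u)]
  refine mul_le_mul_of_nonneg_left (main.trans (le_of_eq ?_)) (Real.exp_pos u).le
  rw [ht]; ring

/-! ### Decay of the density -/

lemma exp_bubble_mul_logWeight_pow_le (x : ℂ) :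
    Real.exp (bubble x) * logWeight x ^ 6 ≤ 8 * 25 ^ 6 * (1 + ‖x‖ ^ 2) ^ (-7 / 4 : ℝ) := by
  have h0 : (0 : ℝ) < 1 + ‖x‖ ^ 2 := by positivity
  have h1 := Real.log_le_rpow_div h0.le (show (0 : ℝ) < 1 / 24 by norm_num)
  have h2 := Real.one_le_rpow (show 1 ≤ 1 + ‖x‖ ^ 2 by linarith [sq_nonneg ‖x‖])
    (show (0 : ℝ) ≤ 1 / 24 by norm_num)
  have h3 : logWeight x ≤ 25 * (1 + ‖x‖ ^ 2) ^ (1 / 24 : ℝ) := by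
    rw [logWeight]; linarith
  have h4 := pow_le_pow_left₀ (zero_le_one.trans (one_le_logWeight x)) h3 6
  have e1 : (25 * (1 + ‖x‖ ^ 2) ^ (1 / 24 : ℝ)) ^ 6 = 25 ^ 6 * (1 + ‖x‖ ^ 2) ^ (1 / 4 : ℝ) := by
    rw [mul_pow, ← Real.rpow_natCast _ 6, ← Real.rpow_natCast _ 6, ← Real.rpow_mul h0.le]
    norm_num
  rw [e1] at h4
  have e2 : (1 + ‖x‖ ^ 2) ^ (-7 / 4 : ℝ) = (1 + ‖x‖ ^ 2) ^ (1 / 4 : ℝ) / (1 + ‖x‖ ^ 2) ^ 2 := by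
    rw [show (-7 / 4 : ℝ) = 1 / 4 - (2 : ℕ) by norm_num, Real.rpow_sub_natCast h0.ne']
  rw [exp_bubble, e2, add_comm (‖x‖ ^ 2) 1]
  calc 8 / (1 + ‖x‖ ^ 2) ^ 2 * logWeight x ^ 6
      ≤ 8 / (1 + ‖x‖ ^ 2) ^ 2 * (25 ^ 6 * (1 + ‖x‖ ^ 2) ^ (1 / 4 : ℝ)) := by gcongr
    _ = _ := by ring

lemma exists_bubbleDensity_bound : ∃ C, 0 < C ∧ ∀ p : ℝ, 1 ≤ p → ∀ x,
    |bubbleDensity p x| ≤ C * (1 + ‖x‖ ^ 2) ^ (-7 / 4 : ℝ) := by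
  obtain ⟨K, hK1, hU, hV, hW, -⟩ := exists_profile_bounds
  refine ⟨(8 * K ^ 4) * (8 * 25 ^ 6), by positivity, fun p hp x => ?_⟩
  have hw := one_le_logWeight x
  set L := K * logWeight x with hL
  have hL1 : 1 ≤ L := one_le_mul_of_one_le_of_one_le hK1 hw
  have hp0 : 0 < p := by linarith
  have hLL : L ≤ L ^ 4 := le_self_pow₀ hL1 (by norm_num)
  have b1 : |(V x - rhsV x) / p| ≤ 2 * L ^ 4 := by
    rw [abs_div, abs_of_pos hp0]
    refine (div_le_self (abs_nonneg _) hp).trans ?_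
    have h1 := abs_sub (V x) (rhsV x)
    have h2 := f₁_le (hU x) hL1
    have h3 := hV x
    rw [← rhsV] at h2
    linarith
  have b2 : |(W x - rhsW x) / p ^ 2| ≤ 5 * L ^ 4 := by
    rw [abs_div, abs_of_pos (by positivity : 0 < p ^ 2)]
    refine (div_le_self (abs_nonneg _) (one_le_pow₀ hp)).trans ?_
    have h1 := abs_sub (W x) (rhsW x)
    have h2 := f₂_le (hU x) (hV x) hL1
    have h3 := hW x
    rw [← rhsW] at h2
    linarith
  have b3 : |1 + (V x - rhsV x) / p + (W x - rhsW x) / p ^ 2| ≤ 8 * L ^ 4 := by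
    have h1 := abs_add_three 1 ((V x - rhsV x) / p) ((W x - rhsW x) / p ^ 2)
    rw [abs_one] at h1
    linarith
  have h6 : logWeight x ^ 4 ≤ logWeight x ^ 6 := pow_le_pow_right₀ hw (by norm_num)
  have h7 := exp_bubble_mul_logWeight_pow_le x
  rw [bubbleDensity, abs_mul, abs_of_pos (Real.exp_pos _)]
  calc Real.exp (bubble x) * |1 + (V x - rhsV x) / p + (W x - rhsW x) / p ^ 2|
      ≤ Real.exp (bubble x) * (8 * L ^ 4) := by gcongr
    _ = 8 * K ^ 4 * (Real.exp (bubble x) * logWeight x ^ 4) := by rw [hL]; ring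
    _ ≤ 8 * K ^ 4 * (Real.exp (bubble x) * logWeight x ^ 6) := by gcongr
    _ ≤ 8 * K ^ 4 * (8 * 25 ^ 6 * (1 + ‖x‖ ^ 2) ^ (-7 / 4 : ℝ)) := by gcongr
    _ = _ := by ring

/-- For `δ ≤ 1/4`, the density is smaller than the weight by a factor `1 / (1 + ‖x‖)`. -/
lemma rpow_decay_le {δ : ℝ} (hδ : δ ≤ 1 / 4) (x : ℂ) :
    (1 + ‖x‖ ^ 2) ^ (-7 / 4 : ℝ) ≤ (1 + ‖x‖ ^ 2) ^ (-(1 + δ)) * (2 / (1 + ‖x‖)) := by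
  have h0 : (0 : ℝ) < 1 + ‖x‖ ^ 2 := by positivity
  have h1 : (1 : ℝ) ≤ 1 + ‖x‖ ^ 2 := by linarith [sq_nonneg ‖x‖]
  have e1 : (1 + ‖x‖ ^ 2) ^ (-7 / 4 : ℝ) ≤ (1 + ‖x‖ ^ 2) ^ (-(1 + δ) + (-1 / 2)) :=
    Real.rpow_le_rpow_of_exponent_le h1 (by linarith)
  rw [Real.rpow_add h0] at e1
  refine e1.trans (mul_le_mul_of_nonneg_left ?_ (by positivity))
  have hn := norm_nonneg x
  have e2 : (1 + ‖x‖ ^ 2) ^ (-1 / 2 : ℝ) = (Real.sqrt (1 + ‖x‖ ^ 2))⁻¹ := by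
    rw [Real.sqrt_eq_rpow, ← Real.rpow_neg h0.le]; norm_num
  rw [e2, inv_eq_one_div, div_le_div_iff₀ (Real.sqrt_pos.2 h0) (by positivity)]
  have h3 : (1 + ‖x‖) / 2 ≤ Real.sqrt (1 + ‖x‖ ^ 2) := by
    apply Real.le_sqrt_of_sq_le
    nlinarith [sq_nonneg (1 - ‖x‖)]
  linarith

/-! ### The error of a single bubble -/

lemma eventually_exp_neg_le {a ε : ℝ} (ha : 0 < a) (hε : 0 < ε) (n : ℕ) :
    ∀ᶠ p : ℝ in atTop, Real.exp (-(a * p)) ≤ ε / p ^ n := by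
  have h1 : Tendsto (fun p : ℝ => (a * p) ^ n * Real.exp (-(a * p))) atTop (𝓝 0) :=
    (Real.tendsto_pow_mul_exp_neg_atTop_nhds_zero n).comp (tendsto_id.const_mul_atTop ha)
  filter_upwards [h1.eventually_lt_const (show 0 < a ^ n * ε by positivity), eventually_gt_atTop 0]
    with p hp hp0
  rw [mul_pow, mul_assoc] at hp
  rw [le_div_iff₀ (by positivity), mul_comm]
  exact (lt_of_mul_lt_mul_left hp (by positivity)).le

/-- A perturbation of order `1 / p` does not spoil a strict inequality between exponentials. -/
lemma eventually_add_div_mul_exp_le {a b A B : ℝ} (hab : b < a) :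
    ∀ᶠ p : ℝ in atTop, (Real.exp (-a) + A / p) * Real.exp (B / p) ≤ Real.exp (-b) := by
  have hA : Tendsto (fun p : ℝ => A / p) atTop (𝓝 0) := tendsto_const_nhds.div_atTop tendsto_id
  have hB : Tendsto (fun p : ℝ => B / p) atTop (𝓝 0) := tendsto_const_nhds.div_atTop tendsto_id
  have h1 : Tendsto (fun p : ℝ => (Real.exp (-a) + A / p) * Real.exp (B / p)) atTop
      (𝓝 ((Real.exp (-a) + 0) * Real.exp 0)) :=
    (hA.const_add _).mul ((Real.continuous_exp.tendsto 0).comp hB)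
  rw [add_zero, Real.exp_zero, mul_one] at h1
  exact (h1.eventually_lt_const (Real.exp_lt_exp.2 (by linarith))).mono fun p hp => hp.le

lemma rpow_le_of_mul_exp_le {s ξ c p : ℝ} (hs : 0 ≤ s) (hp : 0 < p)
    (h : s * Real.exp (2 * ξ) ≤ Real.exp (-c)) :
    s ^ p ≤ Real.exp (-(c * p)) * Real.exp (-(2 * (ξ * p))) := by
  have h1 : s ≤ Real.exp (-c - 2 * ξ) := by
    rw [Real.exp_sub, le_div_iff₀ (Real.exp_pos _)]; exact h
  refine (Real.rpow_le_rpow hs h1 hp.le).trans (le_of_eq ?_)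
  rw [← Real.exp_mul, ← Real.exp_add]
  ring_nf

lemma abs_coeffM_sub_le {p : ℝ} (hp : 1 ≤ p) : |coeffM p - 4| ≤ (|C₁| + |C₂|) / p := by
  have hp0 : 0 < p := by linarith
  have h1 := abs_add_le (C₁ / p) (C₂ / p ^ 2)
  rw [abs_div, abs_div, abs_of_pos hp0, abs_of_pos (by positivity : 0 < p ^ 2)] at h1
  have h2 : |C₂| / p ^ 2 ≤ |C₂| / p := by
    gcongr
    exact le_self_pow₀ hp (by norm_num)
  rw [show coeffM p - 4 = -(C₁ / p + C₂ / p ^ 2) by rw [coeffM]; ring, abs_neg, add_div]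
  linarith

/-- The error of a bubble where its logarithmic weight is small compared with `p`. -/
lemma exists_bubble_error_near :
    ∃ κ C : ℝ, 0 < κ ∧ 0 < C ∧ ∀ p : ℝ, 0 < p → ∀ Y : ℂ, logWeight Y ≤ κ * p → ∀ e : ℝ,
      |e| ≤ 1 / p ^ 3 → ∀ δ : ℝ, δ ≤ 1 / 4 →
        abs (|1 + (bubbleSum p Y + e) / p| ^ (p - 1) * (1 + (bubbleSum p Y + e) / p)
          - bubbleDensity p Y) ≤ C / p ^ 3 * (1 + ‖Y‖ ^ 2) ^ (-(1 + δ)) := by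
  obtain ⟨K, hK1, hU, hV, hW, -⟩ := exists_profile_bounds
  have hK0 : 0 < K := by linarith
  refine ⟨1 / (8 * K), 30000 * K ^ 6 * (8 * 25 ^ 6), by positivity, by positivity, ?_⟩
  intro p hp Y hY e he δ hδ
  have hw := one_le_logWeight Y
  have hL : 1 ≤ K * logWeight Y := one_le_mul_of_one_le_of_one_le hK1 hw
  have hLp : 8 * (K * logWeight Y) ≤ p := by
    rw [one_div_mul_eq_div, le_div_iff₀ (by positivity)] at hY
    linarith
  have key := abs_power_sub_expansion_le hL hLp (hU Y) (hV Y) (hW Y)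
    (he.trans (div_le_div_of_nonneg_right hL (by positivity)))
  rw [bubbleDensity, bubbleSum, rhsV, rhsW]
  refine key.trans ?_
  have h1 := exp_bubble_mul_logWeight_pow_le Y
  have h2 : (1 + ‖Y‖ ^ 2) ^ (-7 / 4 : ℝ) ≤ (1 + ‖Y‖ ^ 2) ^ (-(1 + δ)) :=
    Real.rpow_le_rpow_of_exponent_le (by linarith [sq_nonneg ‖Y‖]) (by linarith)
  calc Real.exp (bubble Y) * (30000 * (K * logWeight Y) ^ 6 / p ^ 3)
      = 30000 * K ^ 6 / p ^ 3 * (Real.exp (bubble Y) * logWeight Y ^ 6) := by ring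
    _ ≤ 30000 * K ^ 6 / p ^ 3 * (8 * 25 ^ 6 * (1 + ‖Y‖ ^ 2) ^ (-7 / 4 : ℝ)) := by gcongr
    _ ≤ 30000 * K ^ 6 / p ^ 3 * (8 * 25 ^ 6 * (1 + ‖Y‖ ^ 2) ^ (-(1 + δ))) := by gcongr
    _ = _ := by ring

/-- For `ξ > 0`, the function `|1 - 4 ξ| e^{2ξ}` is less than `1` up to `ξ = 1 / 4`, and increases
beyond. -/
lemma abs_one_sub_mul_exp_le {ξ κ X t c : ℝ} (h1 : κ ≤ ξ) (h2 : ξ ≤ X + t)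
    (hX : (4 * (X + t) - 1) * Real.exp (2 * (X + t)) ≤ Real.exp (-c)) (hK : c ≤ 2 * κ) :
    |1 - 4 * ξ| * Real.exp (2 * ξ) ≤ Real.exp (-c) := by
  rcases le_or_gt ξ (1 / 4) with h | h
  · rw [abs_of_nonneg (by linarith)]
    have h3 : 1 - 4 * ξ ≤ Real.exp (-(4 * ξ)) := by
      have := Real.add_one_le_exp (-(4 * ξ)); linarith
    calc (1 - 4 * ξ) * Real.exp (2 * ξ) ≤ Real.exp (-(4 * ξ)) * Real.exp (2 * ξ) := by gcongr
      _ = Real.exp (-(2 * ξ)) := by rw [← Real.exp_add]; ring_nf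
      _ ≤ _ := Real.exp_le_exp.2 (by linarith)
  · rw [abs_of_neg (by linarith)]
    refine le_trans ?_ hX
    exact mul_le_mul (by linarith) (Real.exp_le_exp.2 (by linarith)) (Real.exp_pos _).le
      (by linarith)

/-- The error of a bubble where its logarithmic weight is comparable with `p`: both the power and
the density are exponentially small compared with the weight. -/
lemma exists_bubble_error_far {κ K c₁ X₀ : ℝ} (hκ : 0 < κ) (hK : 0 < K) (hc₁ : 0 < c₁)
    (hX₀ : 0 < X₀) :
    ∃ δ₀ : ℝ, 0 < δ₀ ∧ δ₀ ≤ 1 / 4 ∧ ∃ C, 0 < C ∧ ∀ᶠ p : ℝ in atTop, ∀ X ≤ X₀,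
      (4 * X - 1) * Real.exp (2 * X) ≤ Real.exp (-c₁) → ∀ Y : ℂ, κ * p < logWeight Y →
      ‖Y‖ ≤ Real.exp (X * p + K) → ∀ e : ℝ, |e| ≤ K → ∀ δ : ℝ, 0 < δ → δ ≤ δ₀ →
        abs (|1 + (bubbleSum p Y + e) / p| ^ (p - 1) * (1 + (bubbleSum p Y + e) / p)
          - bubbleDensity p Y) ≤ C / p ^ 3 * (1 + ‖Y‖ ^ 2) ^ (-(1 + δ)) := by
  obtain ⟨K₁, hK₁, hfar⟩ := exists_bubbleSum_far
  obtain ⟨D, hD, hdens⟩ := exists_bubbleDensity_bound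
  obtain ⟨c, hc⟩ : ∃ c, c = min (κ / 2) (c₁ / 2) / 2 := ⟨_, rfl⟩
  have hc0 : 0 < c := by rw [hc]; positivity
  have hc2 : 2 * c ≤ κ / 2 := by rw [hc]; linarith [min_le_left (κ / 2) (c₁ / 2)]
  have hc3 : 2 * c ≤ c₁ / 2 := by rw [hc]; linarith [min_le_right (κ / 2) (c₁ / 2)]
  obtain ⟨K₃, hK₃⟩ : ∃ K₃, K₃ = K₁ + Real.log 8 + K + (|C₁| + |C₂|) * (X₀ + K) := ⟨_, rfl⟩
  refine ⟨min (1 / 4) (c / (4 * X₀)), by positivity, min_le_left _ _,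
    4 * Real.exp K + 2 * D, by positivity, ?_⟩
  filter_upwards [eventually_ge_atTop 1, eventually_ge_atTop (4 / κ),
    eventually_add_div_mul_exp_le (A := 4 * K * Real.exp (2 * X₀)) (B := 2 * K)
      (show c₁ / 2 < c₁ by linarith),
    eventually_add_div_mul_exp_le (A := K₃ * Real.exp (2 * (X₀ + K))) (B := 0)
      (show c < 2 * c by linarith),
    eventually_exp_neg_le (show 0 < c / 2 by linarith) one_pos 3,
    eventually_exp_neg_le (show 0 < κ / 4 by linarith) one_pos 3]
    with p hp1 hpκ hpX hps hpc hpκ' X hX hXe Y hY hYX e he δ hδ hδ₀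
  have hp0 : 0 < p := by linarith
  rw [div_le_iff₀ hκ] at hpκ
  -- the logarithm of `‖Y‖` is at least `κ p / 4`
  have hY1 : 1 ≤ ‖Y‖ := by
    by_contra! h
    have h1 : Real.log (1 + ‖Y‖ ^ 2) ≤ 1 := by
      have := Real.log_le_sub_one_of_pos (show 0 < 1 + ‖Y‖ ^ 2 by positivity)
      have h2 : ‖Y‖ ^ 2 ≤ 1 := pow_le_one₀ (norm_nonneg _) h.le
      linarith
    rw [logWeight] at hY
    linarith
  have hY0 : 0 < ‖Y‖ := by linarith
  obtain ⟨ℓ, hℓ⟩ : ∃ ℓ, ℓ = Real.log ‖Y‖ := ⟨_, rfl⟩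
  have hYℓ : ‖Y‖ = Real.exp ℓ := by rw [hℓ, Real.exp_log hY0]
  have hY2 : 1 + ‖Y‖ ^ 2 ≤ 2 * Real.exp (2 * ℓ) := by
    rw [two_mul ℓ, Real.exp_add, ← hYℓ]; nlinarith
  have hℓ1 : κ * p / 4 ≤ ℓ := by
    have h1 := Real.log_le_log (by positivity) hY2
    rw [Real.log_mul two_ne_zero (Real.exp_ne_zero _), Real.log_exp] at h1
    have h2 := Real.log_two_lt_d9
    rw [logWeight] at hY
    linarith
  have hℓ2 : ℓ ≤ X * p + K := by
    rw [hYℓ] at hYX; exact Real.exp_le_exp.1 hYX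
  have hℓ0 : 0 < ℓ := lt_of_lt_of_le (by positivity) hℓ1
  obtain ⟨ξ, hξ⟩ : ∃ ξ, ξ = ℓ / p := ⟨_, rfl⟩
  have hξp : ξ * p = ℓ := by rw [hξ]; field_simp
  have hξ1 : κ / 4 ≤ ξ := by rw [hξ, le_div_iff₀ hp0]; linarith
  have hξ2 : ξ ≤ X + K / p := by
    rw [hξ, div_le_iff₀ hp0, add_mul, div_mul_cancel₀ _ hp0.ne']; exact hℓ2
  have hKp : K / p ≤ K := div_le_self hK.le hp1
  have hξ3 : ξ ≤ X₀ + K := by linarith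
  have hξ0 : 0 < ξ := by linarith
  have hXt : (4 * (X + K / p) - 1) * Real.exp (2 * (X + K / p)) ≤ Real.exp (-(c₁ / 2)) := by
    refine le_trans ?_ hpX
    have e1 : (4 * (X + K / p) - 1) * Real.exp (2 * (X + K / p)) =
        ((4 * X - 1) * Real.exp (2 * X) + 4 * K / p * Real.exp (2 * X)) *
          Real.exp (2 * K / p) := by
      rw [show 2 * (X + K / p) = 2 * X + 2 * K / p by ring, Real.exp_add]; ring
    rw [e1]
    have e2 : 4 * K / p * Real.exp (2 * X) ≤ 4 * K * Real.exp (2 * X₀) / p := by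
      rw [div_mul_eq_mul_div]
      gcongr
    exact mul_le_mul_of_nonneg_right (by linarith) (Real.exp_pos _).le
  have hmain : |1 - 4 * ξ| * Real.exp (2 * ξ) ≤ Real.exp (-(2 * c)) :=
    abs_one_sub_mul_exp_le hξ1 hξ2
      (hXt.trans (Real.exp_le_exp.2 (by linarith))) (by linarith)
  -- the base of the power
  obtain ⟨s, hs⟩ : ∃ s, s = 1 + (bubbleSum p Y + e) / p := ⟨_, rfl⟩
  have hs1 : |s| ≤ |1 - 4 * ξ| + K₃ / p := by
    have e1 : s = (1 - 4 * ξ) + ((bubbleSum p Y - Real.log 8 + coeffM p * ℓ) + Real.log 8 + e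
        - (coeffM p - 4) * ℓ) / p := by
      rw [hs, hξ]; ring
    have h1 := hfar p hp1 Y hY1
    rw [← hℓ] at h1
    have h2 : K₁ / ‖Y‖ ≤ K₁ := div_le_self hK₁.le hY1
    have h3 := abs_coeffM_sub_le hp1
    have h4 : |(coeffM p - 4) * ℓ| ≤ (|C₁| + |C₂|) * (X₀ + K) := by
      rw [abs_mul, abs_of_pos hℓ0]
      calc |coeffM p - 4| * ℓ ≤ (|C₁| + |C₂|) / p * ℓ := by gcongr
        _ = (|C₁| + |C₂|) * ξ := by rw [hξ]; ring
        _ ≤ _ := by gcongr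
    rw [e1]
    refine (abs_add_le _ _).trans (add_le_add_right ?_ _)
    rw [abs_div, abs_of_pos hp0]
    refine div_le_div_of_nonneg_right ?_ hp0.le
    have h5 := abs_sub (bubbleSum p Y - Real.log 8 + coeffM p * ℓ + Real.log 8 + e)
      ((coeffM p - 4) * ℓ)
    have h6 := abs_add_three (bubbleSum p Y - Real.log 8 + coeffM p * ℓ) (Real.log 8) e
    rw [abs_of_pos (Real.log_pos (by norm_num : (1 : ℝ) < 8))] at h6
    rw [hK₃]
    linarith
  have hs2 : |s| * Real.exp (2 * ξ) ≤ Real.exp (-c) := by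
    refine le_trans ?_ hps
    rw [zero_div, Real.exp_zero, mul_one]
    have h1 := mul_le_mul_of_nonneg_right hs1 (Real.exp_pos (2 * ξ)).le
    rw [add_mul] at h1
    have hK₃0 : 0 ≤ K₃ := by
      rw [hK₃]; have := Real.log_pos (by norm_num : (1 : ℝ) < 8); positivity
    have h2 : K₃ / p * Real.exp (2 * ξ) ≤ K₃ * Real.exp (2 * (X₀ + K)) / p := by
      rw [div_mul_eq_mul_div]
      gcongr
    linarith
  have hpow := rpow_le_of_mul_exp_le (abs_nonneg s) hp0 hs2
  rw [hξp] at hpow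
  have hY3 : 0 < 1 + ‖Y‖ ^ 2 := by positivity
  -- comparison with the weight
  have hδ1 : δ ≤ 1 / 4 := hδ₀.trans (min_le_left _ _)
  have hδ2 : 4 * X₀ * δ ≤ c := by
    have := hδ₀.trans (min_le_right _ _)
    rw [le_div_iff₀ (by positivity)] at this
    linarith
  have hwt : Real.exp (-(2 * ℓ)) ≤
      4 * Real.exp K * Real.exp (c / 2 * p) * (1 + ‖Y‖ ^ 2) ^ (-(1 + δ)) := by
    have h1 : (1 + ‖Y‖ ^ 2) ^ (1 + δ) ≤
        4 * Real.exp K * Real.exp (c / 2 * p) * Real.exp (2 * ℓ) := by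
      refine (Real.rpow_le_rpow hY3.le hY2 (by linarith)).trans ?_
      rw [Real.mul_rpow two_pos.le (Real.exp_pos _).le, ← Real.exp_mul]
      have h2 : (2 : ℝ) ^ (1 + δ) ≤ 4 := by
        calc (2 : ℝ) ^ (1 + δ) ≤ 2 ^ (2 : ℝ) :=
              Real.rpow_le_rpow_of_exponent_le (by norm_num) (by linarith)
          _ = 4 := by norm_num
      have h3 : Real.exp (2 * ℓ * (1 + δ)) ≤
          Real.exp K * Real.exp (c / 2 * p) * Real.exp (2 * ℓ) := by
        rw [← Real.exp_add, ← Real.exp_add]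
        apply Real.exp_le_exp.2
        have h4 : X * p ≤ X₀ * p := mul_le_mul_of_nonneg_right hX hp0.le
        have h5 : 2 * δ * ℓ ≤ 2 * δ * (X₀ * p + K) :=
          mul_le_mul_of_nonneg_left (by linarith) (by linarith)
        have h6 : 4 * X₀ * δ * p ≤ c * p := mul_le_mul_of_nonneg_right hδ2 hp0.le
        have h7 : δ * K ≤ 1 / 4 * K := mul_le_mul_of_nonneg_right hδ1 hK.le
        linarith
      calc (2 : ℝ) ^ (1 + δ) * Real.exp (2 * ℓ * (1 + δ))
          ≤ 4 * (Real.exp K * Real.exp (c / 2 * p) * Real.exp (2 * ℓ)) := by gcongr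
        _ = _ := by ring
    rw [Real.rpow_neg hY3.le, Real.exp_neg, ← div_eq_mul_inv, le_div_iff₀ (by positivity),
      ← div_eq_inv_mul, div_le_iff₀ (Real.exp_pos _)]
    exact h1
  have hfirst : |s| ^ p ≤ 4 * Real.exp K / p ^ 3 * (1 + ‖Y‖ ^ 2) ^ (-(1 + δ)) := by
    have e1 : Real.exp (-(c * p)) = Real.exp (-(c / 2 * p)) * Real.exp (-(c / 2 * p)) := by
      rw [← Real.exp_add]; ring_nf
    have e2 : Real.exp (-(c / 2 * p)) * Real.exp (c / 2 * p) = 1 := by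
      rw [← Real.exp_add, neg_add_cancel, Real.exp_zero]
    calc |s| ^ p ≤ Real.exp (-(c * p)) * Real.exp (-(2 * ℓ)) := hpow
      _ ≤ Real.exp (-(c * p)) *
          (4 * Real.exp K * Real.exp (c / 2 * p) * (1 + ‖Y‖ ^ 2) ^ (-(1 + δ))) := by gcongr
      _ = Real.exp (-(c / 2 * p)) * (Real.exp (-(c / 2 * p)) * Real.exp (c / 2 * p)) *
          (4 * Real.exp K * (1 + ‖Y‖ ^ 2) ^ (-(1 + δ))) := by rw [e1]; ring
      _ = Real.exp (-(c / 2 * p)) * (4 * Real.exp K * (1 + ‖Y‖ ^ 2) ^ (-(1 + δ))) := by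
          rw [e2, mul_one]
      _ ≤ 1 / p ^ 3 * (4 * Real.exp K * (1 + ‖Y‖ ^ 2) ^ (-(1 + δ))) := by gcongr
      _ = _ := by ring
  have hsecond : |bubbleDensity p Y| ≤ 2 * D / p ^ 3 * (1 + ‖Y‖ ^ 2) ^ (-(1 + δ)) := by
    have h1 : 2 / (1 + ‖Y‖) ≤ 2 * (1 / p ^ 3) := by
      refine le_trans ?_ (mul_le_mul_of_nonneg_left hpκ' two_pos.le)
      rw [div_eq_mul_inv]
      refine mul_le_mul_of_nonneg_left ?_ two_pos.le
      rw [Real.exp_neg]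
      refine inv_anti₀ (Real.exp_pos _) ?_
      have := Real.exp_le_exp.2 (show κ / 4 * p ≤ ℓ by linarith)
      linarith
    calc |bubbleDensity p Y| ≤ D * (1 + ‖Y‖ ^ 2) ^ (-7 / 4 : ℝ) := hdens p hp1 Y
      _ ≤ D * ((1 + ‖Y‖ ^ 2) ^ (-(1 + δ)) * (2 / (1 + ‖Y‖))) := by
          gcongr; exact rpow_decay_le hδ1 Y
      _ ≤ D * ((1 + ‖Y‖ ^ 2) ^ (-(1 + δ)) * (2 * (1 / p ^ 3))) := by gcongr
      _ = _ := by ring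
  rw [← hs]
  have h1 := abs_sub (|s| ^ (p - 1) * s) (bubbleDensity p Y)
  rw [abs_rpow_sub_one_mul hp0] at h1
  rw [add_div, add_mul]
  linarith

/-- The error of a bubble: in a region of radius `e ^ (X p)` in the rescaled variable, the power
of `1 + (U + V / p + W / p² + e) / p` agrees with the density to the order `p⁻³`, in the weighted
norm. The condition on `X` expresses that the power decays faster than `‖Y‖⁻²`. -/
lemma exists_bubble_error {K c₀ c₁ X₀ : ℝ} (hK : 0 < K) (hc₀ : 0 < c₀) (hc₁ : 0 < c₁)
    (hX₀ : 0 < X₀) :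
    ∃ δ₀ : ℝ, 0 < δ₀ ∧ δ₀ ≤ 1 / 4 ∧ ∃ C, 0 < C ∧ ∀ᶠ p : ℝ in atTop, ∀ X ≤ X₀,
      (4 * X - 1) * Real.exp (2 * X) ≤ Real.exp (-c₁) → ∀ Y : ℂ,
      ‖Y‖ ≤ Real.exp (X * p + K) → ∀ e : ℝ, |e| ≤ K →
      |e| ≤ K * (1 + ‖Y‖) * Real.exp (-(c₀ * p)) → ∀ δ : ℝ, 0 < δ → δ ≤ δ₀ →
        abs (|1 + (bubbleSum p Y + e) / p| ^ (p - 1) * (1 + (bubbleSum p Y + e) / p)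
          - bubbleDensity p Y) ≤ C / p ^ 3 * (1 + ‖Y‖ ^ 2) ^ (-(1 + δ)) := by
  obtain ⟨κ₀, C, hκ₀, hC, hnear⟩ := exists_bubble_error_near
  have hκ : 0 < min κ₀ (c₀ / 2) := by positivity
  obtain ⟨δ₀, hδ₀, hδ₁, C', hC', hfar⟩ := exists_bubble_error_far hκ hK hc₁ hX₀
  refine ⟨δ₀, hδ₀, hδ₁, C + C', by positivity, ?_⟩
  filter_upwards [hfar, eventually_gt_atTop 0,
    eventually_exp_neg_le (show 0 < c₀ / 2 by linarith) (show 0 < 1 / (2 * K) by positivity) 3]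
    with p hp hp0 hpe X hX hXe Y hYX e he heY δ hδ hδδ
  have hw : 0 ≤ (1 + ‖Y‖ ^ 2) ^ (-(1 + δ)) := by positivity
  rcases le_or_gt (logWeight Y) (min κ₀ (c₀ / 2) * p) with h | h
  · have h1 : logWeight Y ≤ κ₀ * p :=
      h.trans (mul_le_mul_of_nonneg_right (min_le_left _ _) hp0.le)
    have h2 : logWeight Y ≤ c₀ / 2 * p :=
      h.trans (mul_le_mul_of_nonneg_right (min_le_right _ _) hp0.le)
    have h3 : |e| ≤ 1 / p ^ 3 := by
      have h4 : 1 + ‖Y‖ ≤ 2 * Real.exp (c₀ / 2 * p) := by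
        have h5 : 1 + ‖Y‖ ^ 2 ≤ Real.exp (c₀ / 2 * p) := by
          rw [← Real.log_le_iff_le_exp (by positivity)]
          rw [logWeight] at h2; linarith
        nlinarith [sq_nonneg (‖Y‖ - 1)]
      calc |e| ≤ K * (1 + ‖Y‖) * Real.exp (-(c₀ * p)) := heY
        _ ≤ K * (2 * Real.exp (c₀ / 2 * p)) * Real.exp (-(c₀ * p)) := by gcongr
        _ = 2 * K * Real.exp (-(c₀ / 2 * p)) := by
            rw [show -(c₀ / 2 * p) = c₀ / 2 * p + -(c₀ * p) by ring, Real.exp_add]; ring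
        _ ≤ 2 * K * (1 / (2 * K) / p ^ 3) := by gcongr
        _ = 1 / p ^ 3 := by field_simp
    refine (hnear p hp0 Y h1 e h3 δ (hδδ.trans hδ₁)).trans ?_
    gcongr
    linarith
  · refine (hp X hX hXe Y h hYX e he δ hδ hδδ).trans ?_
    gcongr
    linarith

/-! ### The concentration rates of the parameters -/

/-- The exponential rate of `ρ`: the relations between the parameters force
`-log ρ = p · rate k η + O(1)`. -/
def rate (k : ℕ) (η : ℝ) : ℝ := -Real.log η / (2 * k * η + 2 * k - 2 - 2 / η)

/-- The inequalities between the rates on which the estimates rest, with a margin `c`. The rates of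
`α`, `β ^ k` and `ρ` are `1 / 4 + k η r`, `1 / 4 + r / η` and `r = rate k η`. The field `peak_lt`
says that `β ^ k` is much smaller than `ρ ^ k`, and `power_lt` that at the distance `ρ` from the
origin the power of the ansatz is already smaller than the weight. -/
structure AdmissibleRatio (k : ℕ) (c η : ℝ) : Prop where
  le_eta : c ≤ η
  eta_le : η ≤ 1
  le_mul : c ≤ k * η - 1
  le_den : c ≤ 2 * k * η + 2 * k - 2 - 2 / η
  le_rate : c ≤ rate k η
  rate_le : rate k η ≤ 1 / 2 - c
  peak_lt : c ≤ 1 / 4 - (k - 1 / η) * rate k η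
  power_lt : 4 * (k * η - 1) * rate k η * Real.exp (1 / 2 + 2 * (k * η - 1) * rate k η) ≤
    Real.exp (-c)

lemma eventually_admissibleRatio {k : ℕ} {c η₀ : ℝ} (hη₀ : 0 < η₀) (h1 : c < η₀) (h2 : η₀ < 1)
    (h3 : c < k * η₀ - 1) (hden : 0 < 2 * k * η₀ + 2 * k - 2 - 2 / η₀)
    (h4 : c < 2 * k * η₀ + 2 * k - 2 - 2 / η₀) (h5 : c < rate k η₀) (h6 : rate k η₀ < 1 / 2 - c)
    (h7 : c < 1 / 4 - (k - 1 / η₀) * rate k η₀)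
    (h8 : 4 * (k * η₀ - 1) * rate k η₀ * Real.exp (1 / 2 + 2 * (k * η₀ - 1) * rate k η₀) <
      Real.exp (-c)) :
    ∀ᶠ η in 𝓝 η₀, AdmissibleRatio k c η := by
  have hinv : ContinuousAt (fun η : ℝ => 1 / η) η₀ := continuousAt_const.div continuousAt_id hη₀.ne'
  have hd : ContinuousAt (fun η : ℝ => 2 * (k : ℝ) * η + 2 * k - 2 - 2 / η) η₀ := by
    have : ContinuousAt (fun η : ℝ => 2 / η) η₀ := continuousAt_const.div continuousAt_id hη₀.ne'
    fun_prop
  have hr : ContinuousAt (rate k) η₀ :=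
    (Real.continuousAt_log hη₀.ne').neg.div hd hden.ne'
  have hk : ContinuousAt (fun η : ℝ => (k : ℝ) * η - 1) η₀ := by fun_prop
  have hpk : ContinuousAt (fun η : ℝ => 1 / 4 - ((k : ℝ) - 1 / η) * rate k η) η₀ := by fun_prop
  have hpow : ContinuousAt (fun η : ℝ => 4 * (k * η - 1) * rate k η *
      Real.exp (1 / 2 + 2 * (k * η - 1) * rate k η)) η₀ := by fun_prop
  filter_upwards [continuousAt_id.eventually_const_lt h1, continuousAt_id.eventually_lt_const h2,
    hk.eventually_const_lt h3, hd.eventually_const_lt h4, hr.eventually_const_lt h5,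
    hr.eventually_lt_const h6, hpk.eventually_const_lt h7, hpow.eventually_lt_const h8]
    with η a1 a2 a3 a4 a5 a6 a7 a8
  exact ⟨a1.le, a2.le, a3.le, a4.le, a5.le, a6.le, a7.le, a8.le⟩

lemma exists_admissibleRatio {k : ℕ} (hk : k = 4 ∨ k = 5) :
    ∃ ε : ℝ, 0 < ε ∧ ∀ η : ℝ, 2 / ((k : ℝ) - 1) - ε ≤ η → η ≤ 2 / ((k : ℝ) - 1) + ε →
      AdmissibleRatio k (1 / 100) η := by
  suffices h : ∀ᶠ η in 𝓝 (2 / ((k : ℝ) - 1)), AdmissibleRatio k (1 / 100) η by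
    obtain ⟨ε, hε, h⟩ := Metric.eventually_nhds_iff_ball.1 h
    refine ⟨ε / 2, by positivity, fun η h1 h2 => h η ?_⟩
    rw [Metric.mem_ball, Real.dist_eq, abs_lt]
    constructor <;> linarith
  have hexp : (99 / 100 : ℝ) ≤ Real.exp (-(1 / 100)) := by
    have := Real.add_one_le_exp (-(1 / 100 : ℝ)); linarith
  have l2 := Real.log_two_gt_d9
  have l2' := Real.log_two_lt_d9
  rcases hk with rfl | rfl
  · have hr : rate 4 (2 / 3) = 3 * (Real.log 3 - Real.log 2) / 25 := by
      rw [rate, Real.log_div (by norm_num) (by norm_num)]; norm_num; ring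
    have l3 := Real.log_three_gt_d9
    have l3' := Real.log_three_lt_d9
    have e : 2 / (((4 : ℕ) : ℝ) - 1) = 2 / 3 := by norm_num
    have r1 : rate 4 (2 / 3) < 1 / 20 := by rw [hr]; linarith
    have r2 : 1 / 25 < rate 4 (2 / 3) := by rw [hr]; linarith
    rw [e]
    refine eventually_admissibleRatio (by norm_num) (by norm_num) (by norm_num) (by norm_num)
      (by norm_num) (by norm_num) (by linarith) (by linarith) (by norm_num; linarith) ?_
    refine lt_of_lt_of_le ?_ hexp
    have e1 : 4 * (((4 : ℕ) : ℝ) * (2 / 3) - 1) * rate 4 (2 / 3) ≤ 1 / 3 := by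
      norm_num; linarith
    have e2 : Real.exp (1 / 2 + 2 * (((4 : ℕ) : ℝ) * (2 / 3) - 1) * rate 4 (2 / 3)) ≤
        2.7182818286 := by
      refine le_trans (Real.exp_le_exp.2 ?_) Real.exp_one_lt_d9.le
      norm_num; linarith
    calc _ ≤ 1 / 3 * (2.7182818286 : ℝ) := mul_le_mul e1 e2 (Real.exp_pos _).le (by norm_num)
      _ < 99 / 100 := by norm_num
  · have hr : rate 5 (1 / 2) = Real.log 2 / 9 := by
      rw [rate, Real.log_div (by norm_num) (by norm_num)]; norm_num
    have e : 2 / (((5 : ℕ) : ℝ) - 1) = 1 / 2 := by norm_num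
    have r1 : rate 5 (1 / 2) < 1 / 10 := by rw [hr]; linarith
    have r2 : 1 / 25 < rate 5 (1 / 2) := by rw [hr]; linarith
    rw [e]
    refine eventually_admissibleRatio (by norm_num) (by norm_num) (by norm_num) (by norm_num)
      (by norm_num) (by norm_num) (by linarith) (by linarith) (by norm_num; linarith) ?_
    refine lt_of_lt_of_le ?_ hexp
    have e1 : 4 * (((5 : ℕ) : ℝ) * (1 / 2) - 1) * rate 5 (1 / 2) ≤ 0.4622 := by
      rw [hr]; norm_num; linarith
    have e2 : Real.exp (1 / 2 + 2 * (((5 : ℕ) : ℝ) * (1 / 2) - 1) * rate 5 (1 / 2)) ≤ 2.08 := by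
      refine le_of_pow_le_pow_left₀ (n := 6) (by norm_num) (by norm_num) ?_
      rw [← Real.exp_nat_mul]
      have e3 : ((6 : ℕ) : ℝ) * (1 / 2 + 2 * (((5 : ℕ) : ℝ) * (1 / 2) - 1) * rate 5 (1 / 2)) =
          ((3 : ℕ) : ℝ) * 1 + ((2 : ℕ) : ℝ) * Real.log 2 := by
        rw [hr]; norm_num; ring
      rw [e3, Real.exp_add, Real.exp_nat_mul, Real.exp_nat_mul, Real.exp_log two_pos]
      have := pow_le_pow_left₀ (Real.exp_pos 1).le Real.exp_one_lt_d9.le 3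
      calc Real.exp 1 ^ 3 * 2 ^ 2 ≤ (2.7182818286 : ℝ) ^ 3 * 2 ^ 2 := by gcongr
        _ ≤ _ := by norm_num
    calc _ ≤ (0.4622 : ℝ) * 2.08 := mul_le_mul e1 e2 (Real.exp_pos _).le (by norm_num)
      _ < 99 / 100 := by norm_num

/-- A relation `M q = p + log 8 + 2 g π M H` with `M = 4 + O(1 / p)` gives `q = p / 4 + O(1)`. -/
lemma abs_sub_quarter_le {M q p E g G H : ℝ} (hp : 0 < p) (hM : 2 ≤ M) (hME : |M - 4| ≤ E / p)
    (hg : |g| ≤ G) (h : M * q = p + Real.log 8 + 2 * g * Real.pi * M * H) :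
    |q - p / 4| ≤ E / 8 + Real.log 8 / 2 + 2 * G * Real.pi * |H| := by
  have hpi := Real.pi_pos
  have hM0 : 0 < M := by linarith
  have hl8 : 0 < Real.log 8 := Real.log_pos (by norm_num)
  have h2 : q - p / 4 = -((M - 4) * p) / (4 * M) + Real.log 8 / M + 2 * g * Real.pi * H := by
    have : q = (p + Real.log 8 + 2 * g * Real.pi * M * H) / M := by
      rw [← h]; field_simp
    rw [this]; field_simp; ring
  have hE : |M - 4| * p ≤ E := by rwa [le_div_iff₀ hp] at hME
  have hE0 : 0 ≤ E := le_trans (by positivity) hE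
  rw [h2]
  refine (abs_add_three _ _ _).trans (add_le_add (add_le_add ?_ ?_) ?_)
  · rw [abs_div, abs_neg, abs_mul, abs_of_pos hp, abs_of_pos (by positivity : 0 < 4 * M)]
    exact div_le_div₀ hE0 hE (by norm_num) (by linarith)
  · rw [abs_of_pos (by positivity)]
    exact div_le_div_of_nonneg_left hl8.le two_pos hM
  · rw [abs_mul, abs_mul, abs_mul, abs_of_pos hpi, abs_two]
    gcongr

/-- Solving the relations to the leading order. -/
lemma rate_bounds {k : ℕ} (hk : 0 < k) {c η p A R B K₁ K₂ K₃ : ℝ} (hc : 0 < c)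
    (hη : AdmissibleRatio k c η) (hK₂ : K₂ = (4 * K₁ + 1 / c + 2 * Real.log k) / c)
    (hK₃ : K₃ = k * K₂ + K₂ / c + K₁) (q1 : |A - k * η * R - p / 4| ≤ K₁)
    (q2 : |B - R / η - p / 4| ≤ K₁)
    (h : 2 * A - Real.log η - 2 * Real.log k + (2 * k - 2) * R - 2 * B = -(p * Real.log η)) :
    |R - p * rate k η| ≤ K₂ ∧ |A - p * (1 / 4 + k * η * rate k η)| ≤ K₃ ∧
      |B - p * (1 / 4 + rate k η / η)| ≤ K₃ := by
  have hk1 : (1 : ℝ) ≤ k := by exact_mod_cast hk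
  have hlk : 0 ≤ Real.log k := Real.log_nonneg hk1
  have hη0 : 0 < η := hc.trans_le hη.le_eta
  have hiη : 1 / η ≤ 1 / c := one_div_le_one_div_of_le hc hη.le_eta
  have hiη0 : 0 < 1 / η := by positivity
  have hic : 0 < 1 / c := by positivity
  have hK₁0 : 0 ≤ K₁ := (abs_nonneg _).trans q1
  have hK₂0 : 0 ≤ K₂ := by rw [hK₂]; positivity
  have hkη : k * η ≤ k := mul_le_of_le_one_right (by linarith) hη.eta_le
  have hlη : |Real.log η| ≤ 1 / c := by
    rw [abs_of_nonpos (Real.log_nonpos hη0.le hη.eta_le)]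
    have := Real.log_le_sub_one_of_pos hiη0
    rw [one_div, Real.log_inv, ← one_div] at this
    linarith
  obtain ⟨r, hr⟩ : ∃ r, r = rate k η := ⟨_, rfl⟩
  obtain ⟨D, hD⟩ : ∃ D, D = 2 * k * η + 2 * k - 2 - 2 / η := ⟨_, rfl⟩
  have hDc : c ≤ D := by rw [hD]; exact hη.le_den
  have hDr : D * r = -Real.log η := by
    rw [hr, rate, ← hD, mul_div_cancel₀ _ (by linarith)]
  rw [← hr]
  have hRr : |R - p * r| ≤ K₂ := by
    have h1 : D * (R - p * r) = -2 * (A - k * η * R - p / 4) + 2 * (B - R / η - p / 4)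
        + Real.log η + 2 * Real.log k := by
      have e1 : D * (p * r) = p * -Real.log η := by rw [← hDr]; ring
      have e2 : D * R = 2 * (k * η * R) + (2 * k - 2) * R - 2 * (R / η) := by rw [hD]; ring
      rw [mul_sub, e1, e2]
      linarith
    have h2 : D * |R - p * r| ≤ 4 * K₁ + 1 / c + 2 * Real.log k := by
      rw [← abs_of_pos (show 0 < D by linarith), ← abs_mul, h1]
      have b1 := abs_le.1 q1
      have b2 := abs_le.1 q2
      have b3 := abs_le.1 hlη
      rw [abs_le]
      constructor <;> linarith
    rw [hK₂, le_div_iff₀ hc, mul_comm]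
    exact (mul_le_mul_of_nonneg_right hDc (abs_nonneg _)).trans h2
  refine ⟨hRr, ?_, ?_⟩
  · have h1 : A - p * (1 / 4 + k * η * r) = (A - k * η * R - p / 4) + k * η * (R - p * r) := by ring
    have h2 := abs_add_le (A - k * η * R - p / 4) (k * η * (R - p * r))
    rw [abs_mul, abs_of_pos (by positivity : 0 < k * η)] at h2
    have h3 : k * η * |R - p * r| ≤ k * K₂ :=
      mul_le_mul hkη hRr (abs_nonneg _) (by linarith)
    rw [h1, hK₃]
    have : 0 ≤ K₂ / c := by positivity
    linarith
  · have h1 : B - p * (1 / 4 + r / η) = (B - R / η - p / 4) + 1 / η * (R - p * r) := by ring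
    have h2 := abs_add_le (B - R / η - p / 4) (1 / η * (R - p * r))
    rw [abs_mul, abs_of_pos hiη0] at h2
    have h3 : 1 / η * |R - p * r| ≤ 1 / c * K₂ :=
      mul_le_mul hiη hRr (abs_nonneg _) hic.le
    rw [show 1 / c * K₂ = K₂ / c by ring] at h3
    rw [h1, hK₃]
    have : 0 ≤ k * K₂ := by positivity
    linarith

/-- The relations determine the logarithms of the parameters up to a bounded error. -/
lemma exists_param_bounds (Ω : Set ℂ) {k : ℕ} (hk : 0 < k) {c : ℝ} (hc : 0 < c) :
    ∃ K : ℝ, 1 ≤ K ∧ ∀ᶠ p : ℝ in atTop, ∀ η : ℝ, AdmissibleRatio k c η → ∀ τ α β ρ : ℝ,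
      ParamRelations Ω k p η τ α β ρ →
      |-Real.log ρ - p * rate k η| ≤ K ∧
      |-Real.log α - p * (1 / 4 + k * η * rate k η)| ≤ K ∧
      |-Real.log (β ^ k) - p * (1 / 4 + rate k η / η)| ≤ K ∧ τ ≤ K / p := by
  have hk1 : (1 : ℝ) ≤ k := by exact_mod_cast hk
  have hlk : 0 ≤ Real.log k := Real.log_nonneg hk1
  obtain ⟨E, hE⟩ : ∃ E, E = |C₁| + |C₂| := ⟨_, rfl⟩
  obtain ⟨H, hH⟩ : ∃ H, H = greenRegularPart Ω 0 0 := ⟨_, rfl⟩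
  have hE0 : 0 ≤ E := by rw [hE]; positivity
  have hl8 : 0 < Real.log 8 := Real.log_pos (by norm_num)
  have hpi := Real.pi_pos
  obtain ⟨K₁, hK₁⟩ : ∃ K₁, K₁ = E / 8 + Real.log 8 / 2 + 2 * (k + 1 / c + 1) * Real.pi * |H| :=
    ⟨_, rfl⟩
  have hK₁0 : 0 ≤ K₁ := by rw [hK₁]; positivity
  obtain ⟨K₂, hK₂⟩ : ∃ K₂, K₂ = (4 * K₁ + 1 / c + 2 * Real.log k) / c := ⟨_, rfl⟩
  have hK₂0 : 0 ≤ K₂ := by rw [hK₂]; positivity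
  obtain ⟨K₃, hK₃⟩ : ∃ K₃, K₃ = k * K₂ + K₂ / c + K₁ := ⟨_, rfl⟩
  have hK₃0 : 0 ≤ K₃ := by rw [hK₃]; positivity
  obtain ⟨K₄, hK₄⟩ : ∃ K₄, K₄ = 2 * (1 + 2 * k + 2 * K₃) := ⟨_, rfl⟩
  have hexp := Real.exp_pos K₄
  refine ⟨1 + K₂ + K₃ + Real.exp K₄, by linarith, ?_⟩
  filter_upwards [eventually_ge_atTop 2, eventually_ge_atTop (E / 2)]
    with p hp2 hpE η hη τ α β ρ h
  have hp0 : 0 < p := by linarith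
  have hη0 := h.η_pos
  have hα := h.α_pos
  have hβ := h.β_pos
  have hρ := h.ρ_pos
  have hτ := h.τ_pos
  obtain ⟨A, hA⟩ : ∃ A, A = -Real.log α := ⟨_, rfl⟩
  obtain ⟨R, hR⟩ : ∃ R, R = -Real.log ρ := ⟨_, rfl⟩
  obtain ⟨B, hB⟩ : ∃ B, B = -Real.log (β ^ k) := ⟨_, rfl⟩
  obtain ⟨T, hT⟩ : ∃ T, T = Real.log τ + Real.log p := ⟨_, rfl⟩
  obtain ⟨M, hM⟩ : ∃ M, M = coeffM p := ⟨_, rfl⟩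
  have hβk : 0 < β ^ k := by positivity
  rw [← hA, ← hR, ← hB]
  have e1 : T - Real.log p + 2 * A = p * T := by
    have := congrArg Real.log h.rel₁
    rw [Real.log_div hτ.ne' (by positivity), Real.log_pow, Real.log_rpow (by positivity),
      Real.log_mul hp0.ne' hτ.ne'] at this
    push_cast at this
    rw [hT, hA]; linarith
  have e2 : T - Real.log p + Real.log η + 2 * Real.log k - (2 * k - 2) * R + 2 * B =
      p * (T + Real.log η) := by
    have := congrArg Real.log h.rel₂
    rw [Real.log_mul (by positivity) (by positivity), Real.log_mul hτ.ne' hη0.ne',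
      Real.log_div (by positivity) (by positivity), Real.log_mul (by positivity) (by positivity),
      mul_comm 2 k, pow_mul β, Real.log_pow (x := (k : ℝ)), Real.log_pow (x := ρ),
      Real.log_pow (x := β ^ k), Real.log_rpow (by positivity),
      Real.log_mul (by positivity) hη0.ne', Real.log_mul hp0.ne' hτ.ne',
      Nat.cast_sub (by omega)] at this
    push_cast at this
    rw [hT, hR, hB]; linarith
  have e3 : M * (A - k * η * R) = p + Real.log 8 + 2 * (k * η - 1) * Real.pi * M * H := by
    have := h.rel₃
    rw [Real.log_div (by positivity) hα.ne', Real.log_rpow hρ, ← hM, ← hH] at this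
    rw [hA, hR]; linarith
  have e4 : M * (B - R / η) = p + Real.log 8 + 2 * (-(k - 1 / η)) * Real.pi * M * H := by
    have := h.rel₄
    rw [Real.log_div (by positivity) hβk.ne', Real.log_rpow hρ, ← hM, ← hH] at this
    rw [hB, hR, ← this]; ring
  have hME : |M - 4| ≤ E / p := by rw [hM, hE]; exact abs_coeffM_sub_le (by linarith)
  have hM2 : 2 ≤ M := by
    have : E / p ≤ 2 := by rw [div_le_iff₀ hp0]; linarith
    linarith [(abs_le.1 hME).1]
  have hkη : k * η ≤ k := mul_le_of_le_one_right (by linarith) hη.eta_le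
  have hic : 0 < 1 / c := by positivity
  have hiη : 1 / η ≤ 1 / c := one_div_le_one_div_of_le hc hη.le_eta
  have hiη0 : 0 < 1 / η := by positivity
  have g1 : |k * η - 1| ≤ k + 1 / c + 1 := by
    rw [abs_of_nonneg (by linarith [hη.le_mul])]; linarith
  have g2 : |-(k - 1 / η)| ≤ k + 1 / c + 1 := by
    rw [abs_neg, abs_le]; constructor <;> linarith
  have q1 := abs_sub_quarter_le hp0 hM2 hME g1 e3
  have q2 := abs_sub_quarter_le hp0 hM2 hME g2 e4
  rw [← hK₁] at q1 q2
  obtain ⟨hRr, hAa, hBb⟩ := rate_bounds hk hc hη hK₂ hK₃ q1 q2 (by linarith)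
  refine ⟨by linarith, by linarith, by linarith, ?_⟩
  -- the bound of `τ` follows from the first relation
  have hTb : T ≤ K₄ := by
    have h1 : (p - 1) * T ≤ 2 * A := by
      have := Real.log_nonneg (show 1 ≤ p by linarith)
      linarith
    have h2 : A ≤ p * (1 / 4 + k) + K₃ := by
      have h3 := (abs_le.1 hAa).2
      have h4 : k * η * rate k η ≤ k * 1 := by
        have h5 := hη.rate_le
        exact mul_le_mul hkη (by linarith) (by linarith [hη.le_rate]) (by linarith)
      have h6 : p * (k * η * rate k η) ≤ p * (k * 1) := mul_le_mul_of_nonneg_left h4 hp0.le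
      linarith
    by_contra! hlt
    have hK₄0 : 0 ≤ K₄ := by rw [hK₄]; positivity
    have h3 : p / 2 * K₄ ≤ (p - 1) * T :=
      mul_le_mul (by linarith) hlt.le hK₄0 (by linarith)
    have h4 : p / 2 * K₄ = p + 2 * (p * k) + 2 * (p * K₃) := by rw [hK₄]; ring
    have h5 : 2 * K₃ ≤ p * K₃ := mul_le_mul_of_nonneg_right hp2 hK₃0
    linarith
  have hτp : τ * p ≤ Real.exp K₄ := by
    rw [← Real.exp_log (show 0 < τ * p by positivity), Real.log_mul hτ.ne' hp0.ne', ← hT]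
    exact Real.exp_le_exp.2 hTb
  rw [le_div_iff₀ hp0]
  linarith

/-- The sizes of the parameters, up to a constant `K`, as forced by the relations between them. The
exponents in `rho_le_mul` and `rhok_le_mul` are the differences of the rates of `α` and `ρ`, and of
`β ^ k` and `ρ ^ k`. -/
structure Concentrated (k : ℕ) (c K p η τ α β ρ : ℝ) : Prop where
  alpha_le : α ≤ K * Real.exp (-(c * p))
  betak_le : β ^ k ≤ K * Real.exp (-(c * p))
  rho_le : ρ ≤ K * Real.exp (-(c * p))
  rhok_le : ρ ^ k ≤ K * Real.exp (-(c * p))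
  alpha_le_rho : α ≤ K * Real.exp (-(c * p)) * ρ
  betak_le_rhok : β ^ k ≤ K * Real.exp (-(c * p)) * ρ ^ k
  rho_le_mul : ρ ≤ Real.exp ((1 / 4 + (k * η - 1) * rate k η) * p + K) * α
  rhok_le_mul : ρ ^ k ≤ Real.exp ((1 / 4 - (k - 1 / η) * rate k η) * p + K) * β ^ k
  neg_log_rho_le : -Real.log ρ ≤ rate k η * p + K
  neg_log_alpha_le : -Real.log α ≤ (1 / 4 + k * η * rate k η) * p + K
  tau_le : τ ≤ K / p

lemma exists_concentrated (Ω : Set ℂ) {k : ℕ} (hk : 0 < k) {c : ℝ} (hc : 0 < c) :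
    ∃ K : ℝ, 1 ≤ K ∧ ∀ᶠ p : ℝ in atTop, ∀ η : ℝ, AdmissibleRatio k c η → ∀ τ α β ρ : ℝ,
      ParamRelations Ω k p η τ α β ρ → Concentrated k c K p η τ α β ρ := by
  obtain ⟨K, hK1, H⟩ := exists_param_bounds Ω hk hc
  have hk1 : (1 : ℝ) ≤ k := by exact_mod_cast hk
  have hKk : K ≤ k * K := le_mul_of_one_le_left (by linarith) hk1
  obtain ⟨S, hS⟩ : ∃ S, S = (k + 1) * K := ⟨_, rfl⟩
  have hSK : S = k * K + K := by rw [hS]; ring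
  have hSe : S + 1 ≤ Real.exp S := Real.add_one_le_exp S
  refine ⟨Real.exp S, by linarith, ?_⟩
  filter_upwards [H, eventually_gt_atTop 0] with p hp hp0 η hη τ α β ρ h
  obtain ⟨hR, hA, hB, hτ⟩ := hp η hη τ α β ρ h
  have hα := h.α_pos
  have hβ := h.β_pos
  have hρ := h.ρ_pos
  have hη0 := h.η_pos
  have hβk : 0 < β ^ k := by positivity
  have hρk : 0 < ρ ^ k := by positivity
  obtain ⟨r, hr⟩ : ∃ r, r = rate k η := ⟨_, rfl⟩
  have r1 := hη.le_rate
  have r2 := hη.rate_le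
  have r3 := hη.le_mul
  have r4 := hη.peak_lt
  rw [← hr] at hR hA hB r1 r2 r4
  have c1 : c ≤ 1 / 4 := by linarith
  have r0 : 0 < r := by linarith
  have s0 : 0 ≤ (k * η - 1) * r := mul_nonneg (by linarith) r0.le
  have s1 : 0 ≤ r / η := by positivity
  have hcp : c * p ≤ 1 / 4 * p := mul_le_mul_of_nonneg_right c1 hp0.le
  have hrp : c * p ≤ r * p := mul_le_mul_of_nonneg_right r1 hp0.le
  have hs0p : 0 ≤ (k * η - 1) * r * p := mul_nonneg s0 hp0.le
  have hs1p : 0 ≤ r / η * p := mul_nonneg s1 hp0.le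
  have hr4p : c * p ≤ (1 / 4 - (k - 1 / η) * r) * p := mul_le_mul_of_nonneg_right r4 hp0.le
  have hr0p : 0 < r * p := mul_pos r0 hp0
  have e1 : p * (1 / 4 + k * η * r) = 1 / 4 * p + (k * η - 1) * r * p + r * p := by ring
  have e2 : p * (1 / 4 + r / η) = 1 / 4 * p + r / η * p := by ring
  have e3 : (1 / 4 - (k - 1 / η) * r) * p = 1 / 4 * p + r / η * p - k * (r * p) := by ring
  have e4 : (1 / 4 + (k * η - 1) * r) * p = 1 / 4 * p + (k * η - 1) * r * p := by ring
  have e5 : (1 / 4 + k * η * r) * p = 1 / 4 * p + (k * η - 1) * r * p + r * p := by ring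
  rw [e1] at hA
  rw [e2] at hB
  rw [e3] at hr4p
  rw [mul_comm p r] at hR
  have lρk : Real.log (ρ ^ k) = k * Real.log ρ := Real.log_pow _ _
  obtain ⟨a1, a2⟩ := abs_le.1 hA
  obtain ⟨b1, b2⟩ := abs_le.1 hB
  obtain ⟨d1, d2⟩ := abs_le.1 hR
  have d1' : k * (-K) ≤ k * (-Real.log ρ - r * p) := mul_le_mul_of_nonneg_left d1 (by linarith)
  have d2' : k * (-Real.log ρ - r * p) ≤ k * K := mul_le_mul_of_nonneg_left d2 (by linarith)
  have hkr : r * p ≤ k * (r * p) := le_mul_of_one_le_left hr0p.le hk1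
  have le_exp : ∀ {x t : ℝ}, 0 < x → Real.log x ≤ t → x ≤ Real.exp t := fun hx ht =>
    (Real.log_le_iff_le_exp hx).1 ht
  have le_exp_mul : ∀ {x y t : ℝ}, 0 < x → 0 < y → Real.log x ≤ t + Real.log y →
      x ≤ Real.exp t * y := fun {x y t} hx hy ht => by
    rw [← Real.exp_log hy, ← Real.exp_add]; exact le_exp hx ht
  constructor
  · rw [← Real.exp_add]; exact le_exp hα (by linarith)
  · rw [← Real.exp_add]; exact le_exp hβk (by linarith)
  · rw [← Real.exp_add]; exact le_exp hρ (by linarith)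
  · rw [← Real.exp_add]; exact le_exp hρk (by rw [lρk]; linarith)
  · rw [← Real.exp_add]; exact le_exp_mul hα hρ (by linarith)
  · rw [← Real.exp_add]; exact le_exp_mul hβk hρk (by rw [lρk]; linarith)
  · rw [← hr, e4]; exact le_exp_mul hρ hα (by linarith)
  · rw [← hr, e3]; exact le_exp_mul hρk hβk (by rw [lρk]; linarith)
  · rw [← hr]; linarith
  · rw [← hr, e5]; linarith
  · exact hτ.trans (div_le_div_of_nonneg_right (by linarith) hp0.le)

/-! ### The ansatz near the peaks and away from them -/

/-- Away from its centres, a projected bubble is a logarithm plus a multiple of the regular part of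
the Green function. -/
lemma exists_bubbleProj_far :
    ∃ K : ℝ, 0 < K ∧ ∀ (Ω : Set ℂ) (p : ℝ), 1 ≤ p → ∀ (m : ℕ) (a : ℂ) (b : ℝ) (x : ℂ), 0 < b →
      b ≤ ‖x ^ m - a‖ → |bubbleProj Ω p m a b x - (2 * Real.pi * coeffM p * m *
        greenRegularPart Ω x 0 - coeffM p * Real.log ‖x ^ m - a‖)| ≤ K * (b / ‖x ^ m - a‖) := by
  obtain ⟨K, hK, H⟩ := exists_bubbleSum_far
  refine ⟨K, hK, fun Ω p hp m a b x hb hx => ?_⟩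
  have hn : ‖(x ^ m - a) / (b : ℂ)‖ = ‖x ^ m - a‖ / b := by
    rw [norm_div, Complex.norm_real, Real.norm_eq_abs, abs_of_pos hb]
  have h1 := H p hp ((x ^ m - a) / b) (by rw [hn, le_div_iff₀ hb]; linarith)
  rw [hn, Real.log_div (by linarith) hb.ne', div_div_eq_mul_div] at h1
  rw [mul_div_assoc] at h1
  convert h1 using 2
  rw [bubbleProj]; ring

lemma eventually_coeffM_bounds : ∀ᶠ p : ℝ in atTop, 0 < coeffM p ∧ coeffM p ≤ 8 := by
  filter_upwards [eventually_ge_atTop 1, eventually_ge_atTop ((|C₁| + |C₂|) / 2)] with p hp1 hp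
  have h1 := abs_coeffM_sub_le hp1
  have h2 : (|C₁| + |C₂|) / p ≤ 2 := by rw [div_le_iff₀ (by linarith)]; linarith
  have h3 := abs_le.1 h1
  constructor <;> linarith

/-- The points closer to the origin than `ρ / 2` are far from the other peaks. -/
lemma half_le_norm_pow_sub {k : ℕ} (hk : 0 < k) {ρ : ℝ} (hρ : 0 < ρ) {x : ℂ} (hx : ‖x‖ ≤ ρ / 2) :
    ‖x ^ k‖ ≤ ρ ^ k * (‖x‖ / ρ) ∧ ‖x ^ k‖ ≤ ρ ^ k / 2 ∧ ρ ^ k / 2 ≤ ‖x ^ k - (ρ : ℂ) ^ k‖ := by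
  have hρn : ‖(ρ : ℂ) ^ k‖ = ρ ^ k := by
    rw [norm_pow, Complex.norm_real, Real.norm_eq_abs, abs_of_pos hρ]
  have hρk : 0 < ρ ^ k := by positivity
  have hq : ‖x‖ / ρ ≤ 1 / 2 := by rw [div_le_iff₀ hρ]; linarith
  have h1 : ‖x ^ k‖ ≤ ρ ^ k * (‖x‖ / ρ) := by
    have : ‖x ^ k‖ = ρ ^ k * (‖x‖ / ρ) ^ k := by
      rw [norm_pow, div_pow, mul_div_cancel₀ _ hρk.ne']
    rw [this]
    exact mul_le_mul_of_nonneg_left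
      (pow_le_of_le_one (by positivity) (by linarith) hk.ne') hρk.le
  have h2 : ρ ^ k * (‖x‖ / ρ) ≤ ρ ^ k * (1 / 2) := mul_le_mul_of_nonneg_left hq hρk.le
  refine ⟨h1, by linarith, ?_⟩
  have := norm_sub_norm_le ((ρ : ℂ) ^ k) (x ^ k)
  rw [norm_sub_rev, hρn] at this
  linarith

/-- The points close to the peaks on the circle of radius `ρ` are far from the origin. -/
lemma half_le_norm_of_norm_pow_sub {k : ℕ} (hk : 0 < k) {ρ : ℝ} (hρ : 0 < ρ) {x : ℂ}
    (hx : ‖x ^ k - (ρ : ℂ) ^ k‖ ≤ ρ ^ k / 2) : ρ / 2 ≤ ‖x‖ := by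
  by_contra! h
  have h1 := half_le_norm_pow_sub hk hρ h.le
  have hρn : ‖(ρ : ℂ) ^ k‖ = ρ ^ k := by
    rw [norm_pow, Complex.norm_real, Real.norm_eq_abs, abs_of_pos hρ]
  have h2 := norm_sub_norm_le ((ρ : ℂ) ^ k) (x ^ k)
  rw [norm_sub_rev, hρn] at h2
  have h3 : ρ ^ k * (‖x‖ / ρ) < ρ ^ k * (1 / 2) :=
    mul_lt_mul_of_pos_left (by rw [div_lt_iff₀ hρ]; linarith) (by positivity)
  linarith [h1.1]

/-- The logarithm of the modulus near the peaks on the circle of radius `ρ`. -/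
lemma abs_log_norm_sub_log_le {k : ℕ} (hk : 0 < k) {ρ : ℝ} (hρ : 0 < ρ) {x : ℂ}
    (hx : ‖x ^ k - (ρ : ℂ) ^ k‖ ≤ ρ ^ k / 2) :
    |Real.log ‖x‖ - Real.log ρ| ≤ 2 * (‖x ^ k - (ρ : ℂ) ^ k‖ / ρ ^ k) := by
  have hρn : ‖(ρ : ℂ) ^ k‖ = ρ ^ k := by
    rw [norm_pow, Complex.norm_real, Real.norm_eq_abs, abs_of_pos hρ]
  have hρ0 : (ρ : ℂ) ^ k ≠ 0 := norm_pos_iff.1 (by rw [hρn]; positivity)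
  have h1 := abs_log_norm_sub_le hρ0 (b := (ρ : ℂ) ^ k - x ^ k)
    (by rw [norm_sub_rev, hρn]; exact hx)
  rw [sub_sub_cancel, norm_sub_rev _ (x ^ k), hρn, norm_pow, Real.log_pow, Real.log_pow, ← mul_sub,
    abs_mul, Nat.abs_cast] at h1
  have hk1 : (1 : ℝ) ≤ k := by exact_mod_cast hk
  exact (le_mul_of_one_le_left (abs_nonneg _) hk1).trans h1

/-- The ansatz near the origin. -/
lemma exists_ansatz_bound_origin {Ω : Set ℂ} (h : IsSmoothBoundedDomain Ω) (h0 : (0 : ℂ) ∈ Ω)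
    {k : ℕ} (hk : 0 < k) {c K : ℝ} (hc : 0 < c) (hK : 1 ≤ K) :
    ∃ K' : ℝ, 0 < K' ∧ ∀ᶠ p : ℝ in atTop, ∀ η : ℝ, AdmissibleRatio k c η → ∀ τ α β ρ : ℝ,
      ParamRelations Ω k p η τ α β ρ → Concentrated k c K p η τ α β ρ →
      ∀ x ∈ closure Ω, ‖x‖ ≤ ρ / 2 →
        |ansatz Ω k p η τ α β ρ x / τ - (p + bubbleSum p (x / α))| ≤
          K' * (Real.exp (-(c * p)) + ‖x‖ + ‖x‖ / ρ) := by
  obtain ⟨K₀, e₀, hK₀, he₀, H₀⟩ := exists_ansatz_bound h h0 hk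
  obtain ⟨K₁, hK₁, H₁⟩ := exists_bubbleProj_far
  obtain ⟨K₂, hK₂, -, H₂⟩ := exists_green_lipschitz h h0
  have hk1 : (1 : ℝ) ≤ k := by exact_mod_cast hk
  have hpi := Real.pi_pos
  have hK0 : 0 < K := by linarith
  refine ⟨3 * K₀ * K + 16 * Real.pi * k * K₂ + 16 + 2 * K₁ * K, by positivity, ?_⟩
  filter_upwards [eventually_ge_atTop 1, eventually_coeffM_bounds,
    eventually_exp_neg_le hc (show 0 < e₀ / K by positivity) 0,
    eventually_exp_neg_le hc (show 0 < 1 / (2 * K) by positivity) 0]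
    with p hp1 hM hpe hpe' η hη τ α β ρ hpar hcon x hx hxρ
  have hτ := hpar.τ_pos
  have hα := hpar.α_pos
  have hβ := hpar.β_pos
  have hρ := hpar.ρ_pos
  have hη0 := hpar.η_pos
  have hβk : 0 < β ^ k := by positivity
  have hρk : 0 < ρ ^ k := by positivity
  obtain ⟨E, hE⟩ : ∃ E, E = Real.exp (-(c * p)) := ⟨_, rfl⟩
  have hE0 : 0 < E := hE ▸ Real.exp_pos _
  rw [pow_zero, div_one, ← hE, le_div_iff₀ hK0, mul_comm] at hpe
  rw [pow_zero, div_one, ← hE, le_div_iff₀ (by positivity)] at hpe'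
  have c1 := hcon.alpha_le
  have c2 := hcon.betak_le
  have c4 := hcon.rhok_le
  have c6 := hcon.betak_le_rhok
  rw [← hE] at c1 c2 c4 c6 ⊢
  have hρn : ‖(ρ : ℂ) ^ k‖ = ρ ^ k := by
    rw [norm_pow, Complex.norm_real, Real.norm_eq_abs, abs_of_pos hρ]
  obtain ⟨hx1, hx2, hx3⟩ := half_le_norm_pow_sub hk hρ hxρ
  have hβρ : β ^ k ≤ ρ ^ k / 2 := by
    have : K * E * ρ ^ k ≤ 1 / 2 * ρ ^ k := mul_le_mul_of_nonneg_right (by linarith) hρk.le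
    linarith
  have b0 := H₀ p η τ α β ρ hp1 hη0 hη.eta_le hτ hα hβ hρ (c1.trans hpe) (c2.trans hpe)
    (c4.trans hpe) x hx
  have b1 := H₁ Ω p hp1 k ((ρ : ℂ) ^ k) (β ^ k) x hβk (hβρ.trans hx3)
  have b2 := H₂ x hx
  have b3 := abs_log_norm_sub_le (a := (ρ : ℂ) ^ k) (b := x ^ k)
    (norm_pos_iff.1 (by rw [hρn]; exact hρk)) (by rw [hρn]; exact hx2)
  rw [norm_sub_rev, hρn, Real.log_pow] at b3
  have b4 : ‖x ^ k‖ / ρ ^ k ≤ ‖x‖ / ρ := by rw [div_le_iff₀' hρk]; exact hx1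
  have b5 : β ^ k / ‖x ^ k - (ρ : ℂ) ^ k‖ ≤ 2 * K * E := by
    rw [div_le_iff₀ (by linarith)]
    have : 2 * K * E * (ρ ^ k / 2) ≤ 2 * K * E * ‖x ^ k - (ρ : ℂ) ^ k‖ :=
      mul_le_mul_of_nonneg_left hx3 (by positivity)
    linarith
  have hrel := hpar.rel₃
  rw [Real.log_div (by positivity) hα.ne', Real.log_rpow hρ] at hrel
  have hP1 : bubbleProj Ω p 1 0 α x = bubbleSum p (x / α) - Real.log 8 - coeffM p * Real.log α
      + 2 * Real.pi * coeffM p * greenRegularPart Ω x 0 := by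
    rw [bubbleProj, pow_one, sub_zero, Nat.cast_one, mul_one]
  obtain ⟨M, hMdef⟩ : ∃ M, M = coeffM p := ⟨_, rfl⟩
  rw [← hMdef] at hM b1 hrel hP1
  obtain ⟨hM0, hM8⟩ := hM
  obtain ⟨P₁, hP₁⟩ : ∃ P, P = bubbleProj Ω p 1 0 α x := ⟨_, rfl⟩
  obtain ⟨P₂, hP₂⟩ : ∃ P, P = bubbleProj Ω p k ((ρ : ℂ) ^ k) (β ^ k) x := ⟨_, rfl⟩
  obtain ⟨H, hH⟩ : ∃ P, P = greenRegularPart Ω x 0 := ⟨_, rfl⟩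
  obtain ⟨H', hH'⟩ : ∃ P, P = greenRegularPart Ω 0 0 := ⟨_, rfl⟩
  obtain ⟨l, hl⟩ : ∃ P, P = Real.log ‖x ^ k - (ρ : ℂ) ^ k‖ := ⟨_, rfl⟩
  obtain ⟨u, hu⟩ : ∃ u, u = ansatz Ω k p η τ α β ρ x / τ := ⟨_, rfl⟩
  rw [← hP₁, ← hP₂, ← hu] at b0
  rw [← hP₂, ← hH, ← hl] at b1
  rw [← hH, ← hH'] at b2
  rw [← hl] at b3
  rw [← hH'] at hrel
  rw [← hP₁, ← hH] at hP1
  rw [← hu]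
  have e1 : u - (p + bubbleSum p (x / α)) = (u - (P₁ - η * P₂))
      + 2 * Real.pi * M * (1 - k * η) * (H - H') + η * M * (l - k * Real.log ρ)
      - η * (P₂ - (2 * Real.pi * M * k * H - M * l)) := by
    rw [hP1, ← hrel]; ring
  have t0 : K₀ * (α + β ^ k + ρ ^ k) ≤ 3 * K₀ * K * E := by
    have : K₀ * (α + β ^ k + ρ ^ k) ≤ K₀ * (3 * (K * E)) :=
      mul_le_mul_of_nonneg_left (by linarith) hK₀.le
    linarith
  have t1 : |2 * Real.pi * M * (1 - k * η) * (H - H')| ≤ 16 * Real.pi * k * K₂ * ‖x‖ := by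
    rw [abs_mul, abs_mul, abs_of_pos (by positivity : 0 < 2 * Real.pi * M)]
    have h1 : |1 - k * η| ≤ k := by
      have := mul_le_of_le_one_right (by linarith : (0 : ℝ) ≤ k) hη.eta_le
      have := hη.le_mul
      rw [abs_sub_comm, abs_of_nonneg (by linarith)]; linarith
    calc 2 * Real.pi * M * |1 - k * η| * |H - H'| ≤ 2 * Real.pi * 8 * k * (K₂ * ‖x‖) := by gcongr
      _ = _ := by ring
  have t2 : |η * M * (l - k * Real.log ρ)| ≤ 16 * (‖x‖ / ρ) := by
    rw [abs_mul, abs_of_pos (by positivity : 0 < η * M)]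
    calc η * M * |l - k * Real.log ρ| ≤ 1 * 8 * (2 * (‖x‖ / ρ)) := by
          gcongr
          · exact hη.eta_le
          · exact b3.trans (mul_le_mul_of_nonneg_left b4 two_pos.le)
      _ = _ := by ring
  have t3 : |η * (P₂ - (2 * Real.pi * M * k * H - M * l))| ≤ 2 * K₁ * K * E := by
    rw [abs_mul, abs_of_pos hη0]
    calc η * |P₂ - (2 * Real.pi * M * k * H - M * l)| ≤ 1 * (K₁ * (2 * K * E)) := by
          gcongr
          · exact hη.eta_le
          · exact b1.trans (mul_le_mul_of_nonneg_left b5 hK₁.le)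
      _ = _ := by ring
  rw [e1]
  refine (abs_sub _ _).trans ?_
  have s1 := abs_add_three (u - (P₁ - η * P₂)) (2 * Real.pi * M * (1 - k * η) * (H - H'))
    (η * M * (l - k * Real.log ρ))
  obtain ⟨F, hF⟩ : ∃ F, F = 3 * K₀ * K + 16 * Real.pi * k * K₂ + 16 + 2 * K₁ * K := ⟨_, rfl⟩
  rw [← hF]
  have f0 : (3 * K₀ * K + 2 * K₁ * K) * E ≤ F * E :=
    mul_le_mul_of_nonneg_right (by rw [hF]; linarith [show 0 ≤ 16 * Real.pi * k * K₂ by positivity])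
      hE0.le
  have f1 : 16 * Real.pi * k * K₂ * ‖x‖ ≤ F * ‖x‖ :=
    mul_le_mul_of_nonneg_right (by
      rw [hF]
      linarith [show 0 ≤ 3 * K₀ * K by positivity, show 0 ≤ 2 * K₁ * K by positivity])
      (norm_nonneg _)
  have f2 : 16 * (‖x‖ / ρ) ≤ F * (‖x‖ / ρ) :=
    mul_le_mul_of_nonneg_right (by
      rw [hF]
      linarith [show 0 ≤ 3 * K₀ * K by positivity, show 0 ≤ 2 * K₁ * K by positivity,
        show 0 ≤ 16 * Real.pi * k * K₂ by positivity])
      (by positivity)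
  linarith

/-- The ansatz near the peaks on the circle of radius `ρ`. -/
lemma exists_ansatz_bound_circle {Ω : Set ℂ} (h : IsSmoothBoundedDomain Ω) (h0 : (0 : ℂ) ∈ Ω)
    {k : ℕ} (hk : 0 < k) {c K : ℝ} (hc : 0 < c) (hK : 1 ≤ K) :
    ∃ K' : ℝ, 0 < K' ∧ ∀ᶠ p : ℝ in atTop, ∀ η : ℝ, AdmissibleRatio k c η → ∀ τ α β ρ : ℝ,
      ParamRelations Ω k p η τ α β ρ → Concentrated k c K p η τ α β ρ →
      ∀ x ∈ closure Ω, ‖x ^ k - (ρ : ℂ) ^ k‖ ≤ ρ ^ k / 2 →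
        |-(ansatz Ω k p η τ α β ρ x / τ) / η -
          (p + bubbleSum p ((x ^ k - (ρ : ℂ) ^ k) / (β ^ k : ℝ)))| ≤
          K' * (Real.exp (-(c * p)) + ‖x ^ k - (ρ : ℂ) ^ k‖ / ρ ^ k) := by
  obtain ⟨K₀, e₀, hK₀, he₀, H₀⟩ := exists_ansatz_bound h h0 hk
  obtain ⟨K₁, hK₁, H₁⟩ := exists_bubbleProj_far
  obtain ⟨K₂, hK₂, -, H₂⟩ := exists_green_lipschitz h h0
  have hk1 : (1 : ℝ) ≤ k := by exact_mod_cast hk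
  have hpi := Real.pi_pos
  have hK0 : 0 < K := by linarith
  refine ⟨3 * K₀ * K / c + 32 * Real.pi * k * K₂ * K + 16 / c + 2 * K₁ * K / c,
    by positivity, ?_⟩
  filter_upwards [eventually_ge_atTop 1, eventually_coeffM_bounds,
    eventually_exp_neg_le hc (show 0 < e₀ / K by positivity) 0,
    eventually_exp_neg_le hc (show 0 < 1 / (2 * K) by positivity) 0]
    with p hp1 hM hpe hpe' η hη τ α β ρ hpar hcon x hx hxρ
  have hτ := hpar.τ_pos
  have hα := hpar.α_pos
  have hβ := hpar.β_pos
  have hρ := hpar.ρ_pos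
  have hη0 := hpar.η_pos
  have hβk : 0 < β ^ k := by positivity
  have hρk : 0 < ρ ^ k := by positivity
  obtain ⟨E, hE⟩ : ∃ E, E = Real.exp (-(c * p)) := ⟨_, rfl⟩
  have hE0 : 0 < E := hE ▸ Real.exp_pos _
  rw [pow_zero, div_one, ← hE, le_div_iff₀ hK0, mul_comm] at hpe
  rw [pow_zero, div_one, ← hE, le_div_iff₀ (by positivity)] at hpe'
  have c1 := hcon.alpha_le
  have c2 := hcon.betak_le
  have c3 := hcon.rho_le
  have c4 := hcon.rhok_le
  have c5 := hcon.alpha_le_rho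
  rw [← hE] at c1 c2 c3 c4 c5 ⊢
  obtain ⟨q, hq⟩ : ∃ q, q = ‖x ^ k - (ρ : ℂ) ^ k‖ / ρ ^ k := ⟨_, rfl⟩
  have hq0 : 0 ≤ q := by rw [hq]; positivity
  have hx1 := half_le_norm_of_norm_pow_sub hk hρ hxρ
  have hx2 : ‖x‖ ≤ 2 * ρ := by
    have hρn : ‖(ρ : ℂ) ^ k‖ = ρ ^ k := by
      rw [norm_pow, Complex.norm_real, Real.norm_eq_abs, abs_of_pos hρ]
    have h1 := norm_sub_norm_le (x ^ k) ((ρ : ℂ) ^ k)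
    rw [hρn, norm_pow] at h1
    have h2 : (2 : ℝ) ≤ 2 ^ k := le_self_pow₀ (by norm_num) hk.ne'
    refine le_of_pow_le_pow_left₀ hk.ne' (by positivity) ?_
    rw [mul_pow]
    nlinarith
  have hαρ : α ≤ ρ / 2 := by
    have : K * E * ρ ≤ 1 / 2 * ρ := mul_le_mul_of_nonneg_right (by linarith) hρ.le
    linarith
  have b0 := H₀ p η τ α β ρ hp1 hη0 hη.eta_le hτ hα hβ hρ (c1.trans hpe) (c2.trans hpe)
    (c4.trans hpe) x hx
  have b1 := H₁ Ω p hp1 1 0 α x hα (by rw [pow_one, sub_zero]; exact hαρ.trans hx1)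
  rw [pow_one, sub_zero, Nat.cast_one, mul_one] at b1
  have b2 := H₂ x hx
  have b3 := abs_log_norm_sub_log_le hk hρ hxρ
  rw [← hq] at b3 ⊢
  have b5 : α / ‖x‖ ≤ 2 * K * E := by
    rw [div_le_iff₀ (by linarith)]
    have : 2 * K * E * (ρ / 2) ≤ 2 * K * E * ‖x‖ :=
      mul_le_mul_of_nonneg_left hx1 (by positivity)
    linarith
  have hrel := hpar.rel₄
  rw [Real.log_div (by positivity) hβk.ne', Real.log_rpow hρ] at hrel
  have hP2 : bubbleProj Ω p k ((ρ : ℂ) ^ k) (β ^ k) x =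
      bubbleSum p ((x ^ k - (ρ : ℂ) ^ k) / (β ^ k : ℝ)) - Real.log 8
      - coeffM p * Real.log (β ^ k) + 2 * Real.pi * coeffM p * k * greenRegularPart Ω x 0 := by
    rw [bubbleProj]
  obtain ⟨M, hMdef⟩ : ∃ M, M = coeffM p := ⟨_, rfl⟩
  rw [← hMdef] at hM b1 hrel hP2
  obtain ⟨hM0, hM8⟩ := hM
  obtain ⟨P₁, hP₁⟩ : ∃ P, P = bubbleProj Ω p 1 0 α x := ⟨_, rfl⟩
  obtain ⟨P₂, hP₂⟩ : ∃ P, P = bubbleProj Ω p k ((ρ : ℂ) ^ k) (β ^ k) x := ⟨_, rfl⟩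
  obtain ⟨H, hH⟩ : ∃ P, P = greenRegularPart Ω x 0 := ⟨_, rfl⟩
  obtain ⟨H', hH'⟩ : ∃ P, P = greenRegularPart Ω 0 0 := ⟨_, rfl⟩
  obtain ⟨l, hl⟩ : ∃ P, P = Real.log ‖x‖ := ⟨_, rfl⟩
  obtain ⟨Q, hQ⟩ : ∃ Q, Q = bubbleSum p ((x ^ k - (ρ : ℂ) ^ k) / (β ^ k : ℝ)) := ⟨_, rfl⟩
  obtain ⟨u, hu⟩ : ∃ u, u = ansatz Ω k p η τ α β ρ x / τ := ⟨_, rfl⟩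
  rw [← hP₁, ← hP₂, ← hu] at b0
  rw [← hP₁, ← hH, ← hl] at b1
  rw [← hH, ← hH'] at b2
  rw [← hl] at b3
  rw [← hH'] at hrel
  rw [← hP₂, ← hH, ← hQ] at hP2
  rw [← hu, ← hQ]
  have e1 : -u / η - (p + Q) = -(1 / η) * (u - (P₁ - η * P₂))
      + 2 * Real.pi * M * (k - 1 / η) * (H - H') + 1 / η * M * (l - Real.log ρ)
      - 1 / η * (P₁ - (2 * Real.pi * M * H - M * l)) := by
    rw [hP2, ← hrel]; field_simp; ring
  have hiη0 : 0 < 1 / η := by positivity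
  have hiη : 1 / η ≤ 1 / c := one_div_le_one_div_of_le hc hη.le_eta
  have t0 : |-(1 / η) * (u - (P₁ - η * P₂))| ≤ 3 * K₀ * K / c * E := by
    have h1 : K₀ * (α + β ^ k + ρ ^ k) ≤ K₀ * (3 * (K * E)) :=
      mul_le_mul_of_nonneg_left (by linarith) hK₀.le
    rw [abs_mul, abs_neg, abs_of_pos hiη0]
    calc 1 / η * |u - (P₁ - η * P₂)| ≤ 1 / c * (K₀ * (3 * (K * E))) := by
          gcongr; exact b0.trans h1
      _ = _ := by ring
  have t1 : |2 * Real.pi * M * (k - 1 / η) * (H - H')| ≤ 32 * Real.pi * k * K₂ * K * E := by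
    rw [abs_mul, abs_mul, abs_of_pos (by positivity : 0 < 2 * Real.pi * M)]
    have h1 : |k - 1 / η| ≤ k := by
      have h2 : 1 / η ≤ k := by
        rw [div_le_iff₀ hη0]; linarith [hη.le_mul]
      rw [abs_of_nonneg (by linarith)]; linarith
    calc 2 * Real.pi * M * |k - 1 / η| * |H - H'| ≤ 2 * Real.pi * 8 * k * (K₂ * (2 * (K * E))) := by
          gcongr
          exact b2.trans (mul_le_mul_of_nonneg_left (by linarith) hK₂.le)
      _ = _ := by ring
  have t2 : |1 / η * M * (l - Real.log ρ)| ≤ 16 / c * q := by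
    rw [abs_mul, abs_of_pos (by positivity : 0 < 1 / η * M)]
    calc 1 / η * M * |l - Real.log ρ| ≤ 1 / c * 8 * (2 * q) := by gcongr
      _ = _ := by ring
  have t3 : |1 / η * (P₁ - (2 * Real.pi * M * H - M * l))| ≤ 2 * K₁ * K / c * E := by
    rw [abs_mul, abs_of_pos hiη0]
    calc 1 / η * |P₁ - (2 * Real.pi * M * H - M * l)| ≤ 1 / c * (K₁ * (2 * K * E)) := by
          gcongr
          exact b1.trans (mul_le_mul_of_nonneg_left b5 hK₁.le)
      _ = _ := by ring
  rw [e1]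
  refine (abs_sub _ _).trans ?_
  have s1 := abs_add_three (-(1 / η) * (u - (P₁ - η * P₂)))
    (2 * Real.pi * M * (k - 1 / η) * (H - H')) (1 / η * M * (l - Real.log ρ))
  obtain ⟨F, hF⟩ : ∃ F, F = 3 * K₀ * K / c + 32 * Real.pi * k * K₂ * K + 16 / c + 2 * K₁ * K / c :=
    ⟨_, rfl⟩
  rw [← hF]
  have f0 : (3 * K₀ * K / c + 32 * Real.pi * k * K₂ * K + 2 * K₁ * K / c) * E ≤ F * E :=
    mul_le_mul_of_nonneg_right (by rw [hF]; linarith [show 0 ≤ 16 / c by positivity]) hE0.le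
  have f2 : 16 / c * q ≤ F * q :=
    mul_le_mul_of_nonneg_right (by
      rw [hF]
      linarith [show 0 ≤ 3 * K₀ * K / c by positivity, show 0 ≤ 2 * K₁ * K / c by positivity,
        show 0 ≤ 32 * Real.pi * k * K₂ * K by positivity]) hq0
  linarith

/-- Away from all peaks, `x ^ k - ρ ^ k` is comparable with `x ^ k`. -/
lemma abs_log_norm_pow_sub_le {k : ℕ} {ρ : ℝ} (hρ : 0 < ρ) {x : ℂ}
    (hx : ρ / 2 ≤ ‖x‖) (hxρ : ρ ^ k / 2 ≤ ‖x ^ k - (ρ : ℂ) ^ k‖) :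
    |Real.log ‖x ^ k - (ρ : ℂ) ^ k‖ - k * Real.log ‖x‖| ≤ Real.log (4 * 2 ^ k) := by
  have hx0 : 0 < ‖x‖ := by linarith
  have hρn : ‖(ρ : ℂ) ^ k‖ = ρ ^ k := by
    rw [norm_pow, Complex.norm_real, Real.norm_eq_abs, abs_of_pos hρ]
  have hρk : 0 < ρ ^ k := by positivity
  have hxk : 0 < ‖x‖ ^ k := by positivity
  have h2k : (1 : ℝ) ≤ 2 ^ k := one_le_pow₀ (by norm_num)
  have h1 : ρ ^ k ≤ 2 ^ k * ‖x‖ ^ k := by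
    rw [← mul_pow]; exact pow_le_pow_left₀ hρ.le (by linarith) k
  have h2 : ‖x ^ k - (ρ : ℂ) ^ k‖ ≤ 4 * 2 ^ k * ‖x‖ ^ k := by
    have := norm_sub_le (x ^ k) ((ρ : ℂ) ^ k)
    rw [hρn, norm_pow] at this
    nlinarith
  have h3 : ‖x‖ ^ k ≤ 4 * 2 ^ k * ‖x ^ k - (ρ : ℂ) ^ k‖ := by
    have := norm_sub_norm_le (x ^ k) ((ρ : ℂ) ^ k)
    rw [hρn, norm_pow] at this
    nlinarith
  have h4 : 0 < ‖x ^ k - (ρ : ℂ) ^ k‖ := by linarith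
  have l1 := Real.log_le_log h4 h2
  have l2 := Real.log_le_log hxk h3
  rw [Real.log_mul (by positivity) hxk.ne', Real.log_pow (x := ‖x‖)] at l1
  rw [Real.log_mul (by positivity) h4.ne', Real.log_pow (x := ‖x‖)] at l2
  rw [abs_le]
  constructor <;> linarith

/-- The size of the ansatz away from all peaks. -/
lemma exists_ansatz_bound_far {Ω : Set ℂ} (h : IsSmoothBoundedDomain Ω) (h0 : (0 : ℂ) ∈ Ω)
    {k : ℕ} (hk : 0 < k) {c K : ℝ} (hc : 0 < c) (hK : 1 ≤ K) :
    ∃ K' : ℝ, 0 < K' ∧ ∀ᶠ p : ℝ in atTop, ∀ η : ℝ, AdmissibleRatio k c η → ∀ τ α β ρ : ℝ,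
      ParamRelations Ω k p η τ α β ρ → Concentrated k c K p η τ α β ρ →
      ∀ x ∈ closure Ω, ρ / 2 ≤ ‖x‖ → ρ ^ k / 2 ≤ ‖x ^ k - (ρ : ℂ) ^ k‖ →
        |ansatz Ω k p η τ α β ρ x| / τ ≤ coeffM p * (k * η - 1) * |Real.log ‖x‖| + K' := by
  obtain ⟨K₀, e₀, hK₀, he₀, H₀⟩ := exists_ansatz_bound h h0 hk
  obtain ⟨K₁, hK₁, H₁⟩ := exists_bubbleProj_far
  obtain ⟨K₂, hK₂, H₂, -⟩ := exists_green_lipschitz h h0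
  have hk1 : (1 : ℝ) ≤ k := by exact_mod_cast hk
  have hpi := Real.pi_pos
  have hK0 : 0 < K := by linarith
  have hlk : 0 ≤ Real.log (4 * 2 ^ k) :=
    Real.log_nonneg (by linarith [one_le_pow₀ (show (1 : ℝ) ≤ 2 by norm_num) (n := k)])
  refine ⟨3 * K₀ * e₀ + 8 * Real.log (4 * 2 ^ k) + 16 * Real.pi * k * K₂ + 2 * K₁,
    by positivity, ?_⟩
  filter_upwards [eventually_ge_atTop 1, eventually_coeffM_bounds,
    eventually_exp_neg_le hc (show 0 < e₀ / K by positivity) 0,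
    eventually_exp_neg_le hc (show 0 < 1 / (2 * K) by positivity) 0]
    with p hp1 hM hpe hpe' η hη τ α β ρ hpar hcon x hx hx1 hx2
  have hτ := hpar.τ_pos
  have hα := hpar.α_pos
  have hβ := hpar.β_pos
  have hρ := hpar.ρ_pos
  have hη0 := hpar.η_pos
  have hβk : 0 < β ^ k := by positivity
  have hρk : 0 < ρ ^ k := by positivity
  obtain ⟨E, hE⟩ : ∃ E, E = Real.exp (-(c * p)) := ⟨_, rfl⟩
  have hE0 : 0 < E := hE ▸ Real.exp_pos _
  rw [pow_zero, div_one, ← hE, le_div_iff₀ hK0, mul_comm] at hpe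
  rw [pow_zero, div_one, ← hE, le_div_iff₀ (by positivity)] at hpe'
  have c1 := hcon.alpha_le
  have c2 := hcon.betak_le
  have c4 := hcon.rhok_le
  have c5 := hcon.alpha_le_rho
  have c6 := hcon.betak_le_rhok
  rw [← hE] at c1 c2 c4 c5 c6
  have hαx : α ≤ ‖x‖ := by
    have : K * E * ρ ≤ 1 / 2 * ρ := mul_le_mul_of_nonneg_right (by linarith) hρ.le
    linarith
  have hβx : β ^ k ≤ ‖x ^ k - (ρ : ℂ) ^ k‖ := by
    have : K * E * ρ ^ k ≤ 1 / 2 * ρ ^ k := mul_le_mul_of_nonneg_right (by linarith) hρk.le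
    linarith
  have b0 := H₀ p η τ α β ρ hp1 hη0 hη.eta_le hτ hα hβ hρ (c1.trans hpe) (c2.trans hpe)
    (c4.trans hpe) x hx
  have b1 := H₁ Ω p hp1 1 0 α x hα (by rw [pow_one, sub_zero]; exact hαx)
  rw [pow_one, sub_zero, Nat.cast_one, mul_one] at b1
  have b1' := H₁ Ω p hp1 k ((ρ : ℂ) ^ k) (β ^ k) x hβk hβx
  have b2 := H₂ x hx
  have b3 := abs_log_norm_pow_sub_le hρ hx1 hx2
  have b5 : α / ‖x‖ ≤ 1 := div_le_one_of_le₀ hαx (norm_nonneg _)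
  have b6 : β ^ k / ‖x ^ k - (ρ : ℂ) ^ k‖ ≤ 1 := div_le_one_of_le₀ hβx (norm_nonneg _)
  obtain ⟨M, hMdef⟩ : ∃ M, M = coeffM p := ⟨_, rfl⟩
  rw [← hMdef] at hM b1 b1' ⊢
  obtain ⟨hM0, hM8⟩ := hM
  obtain ⟨P₁, hP₁⟩ : ∃ P, P = bubbleProj Ω p 1 0 α x := ⟨_, rfl⟩
  obtain ⟨P₂, hP₂⟩ : ∃ P, P = bubbleProj Ω p k ((ρ : ℂ) ^ k) (β ^ k) x := ⟨_, rfl⟩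
  obtain ⟨H, hH⟩ : ∃ P, P = greenRegularPart Ω x 0 := ⟨_, rfl⟩
  obtain ⟨l, hl⟩ : ∃ P, P = Real.log ‖x‖ := ⟨_, rfl⟩
  obtain ⟨l', hl'⟩ : ∃ P, P = Real.log ‖x ^ k - (ρ : ℂ) ^ k‖ := ⟨_, rfl⟩
  obtain ⟨u, hu⟩ : ∃ u, u = ansatz Ω k p η τ α β ρ x / τ := ⟨_, rfl⟩
  rw [← hP₁, ← hP₂, ← hu] at b0
  rw [← hP₁, ← hH, ← hl] at b1
  rw [← hP₂, ← hH, ← hl'] at b1'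
  rw [← hH] at b2
  rw [← hl, ← hl'] at b3
  have hua : |ansatz Ω k p η τ α β ρ x| / τ = |u| := by rw [hu, abs_div, abs_of_pos hτ]
  rw [hua, ← hl]
  have e1 : u = M * (k * η - 1) * l + ((u - (P₁ - η * P₂)) + η * M * (l' - k * l)
      + 2 * Real.pi * M * (1 - k * η) * H)
      + ((P₁ - (2 * Real.pi * M * H - M * l)) - η * (P₂ - (2 * Real.pi * M * k * H - M * l'))) := by
    ring
  have m1 := hη.le_mul
  have t0 : K₀ * (α + β ^ k + ρ ^ k) ≤ 3 * K₀ * e₀ := by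
    have : K₀ * (α + β ^ k + ρ ^ k) ≤ K₀ * (3 * e₀) :=
      mul_le_mul_of_nonneg_left (by linarith) hK₀.le
    linarith
  have t1 : |2 * Real.pi * M * (1 - k * η) * H| ≤ 16 * Real.pi * k * K₂ := by
    rw [abs_mul, abs_mul, abs_of_pos (by positivity : 0 < 2 * Real.pi * M)]
    have h1 : |1 - k * η| ≤ k := by
      have := mul_le_of_le_one_right (by linarith : (0 : ℝ) ≤ k) hη.eta_le
      rw [abs_sub_comm, abs_of_nonneg (by linarith)]; linarith
    calc 2 * Real.pi * M * |1 - k * η| * |H| ≤ 2 * Real.pi * 8 * k * K₂ := by gcongr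
      _ = _ := by ring
  have t2 : |η * M * (l' - k * l)| ≤ 8 * Real.log (4 * 2 ^ k) := by
    rw [abs_mul, abs_of_pos (by positivity : 0 < η * M)]
    calc η * M * |l' - k * l| ≤ 1 * 8 * Real.log (4 * 2 ^ k) := by
          gcongr
          exact hη.eta_le
      _ = _ := by ring
  have t3 : |P₁ - (2 * Real.pi * M * H - M * l)| ≤ K₁ :=
    b1.trans (mul_le_of_le_one_right hK₁.le b5)
  have t4 : |η * (P₂ - (2 * Real.pi * M * k * H - M * l'))| ≤ K₁ := by
    rw [abs_mul, abs_of_pos hη0]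
    calc η * |P₂ - (2 * Real.pi * M * k * H - M * l')| ≤ 1 * K₁ := by
          gcongr
          · exact hη.eta_le
          · exact b1'.trans (mul_le_of_le_one_right hK₁.le b6)
      _ = _ := one_mul _
  have t5 : |M * (k * η - 1) * l| = M * (k * η - 1) * |l| := by
    rw [abs_mul, abs_of_nonneg (mul_nonneg hM0.le (by linarith))]
  rw [e1]
  refine (abs_add_three _ _ _).trans ?_
  have s1 := abs_add_three (u - (P₁ - η * P₂)) (η * M * (l' - k * l))
    (2 * Real.pi * M * (1 - k * η) * H)
  have s2 := abs_sub (P₁ - (2 * Real.pi * M * H - M * l))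
    (η * (P₂ - (2 * Real.pi * M * k * H - M * l')))
  rw [t5]
  linarith

/-! ### The error in the three regions -/

/-- At an exponentially large distance the density is negligible compared with the weight. -/
lemma eventually_bubbleDensity_le {c K : ℝ} (hc : 0 < c) (hK : 0 < K) :
    ∀ᶠ p : ℝ in atTop, ∀ Y : ℂ, Real.exp (c * p) ≤ K * ‖Y‖ → ∀ δ : ℝ, δ ≤ 1 / 4 →
      |bubbleDensity p Y| ≤ 1 / p ^ 3 * (1 + ‖Y‖ ^ 2) ^ (-(1 + δ)) := by
  obtain ⟨D, hD, hdens⟩ := exists_bubbleDensity_bound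
  filter_upwards [eventually_ge_atTop 1,
    eventually_exp_neg_le hc (show 0 < 1 / (2 * D * K) by positivity) 3] with p hp1 hp Y hY δ hδ
  have hn := norm_nonneg Y
  have h1 : 2 / (1 + ‖Y‖) ≤ 2 * K * Real.exp (-(c * p)) := by
    rw [div_le_iff₀ (by positivity)]
    have h2 : Real.exp (-(c * p)) * Real.exp (c * p) = 1 := by
      rw [← Real.exp_add, neg_add_cancel, Real.exp_zero]
    have h3 : Real.exp (-(c * p)) * Real.exp (c * p) ≤ Real.exp (-(c * p)) * (K * ‖Y‖) :=
      mul_le_mul_of_nonneg_left hY (Real.exp_pos _).le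
    have h4 : 0 < K * Real.exp (-(c * p)) := by positivity
    linarith
  calc |bubbleDensity p Y| ≤ D * (1 + ‖Y‖ ^ 2) ^ (-7 / 4 : ℝ) := hdens p hp1 Y
    _ ≤ D * ((1 + ‖Y‖ ^ 2) ^ (-(1 + δ)) * (2 / (1 + ‖Y‖))) := by
        gcongr; exact rpow_decay_le hδ Y
    _ ≤ D * ((1 + ‖Y‖ ^ 2) ^ (-(1 + δ)) * (2 * K * (1 / (2 * D * K) / p ^ 3))) := by
        gcongr
        exact h1.trans (mul_le_mul_of_nonneg_left hp (by positivity))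
    _ = _ := by field_simp

lemma norm_div_ofReal {b : ℝ} (hb : 0 < b) (w : ℂ) : ‖w / (b : ℂ)‖ = ‖w‖ / b := by
  rw [norm_div, Complex.norm_real, Real.norm_eq_abs, abs_of_pos hb]

lemma rpow_sub_one_mul_smul {t s p : ℝ} (ht : 0 < t) :
    |t * s| ^ (p - 1) * (t * s) = t ^ p * (|s| ^ (p - 1) * s) := by
  rw [abs_mul, abs_of_pos ht, Real.mul_rpow ht.le (abs_nonneg s), Real.rpow_sub_one ht.ne']
  field_simp

/-- The error near the origin, where the ansatz is close to the multiple `p τ` of the bubble. -/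
lemma exists_error_bound_origin {Ω : Set ℂ} (h : IsSmoothBoundedDomain Ω) (h0 : (0 : ℂ) ∈ Ω)
    {k : ℕ} (hk : 0 < k) {c K : ℝ} (hc : 0 < c) (hK : 1 ≤ K) :
    ∃ δ₀ : ℝ, 0 < δ₀ ∧ δ₀ ≤ 1 / 4 ∧ ∃ C : ℝ, 0 < C ∧ ∀ᶠ p : ℝ in atTop, ∀ η : ℝ,
      AdmissibleRatio k c η → ∀ τ α β ρ : ℝ,
      ParamRelations Ω k p η τ α β ρ → Concentrated k c K p η τ α β ρ →
      ∀ x ∈ Ω, ‖x‖ ≤ ρ / 2 → ∀ δ : ℝ, 0 < δ → δ ≤ δ₀ →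
        |error Ω k p η τ α β ρ x| ≤ τ * (C / p ^ 3) *
          (1 / α ^ 2 * (1 + ‖x / (α : ℂ)‖ ^ 2) ^ (-(1 + δ)) +
            k ^ 2 * ‖x‖ ^ (2 * k - 2) / β ^ (2 * k) *
              (1 + ‖(x ^ k - (ρ : ℂ) ^ k) / (β ^ k : ℝ)‖ ^ 2) ^ (-(1 + δ))) := by
  obtain ⟨K', hK', H⟩ := exists_ansatz_bound_origin h h0 hk hc hK
  have hK0 : 0 < K := by linarith
  have hk1 : (1 : ℝ) ≤ k := by exact_mod_cast hk
  obtain ⟨δ₀, hδ₀, hδ₁, C, hC, hbub⟩ := exists_bubble_error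
    (K := K' * (2 + 2 * K) + K) (c₀ := c) (c₁ := c) (X₀ := 1 / 4 + k)
    (by positivity) hc hc (by positivity)
  refine ⟨δ₀, hδ₀, hδ₁, C + 1, by positivity, ?_⟩
  filter_upwards [H, hbub, eventually_gt_atTop 0,
    eventually_bubbleDensity_le hc (show 0 < 2 * K by positivity)]
    with p hH hB hp0 hD η hη τ α β ρ hpar hcon x hx hxρ δ hδ hδδ
  have hτ := hpar.τ_pos
  have hα := hpar.α_pos
  have hβ := hpar.β_pos
  have hρ := hpar.ρ_pos
  have hη0 := hpar.η_pos
  have hβk : 0 < β ^ k := by positivity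
  have hρk : 0 < ρ ^ k := by positivity
  have he := hH η hη τ α β ρ hpar hcon x (subset_closure hx) hxρ
  obtain ⟨-, -, hx3⟩ := half_le_norm_pow_sub hk hρ hxρ
  obtain ⟨E, hE⟩ : ∃ E, E = Real.exp (-(c * p)) := ⟨_, rfl⟩
  have hE0 : 0 < E := hE ▸ Real.exp_pos _
  have hE1 : E ≤ 1 := by
    rw [hE, Real.exp_le_one_iff]; linarith [mul_pos hc hp0]
  obtain ⟨y, hy⟩ : ∃ y, y = x / (α : ℂ) := ⟨_, rfl⟩
  obtain ⟨z, hz⟩ : ∃ z, z = (x ^ k - (ρ : ℂ) ^ k) / ((β ^ k : ℝ) : ℂ) := ⟨_, rfl⟩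
  have hyn : ‖y‖ = ‖x‖ / α := by rw [hy, norm_div_ofReal hα]
  have hzn : ‖z‖ = ‖x ^ k - (ρ : ℂ) ^ k‖ / β ^ k := by rw [hz, norm_div_ofReal hβk]
  have hxy : ‖x‖ = α * ‖y‖ := by rw [hyn]; field_simp
  obtain ⟨e, hedef⟩ : ∃ e, e = ansatz Ω k p η τ α β ρ x / τ - (p + bubbleSum p (x / α)) := ⟨_, rfl⟩
  have c1 := hcon.alpha_le
  have c3 := hcon.rho_le
  have c5 := hcon.alpha_le_rho
  have c6 := hcon.betak_le_rhok
  rw [← hedef, ← hE] at he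
  rw [← hE] at c1 c3 c5 c6
  have hn := norm_nonneg y
  have hxE : ‖x‖ ≤ K * E * ‖y‖ := by rw [hxy]; exact mul_le_mul_of_nonneg_right c1 hn
  have hxρE : ‖x‖ / ρ ≤ K * E * ‖y‖ := by
    rw [div_le_iff₀ hρ, hxy]
    have := mul_le_mul_of_nonneg_right c5 hn
    linarith
  have hq : ‖x‖ / ρ ≤ 1 / 2 := by rw [div_le_iff₀ hρ]; linarith
  have hKE : K * E ≤ K := mul_le_of_le_one_right hK0.le hE1
  have he1 : |e| ≤ K' * (2 + 2 * K) + K := by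
    have : K' * (E + ‖x‖ + ‖x‖ / ρ) ≤ K' * (2 + 2 * K) :=
      mul_le_mul_of_nonneg_left (by linarith) hK'.le
    linarith
  have he2 : |e| ≤ (K' * (2 + 2 * K) + K) * (1 + ‖y‖) * Real.exp (-(c * p)) := by
    rw [← hE]
    have h1 : K' * (E + ‖x‖ + ‖x‖ / ρ) ≤ K' * (E + K * E * ‖y‖ + K * E * ‖y‖) :=
      mul_le_mul_of_nonneg_left (by linarith) hK'.le
    have h2 : (K' * (2 + 2 * K) + K) * (1 + ‖y‖) * E = K' * (E + K * E * ‖y‖ + K * E * ‖y‖)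
      + (K' * E * (1 + 2 * K) + 2 * (K' * E * ‖y‖) + K * (1 + ‖y‖) * E) := by ring
    have h3 : 0 ≤ K' * E * (1 + 2 * K) + 2 * (K' * E * ‖y‖) + K * (1 + ‖y‖) * E := by positivity
    linarith
  have r1 := hη.le_mul
  have r2 := hη.le_rate
  have r3 := hη.rate_le
  have hkη : k * η ≤ k := mul_le_of_le_one_right (by linarith) hη.eta_le
  have hX : 1 / 4 + (k * η - 1) * rate k η ≤ 1 / 4 + k := by
    have : (k * η - 1) * rate k η ≤ k * 1 :=
      mul_le_mul (by linarith) (by linarith) (by linarith) (by linarith)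
    linarith
  have hXe : (4 * (1 / 4 + (k * η - 1) * rate k η) - 1) *
      Real.exp (2 * (1 / 4 + (k * η - 1) * rate k η)) ≤ Real.exp (-c) := by
    refine le_of_eq_of_le ?_ hη.power_lt
    ring_nf
  have hyX : ‖y‖ ≤ Real.exp ((1 / 4 + (k * η - 1) * rate k η) * p + (K' * (2 + 2 * K) + K)) := by
    rw [hyn, div_le_iff₀ hα]
    have h1 := hcon.rho_le_mul
    have h2 : Real.exp ((1 / 4 + (k * η - 1) * rate k η) * p + K) ≤
        Real.exp ((1 / 4 + (k * η - 1) * rate k η) * p + (K' * (2 + 2 * K) + K)) :=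
      Real.exp_le_exp.2 (by linarith [show 0 ≤ K' * (2 + 2 * K) by positivity])
    have h3 := mul_le_mul_of_nonneg_right h2 hα.le
    linarith
  have hmain := hB _ hX hXe y hyX e he1 he2 δ hδ hδδ
  have hzfar : Real.exp (c * p) ≤ 2 * K * ‖z‖ := by
    rw [hzn, ← mul_div_assoc, le_div_iff₀ hβk]
    have h2 : E * Real.exp (c * p) = 1 := by
      rw [hE, ← Real.exp_add, neg_add_cancel, Real.exp_zero]
    have h3 : Real.exp (c * p) * β ^ k ≤ Real.exp (c * p) * (K * E * ρ ^ k) :=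
      mul_le_mul_of_nonneg_left c6 (Real.exp_pos _).le
    have h4 : Real.exp (c * p) * (K * E * ρ ^ k) = K * ρ ^ k * (E * Real.exp (c * p)) := by ring
    rw [h4, h2, mul_one] at h3
    have h5 : 2 * K * (ρ ^ k / 2) ≤ 2 * K * ‖x ^ k - (ρ : ℂ) ^ k‖ :=
      mul_le_mul_of_nonneg_left hx3 (by positivity)
    linarith
  have hzd := hD z hzfar δ (hδδ.trans hδ₁)
  obtain ⟨s, hs⟩ : ∃ s, s = 1 + (bubbleSum p y + e) / p := ⟨_, rfl⟩
  rw [← hs] at hmain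
  have hU : ansatz Ω k p η τ α β ρ x = p * τ * s := by
    rw [hs, hedef, hy]; field_simp; ring
  obtain ⟨G, hG⟩ : ∃ G, G = (k : ℝ) ^ 2 * ‖x‖ ^ (2 * k - 2) / β ^ (2 * k) := ⟨_, rfl⟩
  have hG0 : 0 ≤ G := by rw [hG]; positivity
  have herr : error Ω k p η τ α β ρ x =
      τ / α ^ 2 * (|s| ^ (p - 1) * s - bubbleDensity p y) + τ * η * G * bubbleDensity p z := by
    rw [error, laplacian_ansatz h hk hα hβ hx, hU, rpow_sub_one_mul_smul (by positivity),
      ← hpar.rel₁, ← hy, ← hz, ← hG]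
    ring
  obtain ⟨w₁, hw₁⟩ : ∃ w, w = (1 + ‖y‖ ^ 2) ^ (-(1 + δ)) := ⟨_, rfl⟩
  obtain ⟨w₂, hw₂⟩ : ∃ w, w = (1 + ‖z‖ ^ 2) ^ (-(1 + δ)) := ⟨_, rfl⟩
  have hw₁0 : 0 ≤ w₁ := by rw [hw₁]; positivity
  have hw₂0 : 0 ≤ w₂ := by rw [hw₂]; positivity
  rw [← hw₁] at hmain
  rw [← hw₂] at hzd
  rw [herr, ← hG, ← hy, ← hz, ← hw₁, ← hw₂]
  refine (abs_add_le _ _).trans ?_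
  rw [abs_mul, abs_mul (τ * η * G), abs_of_pos (by positivity : 0 < τ / α ^ 2),
    abs_of_nonneg (by positivity : 0 ≤ τ * η * G)]
  have t1 : τ / α ^ 2 * |(|s| ^ (p - 1) * s - bubbleDensity p y)| ≤ τ / α ^ 2 * (C / p ^ 3 * w₁) :=
    mul_le_mul_of_nonneg_left hmain (by positivity)
  have t2 : τ * η * G * |bubbleDensity p z| ≤ τ * 1 * G * (1 / p ^ 3 * w₂) := by
    gcongr
    exact hη.eta_le
  refine (add_le_add t1 t2).trans ?_
  have e1 : τ * ((C + 1) / p ^ 3) * (1 / α ^ 2 * w₁ + G * w₂) =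
      τ / α ^ 2 * (C / p ^ 3 * w₁) + τ * 1 * G * (1 / p ^ 3 * w₂)
      + (τ / p ^ 3 * (1 / α ^ 2 * w₁) + τ * (C / p ^ 3) * (G * w₂)) := by ring
  rw [e1]
  have : 0 ≤ τ / p ^ 3 * (1 / α ^ 2 * w₁) + τ * (C / p ^ 3) * (G * w₂) := by positivity
  linarith

lemma abs_exp_sub_one_le_mul (t : ℝ) : |Real.exp t - 1| ≤ |t| * Real.exp |t| := by
  have h1 := Real.add_one_le_exp t
  have h2 := Real.add_one_le_exp (-t)
  have h3 : Real.exp t * Real.exp (-t) = 1 := by rw [← Real.exp_add, add_neg_cancel, Real.exp_zero]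
  have h4 := mul_le_mul_of_nonneg_left h2 (Real.exp_pos t).le
  rw [h3] at h4
  have h5 : Real.exp t ≤ Real.exp |t| := Real.exp_le_exp.2 (le_abs_self t)
  have h6 : 1 ≤ Real.exp |t| := Real.one_le_exp (abs_nonneg t)
  have h7 : |t| ≤ |t| * Real.exp |t| := le_mul_of_one_le_right (abs_nonneg t) h6
  have h8 : t * Real.exp t ≤ |t| * Real.exp |t| :=
    mul_le_mul (le_abs_self t) h5 (Real.exp_pos t).le (abs_nonneg t)
  have h9 := neg_abs_le t
  rw [abs_le]
  constructor <;> linarith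

lemma abs_pow_sub_pow_le {a b q : ℝ} (ha : 0 < a) (hb : 0 < b) (hq : q ≤ 1 / 2)
    (h : |Real.log a - Real.log b| ≤ 2 * q) (m : ℕ) :
    |a ^ m - b ^ m| ≤ a ^ m * (2 * m * Real.exp m * q) := by
  have e1 : a ^ m - b ^ m = -(a ^ m * (Real.exp (m * (Real.log b - Real.log a)) - 1)) := by
    have : b ^ m = a ^ m * Real.exp (m * (Real.log b - Real.log a)) := by
      rw [mul_sub, Real.exp_sub, ← Real.log_pow, ← Real.log_pow, Real.exp_log (by positivity),
        Real.exp_log (by positivity)]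
      field_simp
    rw [mul_sub, mul_one, ← this]; ring
  have h1 := abs_exp_sub_one_le_mul (m * (Real.log b - Real.log a))
  have h2 : |m * (Real.log b - Real.log a)| ≤ m * (2 * q) := by
    rw [abs_mul, Nat.abs_cast, abs_sub_comm]
    exact mul_le_mul_of_nonneg_left h (Nat.cast_nonneg m)
  have h3 : (m : ℝ) * (2 * q) ≤ m := by
    have := mul_le_mul_of_nonneg_left (show 2 * q ≤ 1 by linarith) (Nat.cast_nonneg (α := ℝ) m)
    linarith
  rw [e1, abs_neg, abs_mul, abs_of_pos (by positivity : 0 < a ^ m)]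
  refine mul_le_mul_of_nonneg_left (h1.trans ?_) (by positivity)
  calc _ ≤ m * (2 * q) * Real.exp m :=
        mul_le_mul h2 (Real.exp_le_exp.2 (h2.trans h3)) (Real.exp_pos _).le
          ((abs_nonneg _).trans h2)
    _ = _ := by ring

/-- The error near the peaks `x ^ k = ρ ^ k`. The Laplacian carries the factor `‖x‖ ^ (2k - 2)`, and
the power the factor `ρ ^ (2k - 2)`; their difference vanishes to the first order at the peaks. -/
lemma exists_error_bound_circle {Ω : Set ℂ} (h : IsSmoothBoundedDomain Ω) (h0 : (0 : ℂ) ∈ Ω)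
    {k : ℕ} (hk : 0 < k) {c K : ℝ} (hc : 0 < c) (hK : 1 ≤ K) :
    ∃ δ₀ : ℝ, 0 < δ₀ ∧ δ₀ ≤ 1 / 4 ∧ ∃ C : ℝ, 0 < C ∧ ∀ᶠ p : ℝ in atTop, ∀ η : ℝ,
      AdmissibleRatio k c η → ∀ τ α β ρ : ℝ,
      ParamRelations Ω k p η τ α β ρ → Concentrated k c K p η τ α β ρ →
      ∀ x ∈ Ω, ‖x ^ k - (ρ : ℂ) ^ k‖ ≤ ρ ^ k / 2 → ∀ δ : ℝ, 0 < δ → δ ≤ δ₀ →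
        |error Ω k p η τ α β ρ x| ≤ τ * (C / p ^ 3) *
          (1 / α ^ 2 * (1 + ‖x / (α : ℂ)‖ ^ 2) ^ (-(1 + δ)) +
            k ^ 2 * ‖x‖ ^ (2 * k - 2) / β ^ (2 * k) *
              (1 + ‖(x ^ k - (ρ : ℂ) ^ k) / (β ^ k : ℝ)‖ ^ 2) ^ (-(1 + δ))) := by
  obtain ⟨K', hK', H⟩ := exists_ansatz_bound_circle h h0 hk hc hK
  obtain ⟨D, hD0, hdens⟩ := exists_bubbleDensity_bound
  have hK0 : 0 < K := by linarith
  have hk1 : (1 : ℝ) ≤ k := by exact_mod_cast hk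
  obtain ⟨δ₀, hδ₀, hδ₁, C, hC, hbub⟩ := exists_bubble_error
    (K := K' * (2 + 2 * K) + K) (c₀ := c) (c₁ := c) (X₀ := 1 / 4)
    (by positivity) hc hc (by positivity)
  obtain ⟨N, hN⟩ : ∃ N : ℝ, N = 2 * ((2 * k - 2 : ℕ) : ℝ) * Real.exp ((2 * k - 2 : ℕ) : ℝ) :=
    ⟨_, rfl⟩
  have hN0 : 0 ≤ N := by rw [hN]; positivity
  refine ⟨δ₀, hδ₀, hδ₁, C + 1 + N * (1 + C), by positivity, ?_⟩
  filter_upwards [H, hbub, eventually_ge_atTop 1,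
    eventually_bubbleDensity_le hc (show 0 < 2 * K by positivity),
    eventually_exp_neg_le hc (show 0 < 1 / (2 * K * D) by positivity) 3]
    with p hH hB hp1 hD hpe η hη τ α β ρ hpar hcon x hx hxρ δ hδ hδδ
  have hp0 : 0 < p := by linarith
  have hτ := hpar.τ_pos
  have hα := hpar.α_pos
  have hβ := hpar.β_pos
  have hρ := hpar.ρ_pos
  have hη0 := hpar.η_pos
  have hβk : 0 < β ^ k := by positivity
  have hρk : 0 < ρ ^ k := by positivity
  have he := hH η hη τ α β ρ hpar hcon x (subset_closure hx) hxρ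
  have hx3 := half_le_norm_of_norm_pow_sub hk hρ hxρ
  have hxlog := abs_log_norm_sub_log_le hk hρ hxρ
  have hx0 : 0 < ‖x‖ := by linarith
  obtain ⟨E, hE⟩ : ∃ E, E = Real.exp (-(c * p)) := ⟨_, rfl⟩
  have hE0 : 0 < E := hE ▸ Real.exp_pos _
  have hE1 : E ≤ 1 := by
    rw [hE, Real.exp_le_one_iff]; linarith [mul_pos hc hp0]
  obtain ⟨y, hy⟩ : ∃ y, y = x / (α : ℂ) := ⟨_, rfl⟩
  obtain ⟨z, hz⟩ : ∃ z, z = (x ^ k - (ρ : ℂ) ^ k) / ((β ^ k : ℝ) : ℂ) := ⟨_, rfl⟩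
  have hyn : ‖y‖ = ‖x‖ / α := by rw [hy, norm_div_ofReal hα]
  have hzn : ‖z‖ = ‖x ^ k - (ρ : ℂ) ^ k‖ / β ^ k := by rw [hz, norm_div_ofReal hβk]
  obtain ⟨q, hq⟩ : ∃ q, q = ‖x ^ k - (ρ : ℂ) ^ k‖ / ρ ^ k := ⟨_, rfl⟩
  have hq0 : 0 ≤ q := by rw [hq]; positivity
  have hq2 : q ≤ 1 / 2 := by rw [hq, div_le_iff₀ hρk]; linarith
  obtain ⟨e, hedef⟩ : ∃ e, e = -(ansatz Ω k p η τ α β ρ x / τ) / η -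
    (p + bubbleSum p ((x ^ k - (ρ : ℂ) ^ k) / (β ^ k : ℝ))) := ⟨_, rfl⟩
  have c5 := hcon.alpha_le_rho
  have c6 := hcon.betak_le_rhok
  rw [← hedef, ← hE, ← hq] at he
  rw [← hq] at hxlog
  rw [← hE] at c5 c6 hpe
  have hn := norm_nonneg z
  have hqz : q ≤ K * E * ‖z‖ := by
    rw [hq, div_le_iff₀ hρk]
    have h1 : ‖x ^ k - (ρ : ℂ) ^ k‖ = β ^ k * ‖z‖ := by rw [hzn]; field_simp
    have := mul_le_mul_of_nonneg_right c6 hn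
    linarith
  have he1 : |e| ≤ K' * (2 + 2 * K) + K := by
    have : K' * (E + q) ≤ K' * (2 + 2 * K) :=
      mul_le_mul_of_nonneg_left (by linarith) hK'.le
    linarith
  have he2 : |e| ≤ (K' * (2 + 2 * K) + K) * (1 + ‖z‖) * Real.exp (-(c * p)) := by
    rw [← hE]
    have h1 : K' * (E + q) ≤ K' * (E + K * E * ‖z‖) :=
      mul_le_mul_of_nonneg_left (by linarith) hK'.le
    have h2 : (K' * (2 + 2 * K) + K) * (1 + ‖z‖) * E = K' * (E + K * E * ‖z‖)
      + (K' * E * (1 + 2 * K) + 2 * (K' * E * ‖z‖) + K' * E * ‖z‖ * K + K * (1 + ‖z‖) * E) := by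
      ring
    have h3 : 0 ≤ K' * E * (1 + 2 * K) + 2 * (K' * E * ‖z‖) + K' * E * ‖z‖ * K
      + K * (1 + ‖z‖) * E := by positivity
    linarith
  have hX0 : 0 ≤ (k - 1 / η) * rate k η := by
    have h1 : 1 / η ≤ k := by rw [div_le_iff₀ hη0]; linarith [hη.le_mul]
    exact mul_nonneg (by linarith) (by linarith [hη.le_rate])
  have hXe : (4 * (1 / 4 - (k - 1 / η) * rate k η) - 1) *
      Real.exp (2 * (1 / 4 - (k - 1 / η) * rate k η)) ≤ Real.exp (-c) :=
    (mul_nonpos_of_nonpos_of_nonneg (by linarith) (Real.exp_pos _).le).trans (Real.exp_pos _).le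
  have hzX : ‖z‖ ≤ Real.exp ((1 / 4 - (k - 1 / η) * rate k η) * p + (K' * (2 + 2 * K) + K)) := by
    rw [hzn, div_le_iff₀ hβk]
    have h1 := hcon.rhok_le_mul
    have h2 : Real.exp ((1 / 4 - (k - 1 / η) * rate k η) * p + K) ≤
        Real.exp ((1 / 4 - (k - 1 / η) * rate k η) * p + (K' * (2 + 2 * K) + K)) :=
      Real.exp_le_exp.2 (by linarith [show 0 ≤ K' * (2 + 2 * K) by positivity])
    have h3 := mul_le_mul_of_nonneg_right h2 hβk.le
    linarith
  have hmain := hB _ (by linarith) hXe z hzX e he1 he2 δ hδ hδδ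
  have hyfar : Real.exp (c * p) ≤ 2 * K * ‖y‖ := by
    rw [hyn, ← mul_div_assoc, le_div_iff₀ hα]
    have h2 : E * Real.exp (c * p) = 1 := by
      rw [hE, ← Real.exp_add, neg_add_cancel, Real.exp_zero]
    have h3 : Real.exp (c * p) * α ≤ Real.exp (c * p) * (K * E * ρ) :=
      mul_le_mul_of_nonneg_left c5 (Real.exp_pos _).le
    have h4 : Real.exp (c * p) * (K * E * ρ) = K * ρ * (E * Real.exp (c * p)) := by ring
    rw [h4, h2, mul_one] at h3
    have h5 : 2 * K * (ρ / 2) ≤ 2 * K * ‖x‖ := mul_le_mul_of_nonneg_left hx3 (by positivity)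
    linarith
  have hδ4 : δ ≤ 1 / 4 := hδδ.trans hδ₁
  have hyd := hD y hyfar δ hδ4
  obtain ⟨s, hs⟩ : ∃ s, s = 1 + (bubbleSum p z + e) / p := ⟨_, rfl⟩
  rw [← hs] at hmain
  have hU : ansatz Ω k p η τ α β ρ x = -(p * τ * η * s) := by
    rw [hs, hedef, hz]; field_simp; ring
  obtain ⟨P, hP⟩ : ∃ P, P = |s| ^ (p - 1) * s := ⟨_, rfl⟩
  rw [← hP] at hmain
  obtain ⟨G, hG⟩ : ∃ G, G = (k : ℝ) ^ 2 * ‖x‖ ^ (2 * k - 2) / β ^ (2 * k) := ⟨_, rfl⟩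
  obtain ⟨G', hG'⟩ : ∃ G, G = (k : ℝ) ^ 2 * ρ ^ (2 * k - 2) / β ^ (2 * k) := ⟨_, rfl⟩
  have hG0 : 0 ≤ G := by rw [hG]; positivity
  have herr : error Ω k p η τ α β ρ x = -(τ / α ^ 2 * bubbleDensity p y) +
      τ * η * (-(G * (P - bubbleDensity p z)) + (G - G') * P) := by
    rw [error, laplacian_ansatz h hk hα hβ hx, hU, abs_neg, mul_neg,
      rpow_sub_one_mul_smul (by positivity), ← hpar.rel₂, ← hy, ← hz, ← hG, ← hG', ← hP]
    ring
  have hGG : |G - G'| ≤ G * (N * q) := by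
    have h1 := abs_pow_sub_pow_le hx0 hρ hq2 hxlog (2 * k - 2)
    rw [← hN] at h1
    have e1 : G - G' = (k : ℝ) ^ 2 / β ^ (2 * k) * (‖x‖ ^ (2 * k - 2) - ρ ^ (2 * k - 2)) := by
      rw [hG, hG']; ring
    have e2 : G * (N * q) = (k : ℝ) ^ 2 / β ^ (2 * k) * (‖x‖ ^ (2 * k - 2) * (N * q)) := by
      rw [hG]; ring
    rw [e1, e2, abs_mul, abs_of_nonneg (by positivity : 0 ≤ (k : ℝ) ^ 2 / β ^ (2 * k))]
    exact mul_le_mul_of_nonneg_left h1 (by positivity)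
  obtain ⟨w₁, hw₁⟩ : ∃ w, w = (1 + ‖y‖ ^ 2) ^ (-(1 + δ)) := ⟨_, rfl⟩
  obtain ⟨w₂, hw₂⟩ : ∃ w, w = (1 + ‖z‖ ^ 2) ^ (-(1 + δ)) := ⟨_, rfl⟩
  have hw₁0 : 0 ≤ w₁ := by rw [hw₁]; positivity
  have hw₂0 : 0 ≤ w₂ := by rw [hw₂]; positivity
  -- the density decays faster than the weight by the factor `1 / ‖z‖`, which compensates `q`
  have hqd : q * |bubbleDensity p z| ≤ 1 / p ^ 3 * w₂ := by
    have h1 : |bubbleDensity p z| ≤ D * (w₂ * (2 / (1 + ‖z‖))) := by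
      refine (hdens p hp1 z).trans (mul_le_mul_of_nonneg_left ?_ hD0.le)
      rw [hw₂]; exact rpow_decay_le hδ4 z
    have h2 : ‖z‖ * (2 / (1 + ‖z‖)) ≤ 2 := by
      rw [← mul_div_assoc, div_le_iff₀ (by positivity)]; linarith
    calc q * |bubbleDensity p z| ≤ K * E * ‖z‖ * (D * (w₂ * (2 / (1 + ‖z‖)))) := by gcongr
      _ = K * E * D * w₂ * (‖z‖ * (2 / (1 + ‖z‖))) := by ring
      _ ≤ K * E * D * w₂ * 2 := by gcongr
      _ = 2 * K * D * w₂ * E := by ring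
      _ ≤ 2 * K * D * w₂ * (1 / (2 * K * D) / p ^ 3) := by gcongr
      _ = 1 / p ^ 3 * w₂ := by field_simp
  rw [← hw₂] at hmain
  rw [← hw₁] at hyd
  have hqP : q * |P| ≤ (1 + C) / p ^ 3 * w₂ := by
    have h1 : |P| ≤ |bubbleDensity p z| + C / p ^ 3 * w₂ := by
      have := abs_add_le (bubbleDensity p z) (P - bubbleDensity p z)
      rw [add_sub_cancel] at this
      linarith
    have h2 : q * |P| ≤ q * (|bubbleDensity p z| + C / p ^ 3 * w₂) :=
      mul_le_mul_of_nonneg_left h1 hq0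
    have h3 : q * (C / p ^ 3 * w₂) ≤ 1 * (C / p ^ 3 * w₂) :=
      mul_le_mul_of_nonneg_right (by linarith) (by positivity)
    rw [add_div, add_mul]
    linarith
  have hin : |-(G * (P - bubbleDensity p z)) + (G - G') * P| ≤
      G * ((C + N * (1 + C)) / p ^ 3 * w₂) := by
    refine (abs_add_le _ _).trans ?_
    rw [abs_neg, abs_mul, abs_mul, abs_of_nonneg hG0]
    have h1 : G * |P - bubbleDensity p z| ≤ G * (C / p ^ 3 * w₂) :=
      mul_le_mul_of_nonneg_left hmain hG0
    have h2 : |G - G'| * |P| ≤ G * (N * q) * |P| := mul_le_mul_of_nonneg_right hGG (abs_nonneg _)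
    have h3 : G * N * (q * |P|) ≤ G * N * ((1 + C) / p ^ 3 * w₂) :=
      mul_le_mul_of_nonneg_left hqP (by positivity)
    have e1 : G * ((C + N * (1 + C)) / p ^ 3 * w₂) =
      G * (C / p ^ 3 * w₂) + G * N * ((1 + C) / p ^ 3 * w₂) := by ring
    rw [e1]
    linarith
  rw [herr, ← hG, ← hy, ← hz, ← hw₁, ← hw₂]
  refine (abs_add_le _ _).trans ?_
  rw [abs_neg, abs_mul, abs_mul (τ * η), abs_of_pos (by positivity : 0 < τ / α ^ 2),
    abs_of_pos (by positivity : 0 < τ * η)]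
  have t1 : τ / α ^ 2 * |bubbleDensity p y| ≤ τ / α ^ 2 * (1 / p ^ 3 * w₁) :=
    mul_le_mul_of_nonneg_left hyd (by positivity)
  have t2 : τ * η * |-(G * (P - bubbleDensity p z)) + (G - G') * P| ≤
      τ * 1 * (G * ((C + N * (1 + C)) / p ^ 3 * w₂)) := by
    gcongr
    exact hη.eta_le
  refine (add_le_add t1 t2).trans ?_
  have e1 : τ * ((C + 1 + N * (1 + C)) / p ^ 3) * (1 / α ^ 2 * w₁ + G * w₂) =
      τ / α ^ 2 * (1 / p ^ 3 * w₁) + τ * 1 * (G * ((C + N * (1 + C)) / p ^ 3 * w₂))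
      + (τ * ((C + N * (1 + C)) / p ^ 3) * (1 / α ^ 2 * w₁) + τ / p ^ 3 * (G * w₂)) := by ring
  rw [e1]
  have : 0 ≤ τ * ((C + N * (1 + C)) / p ^ 3) * (1 / α ^ 2 * w₁) + τ / p ^ 3 * (G * w₂) := by
    positivity
  linarith

/-- The function `σ ↦ σ e^{-2σ}` increases up to `1 / 2`. -/
lemma mul_exp_neg_two_mul_le {σ σ' : ℝ} (h : σ ≤ σ') (h' : σ' ≤ 1 / 2) (h0 : 0 ≤ σ) :
    σ * Real.exp (-(2 * σ)) ≤ σ' * Real.exp (-(2 * σ')) := by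
  have h1 := Real.add_one_le_exp (-(2 * σ') + 2 * σ)
  have e1 : Real.exp (-(2 * σ')) = Real.exp (-(2 * σ)) * Real.exp (-(2 * σ') + 2 * σ) := by
    rw [← Real.exp_add]; ring_nf
  have h2 : σ ≤ σ' * Real.exp (-(2 * σ') + 2 * σ) := by
    have h3 : σ' * (-(2 * σ') + 2 * σ + 1) ≤ σ' * Real.exp (-(2 * σ') + 2 * σ) :=
      mul_le_mul_of_nonneg_left h1 (by linarith)
    nlinarith [mul_nonneg (sub_nonneg.2 h) (show 0 ≤ 1 - 2 * σ' by linarith)]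
  rw [e1, mul_comm σ, mul_left_comm]
  exact mul_le_mul_of_nonneg_left h2 (Real.exp_pos _).le

/-- Comparison of `e^{-2ℓ}` with the weight at a point of modulus at most `D e^ℓ`. -/
lemma exp_neg_le_weight {D ℓ δ m : ℝ} {Y : ℂ} (hD : 1 ≤ D)
    (hδ4 : δ ≤ 1 / 4) (hY : 1 + ‖Y‖ ^ 2 ≤ 2 * D ^ 2 * Real.exp (2 * ℓ)) (hδ : 0 ≤ δ)
    (hm : 2 * δ * ℓ ≤ m) :
    Real.exp (-(2 * ℓ)) ≤ 4 * D ^ 4 * Real.exp m * (1 + ‖Y‖ ^ 2) ^ (-(1 + δ)) := by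
  have hY3 : 0 < 1 + ‖Y‖ ^ 2 := by positivity
  have hD2 : 1 ≤ D ^ 2 := one_le_pow₀ hD
  have h1 : (1 + ‖Y‖ ^ 2) ^ (1 + δ) ≤ 4 * D ^ 4 * Real.exp m * Real.exp (2 * ℓ) := by
    refine (Real.rpow_le_rpow hY3.le hY (by linarith)).trans ?_
    rw [Real.mul_rpow (by positivity) (Real.exp_pos _).le, ← Real.exp_mul]
    have h2 : (2 * D ^ 2) ^ (1 + δ) ≤ 4 * D ^ 4 := by
      calc (2 * D ^ 2) ^ (1 + δ) ≤ (2 * D ^ 2) ^ (2 : ℝ) :=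
            Real.rpow_le_rpow_of_exponent_le (by linarith) (by linarith)
        _ = 4 * D ^ 4 := by rw [Real.rpow_two]; ring
    have h3 : Real.exp (2 * ℓ * (1 + δ)) ≤ Real.exp m * Real.exp (2 * ℓ) := by
      rw [← Real.exp_add]
      exact Real.exp_le_exp.2 (by linarith)
    calc (2 * D ^ 2) ^ (1 + δ) * Real.exp (2 * ℓ * (1 + δ))
        ≤ 4 * D ^ 4 * (Real.exp m * Real.exp (2 * ℓ)) := by gcongr
      _ = _ := by ring
  rw [Real.rpow_neg hY3.le, Real.exp_neg, ← div_eq_mul_inv, le_div_iff₀ (by positivity),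
    ← div_eq_inv_mul, div_le_iff₀ (Real.exp_pos _)]
  exact h1

/-- The base of the power away from all peaks, where `L = max 0 (-log ‖x‖)`, `A = -log α`. -/
lemma far_base_le {c K₁ K₂ X₀ p m r L A θ : ℝ} (hp : 0 < p) (hm : 0 ≤ m) (hmK : 4 * m ≤ K₁)
    (hK₂ : 0 ≤ K₂) (hL : 0 ≤ L) (hLr : L ≤ r * p + K₁) (hr : r + K₁ / p ≤ 1 / 2) (hr0 : 0 ≤ r)
    (hA : A ≤ (1 / 4 + m * r + r) * p + K₁) (hX₀ : 1 / 4 + m * r + r + K₁ ≤ X₀) (hp1 : 1 ≤ p)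
    (hK₁ : 0 ≤ K₁)
    (hθ : θ ≤ 4 * m * (L / p) + K₂ / p)
    (hpow : 4 * m * r * Real.exp (1 / 2 + 2 * m * r) ≤ Real.exp (-c)) :
    θ * Real.exp (2 * ((A - L) / p)) ≤
      Real.exp (-c) + (K₁ * K₁ + K₂) * Real.exp (2 * X₀) / p := by
  have hξ : (A - L) / p ≤ 1 / 4 + m * r + r + K₁ / p - L / p := by
    rw [sub_div]
    have : A / p ≤ 1 / 4 + m * r + r + K₁ / p := by
      rw [div_le_iff₀ hp, add_mul, div_mul_cancel₀ _ hp.ne']; exact hA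
    linarith
  have hKp : K₁ / p ≤ K₁ := div_le_self hK₁ hp1
  have hKp0 : 0 ≤ K₁ / p := by positivity
  have hLp : 0 ≤ L / p := by positivity
  have hLp' : L / p ≤ r + K₁ / p := by
    rw [div_le_iff₀ hp, add_mul, div_mul_cancel₀ _ hp.ne']; exact hLr
  have hmr : 0 ≤ m * r := mul_nonneg hm hr0
  have h1 : Real.exp (2 * ((A - L) / p)) ≤ Real.exp (2 * X₀) := Real.exp_le_exp.2 (by linarith)
  have h2 : Real.exp (2 * ((A - L) / p)) ≤
      Real.exp (1 / 2 + 2 * m * r + 2 * (r + K₁ / p)) * Real.exp (-(2 * (L / p))) := by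
    rw [← Real.exp_add]; exact Real.exp_le_exp.2 (by linarith)
  have h3 := mul_exp_neg_two_mul_le hLp' hr hLp
  have h4 : 4 * m * (L / p) * Real.exp (2 * ((A - L) / p)) ≤
      4 * m * (r + K₁ / p) * Real.exp (1 / 2 + 2 * m * r) := by
    calc 4 * m * (L / p) * Real.exp (2 * ((A - L) / p))
        ≤ 4 * m * (L / p) * (Real.exp (1 / 2 + 2 * m * r + 2 * (r + K₁ / p)) *
          Real.exp (-(2 * (L / p)))) := by gcongr
      _ = 4 * m * Real.exp (1 / 2 + 2 * m * r + 2 * (r + K₁ / p)) *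
          (L / p * Real.exp (-(2 * (L / p)))) := by ring
      _ ≤ 4 * m * Real.exp (1 / 2 + 2 * m * r + 2 * (r + K₁ / p)) *
          ((r + K₁ / p) * Real.exp (-(2 * (r + K₁ / p)))) := by gcongr
      _ = 4 * m * (r + K₁ / p) * (Real.exp (1 / 2 + 2 * m * r + 2 * (r + K₁ / p)) *
          Real.exp (-(2 * (r + K₁ / p)))) := by ring
      _ = _ := by rw [← Real.exp_add]; ring_nf
  have h5 : 4 * m * (K₁ / p) * Real.exp (1 / 2 + 2 * m * r) ≤
      K₁ * (K₁ / p) * Real.exp (2 * X₀) := by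
    gcongr
    linarith
  have h6 : K₂ / p * Real.exp (2 * ((A - L) / p)) ≤ K₂ / p * Real.exp (2 * X₀) := by gcongr
  have h7 := mul_le_mul_of_nonneg_right hθ (Real.exp_pos (2 * ((A - L) / p))).le
  have e1 : (K₁ * K₁ + K₂) * Real.exp (2 * X₀) / p =
      K₁ * (K₁ / p) * Real.exp (2 * X₀) + K₂ / p * Real.exp (2 * X₀) := by ring
  rw [e1]
  rw [add_mul] at h7
  have e2 : 4 * m * (r + K₁ / p) * Real.exp (1 / 2 + 2 * m * r) =
    4 * m * r * Real.exp (1 / 2 + 2 * m * r) + 4 * m * (K₁ / p) * Real.exp (1 / 2 + 2 * m * r) := by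
    ring
  linarith

/-- The error away from all peaks, where the power and both densities are exponentially smaller
than the weight. -/
lemma exists_error_bound_far {Ω : Set ℂ} (h : IsSmoothBoundedDomain Ω) (h0 : (0 : ℂ) ∈ Ω)
    {k : ℕ} (hk : 0 < k) {c K : ℝ} (hc : 0 < c) (hK : 1 ≤ K) :
    ∃ δ₀ : ℝ, 0 < δ₀ ∧ δ₀ ≤ 1 / 4 ∧ ∃ C : ℝ, 0 < C ∧ ∀ᶠ p : ℝ in atTop, ∀ η : ℝ,
      AdmissibleRatio k c η → ∀ τ α β ρ : ℝ,
      ParamRelations Ω k p η τ α β ρ → Concentrated k c K p η τ α β ρ →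
      ∀ x ∈ Ω, ρ / 2 ≤ ‖x‖ → ρ ^ k / 2 ≤ ‖x ^ k - (ρ : ℂ) ^ k‖ → ∀ δ : ℝ, 0 < δ → δ ≤ δ₀ →
        |error Ω k p η τ α β ρ x| ≤ τ * (C / p ^ 3) *
          (1 / α ^ 2 * (1 + ‖x / (α : ℂ)‖ ^ 2) ^ (-(1 + δ)) +
            k ^ 2 * ‖x‖ ^ (2 * k - 2) / β ^ (2 * k) *
              (1 + ‖(x ^ k - (ρ : ℂ) ^ k) / (β ^ k : ℝ)‖ ^ 2) ^ (-(1 + δ))) := by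
  obtain ⟨K', hK', H⟩ := exists_ansatz_bound_far h h0 hk hc hK
  obtain ⟨-, D, -, -, hD1, -, hDx⟩ := exists_norm_bounds h h0
  have hK0 : 0 < K := by linarith
  have hk1 : (1 : ℝ) ≤ k := by exact_mod_cast hk
  have hlD : 0 ≤ Real.log D := Real.log_nonneg hD1
  obtain ⟨F, hF⟩ : ∃ F, F = |C₁| + |C₂| := ⟨_, rfl⟩
  have hF0 : 0 ≤ F := by rw [hF]; positivity
  obtain ⟨K₁, hK₁⟩ : ∃ K₁, K₁ = K + 1 + 4 * k := ⟨_, rfl⟩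
  obtain ⟨K₂, hK₂⟩ : ∃ K₂, K₂ = F * k * (1 + K₁) + 8 * k * Real.log D + K' := ⟨_, rfl⟩
  have hK₁0 : 0 < K₁ := by rw [hK₁]; positivity
  have hK₂0 : 0 < K₂ := by rw [hK₂]; positivity
  refine ⟨min (1 / 4) (c / (8 * (k + 2))), by positivity, min_le_left _ _,
    4 * D ^ 4 * Real.exp K + 1, by positivity, ?_⟩
  filter_upwards [H, eventually_ge_atTop 1, eventually_coeffM_bounds,
    eventually_ge_atTop (K₁ / c),
    eventually_bubbleDensity_le hc (show 0 < 2 * K by positivity),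
    eventually_add_div_mul_exp_le (A := (K₁ * K₁ + K₂) * Real.exp (2 * (k + 2 + K₁))) (B := 0)
      (show c / 2 < c by linarith),
    eventually_exp_neg_le (show 0 < c / 4 by positivity) one_pos 3,
    eventually_exp_neg_le hc (show 0 < 1 / (2 * K) by positivity) 0]
    with p hH hp1 hM hpK hD hbase hpe hpe' η hη τ α β ρ hpar hcon x hx hx1 hx2 δ hδ hδδ
  have hp0 : 0 < p := by linarith
  have hτ := hpar.τ_pos
  have hα := hpar.α_pos
  have hβ := hpar.β_pos
  have hρ := hpar.ρ_pos
  have hη0 := hpar.η_pos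
  have hβk : 0 < β ^ k := by positivity
  have hρk : 0 < ρ ^ k := by positivity
  have hδ4 : δ ≤ 1 / 4 := hδδ.trans (min_le_left _ _)
  have hδc : 8 * (k + 2) * δ ≤ c := by
    have := hδδ.trans (min_le_right _ _)
    rw [le_div_iff₀ (by positivity)] at this
    linarith
  have hu := hH η hη τ α β ρ hpar hcon x (subset_closure hx) hx1 hx2
  have hxD := hDx x (subset_closure hx)
  have hx0 : 0 < ‖x‖ := by linarith
  obtain ⟨y, hy⟩ : ∃ y, y = x / (α : ℂ) := ⟨_, rfl⟩
  obtain ⟨z, hz⟩ : ∃ z, z = (x ^ k - (ρ : ℂ) ^ k) / ((β ^ k : ℝ) : ℂ) := ⟨_, rfl⟩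
  have hyn : ‖y‖ = ‖x‖ / α := by rw [hy, norm_div_ofReal hα]
  have hzn : ‖z‖ = ‖x ^ k - (ρ : ℂ) ^ k‖ / β ^ k := by rw [hz, norm_div_ofReal hβk]
  -- both peaks are at an exponentially large rescaled distance
  have c5 := hcon.alpha_le_rho
  have c6 := hcon.betak_le_rhok
  obtain ⟨E, hE⟩ : ∃ E, E = Real.exp (-(c * p)) := ⟨_, rfl⟩
  have hE0 : 0 < E := hE ▸ Real.exp_pos _
  have hEE : E * Real.exp (c * p) = 1 := by
    rw [hE, ← Real.exp_add, neg_add_cancel, Real.exp_zero]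
  rw [pow_zero, div_one, ← hE, le_div_iff₀ (by positivity)] at hpe'
  rw [← hE] at c5 c6
  have hyfar : Real.exp (c * p) ≤ 2 * K * ‖y‖ := by
    rw [hyn, ← mul_div_assoc, le_div_iff₀ hα]
    have h3 : Real.exp (c * p) * α ≤ Real.exp (c * p) * (K * E * ρ) :=
      mul_le_mul_of_nonneg_left c5 (Real.exp_pos _).le
    have h4 : Real.exp (c * p) * (K * E * ρ) = K * ρ * (E * Real.exp (c * p)) := by ring
    rw [h4, hEE, mul_one] at h3
    have h5 : 2 * K * (ρ / 2) ≤ 2 * K * ‖x‖ := mul_le_mul_of_nonneg_left hx1 (by positivity)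
    linarith
  have hzfar : Real.exp (c * p) ≤ 2 * K * ‖z‖ := by
    rw [hzn, ← mul_div_assoc, le_div_iff₀ hβk]
    have h3 : Real.exp (c * p) * β ^ k ≤ Real.exp (c * p) * (K * E * ρ ^ k) :=
      mul_le_mul_of_nonneg_left c6 (Real.exp_pos _).le
    have h4 : Real.exp (c * p) * (K * E * ρ ^ k) = K * ρ ^ k * (E * Real.exp (c * p)) := by ring
    rw [h4, hEE, mul_one] at h3
    have h5 : 2 * K * (ρ ^ k / 2) ≤ 2 * K * ‖x ^ k - (ρ : ℂ) ^ k‖ :=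
      mul_le_mul_of_nonneg_left hx2 (by positivity)
    linarith
  have hyd := hD y hyfar δ hδ4
  have hzd := hD z hzfar δ hδ4
  have hy1 : 1 ≤ ‖y‖ := by
    rw [hyn, le_div_iff₀ hα]
    have : K * E * ρ ≤ 1 / 2 * ρ := mul_le_mul_of_nonneg_right (by linarith) hρ.le
    linarith
  -- the logarithms
  obtain ⟨l, hl⟩ : ∃ l, l = Real.log ‖x‖ := ⟨_, rfl⟩
  obtain ⟨A, hA⟩ : ∃ A, A = -Real.log α := ⟨_, rfl⟩
  obtain ⟨L, hL⟩ : ∃ L, L = max 0 (-l) := ⟨_, rfl⟩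
  have hL0 : 0 ≤ L := by rw [hL]; exact le_max_left _ _
  have hlL : -l ≤ L := by rw [hL]; exact le_max_right _ _
  have hlD' : l ≤ Real.log D := by rw [hl]; exact Real.log_le_log hx0 hxD
  have hlL2 : l ≤ -L + Real.log D := by
    rw [hL]
    rcases le_total 0 (-l) with h1 | h1
    · rw [max_eq_right h1]; linarith
    · rw [max_eq_left h1]; linarith
  have habs : |l| ≤ L + Real.log D := by rw [abs_le]; constructor <;> linarith
  obtain ⟨r, hr⟩ : ∃ r, r = rate k η := ⟨_, rfl⟩
  have r1 := hη.le_mul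
  have r2 := hη.le_rate
  have r3 := hη.rate_le
  have r4 := hη.power_lt
  have hR := hcon.neg_log_rho_le
  have hAa := hcon.neg_log_alpha_le
  rw [← hr] at r2 r3 r4 hR hAa
  rw [← hA] at hAa
  obtain ⟨m, hm⟩ : ∃ m, m = k * η - 1 := ⟨_, rfl⟩
  have hmk : m ≤ k := by
    have := mul_le_of_le_one_right (by linarith : (0 : ℝ) ≤ k) hη.eta_le
    rw [hm]; linarith
  rw [← hm] at r1 r4 hu
  have hm0 : 0 ≤ m := by linarith
  have hr0 : 0 < r := by linarith
  have hlr : L ≤ r * p + K₁ := by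
    rw [hL]
    refine max_le (by positivity) ?_
    have h1 := Real.log_le_log (by positivity) hx1
    rw [Real.log_div hρ.ne' two_ne_zero, ← hl] at h1
    have h2 := Real.log_two_lt_d9
    rw [hK₁]
    linarith
  have hrh : r + K₁ / p ≤ 1 / 2 := by
    have : K₁ / p ≤ c := by
      rw [div_le_iff₀ hp0]; rw [div_le_iff₀ hc] at hpK; linarith
    linarith
  have hrm : m * r + r ≤ k + 1 := by
    have : m * r ≤ k * 1 := mul_le_mul hmk (by linarith) hr0.le (by linarith)
    linarith
  have hrate : 1 / 4 + k * η * r = 1 / 4 + m * r + r := by rw [hm]; ring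
  rw [hrate] at hAa
  -- the base of the power
  obtain ⟨M, hMdef⟩ : ∃ M, M = coeffM p := ⟨_, rfl⟩
  have hM4 := abs_coeffM_sub_le hp1
  rw [← hMdef] at hM hu hM4
  rw [← hF] at hM4
  rw [← hl] at hu
  obtain ⟨θ, hθ⟩ : ∃ θ, θ = |ansatz Ω k p η τ α β ρ x| / (p * τ) := ⟨_, rfl⟩
  have hθ0 : 0 ≤ θ := by rw [hθ]; positivity
  have hθp : θ ≤ 4 * m * (L / p) + K₂ / p := by
    have e1 : θ = |ansatz Ω k p η τ α β ρ x| / τ / p := by rw [hθ]; field_simp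
    rw [e1, ← mul_div_assoc, ← add_div]
    refine div_le_div_of_nonneg_right (hu.trans ?_) hp0.le
    have h1 : M * m * |l| ≤ M * m * (L + Real.log D) :=
      mul_le_mul_of_nonneg_left habs (mul_nonneg hM.1.le hm0)
    have h2 : M * m * Real.log D ≤ 8 * k * Real.log D :=
      mul_le_mul_of_nonneg_right (mul_le_mul hM.2 hmk hm0 (by norm_num)) hlD
    have h3 : (M - 4) * (m * L) ≤ F * k * (1 + K₁) := by
      have h4 : M - 4 ≤ F / p := (le_abs_self _).trans hM4
      have h5 : L ≤ (1 + K₁) * p := by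
        have : r * p ≤ 1 * p := mul_le_mul_of_nonneg_right (by linarith) hp0.le
        have : K₁ ≤ K₁ * p := le_mul_of_one_le_right hK₁0.le hp1
        linarith
      calc (M - 4) * (m * L) ≤ F / p * (m * L) :=
            mul_le_mul_of_nonneg_right h4 (mul_nonneg hm0 hL0)
        _ ≤ F / p * (k * ((1 + K₁) * p)) := by gcongr
        _ = F * k * (1 + K₁) := by field_simp
    rw [hK₂]
    have e2 : M * m * (L + Real.log D) = 4 * m * L + (M - 4) * (m * L) + M * m * Real.log D := by
      ring
    linarith
  have hb1 := far_base_le (A := A) (X₀ := k + 2 + K₁) hp0 hm0 (by rw [hK₁]; linarith) hK₂0.le hL0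
    hlr hrh hr0.le (by rw [hK₁]; linarith) (by linarith) hp1 hK₁0.le hθp r4
  rw [zero_div, Real.exp_zero, mul_one] at hbase
  have hpow := rpow_le_of_mul_exp_le hθ0 hp0 (hb1.trans hbase)
  rw [div_mul_cancel₀ _ hp0.ne'] at hpow
  have hYle : 1 + ‖y‖ ^ 2 ≤ 2 * D ^ 2 * Real.exp (2 * (A - L)) := by
    have h1 : ‖y‖ ≤ D * Real.exp (A - L) := by
      have h2 : ‖y‖ = Real.exp (l + A) := by
        rw [hyn, hl, hA, ← sub_eq_add_neg, Real.exp_sub, Real.exp_log hx0, Real.exp_log hα]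
      rw [h2, ← Real.exp_log (show 0 < D by linarith), ← Real.exp_add]
      exact Real.exp_le_exp.2 (by linarith)
    have h2 : ‖y‖ ^ 2 ≤ (D * Real.exp (A - L)) ^ 2 := pow_le_pow_left₀ (norm_nonneg _) h1 2
    have h3 : (D * Real.exp (A - L)) ^ 2 = D ^ 2 * Real.exp (2 * (A - L)) := by
      rw [mul_pow, ← Real.exp_nat_mul]; norm_num
    have h4 : 1 ≤ ‖y‖ ^ 2 := one_le_pow₀ hy1
    linarith
  have hwt := exp_neg_le_weight (m := c / 4 * p + K) hD1 hδ4 hYle hδ.le (by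
    have h1 : A - L ≤ (k + 2) * p + K := by
      have : (1 / 4 + m * r + r) * p ≤ (k + 2) * p :=
        mul_le_mul_of_nonneg_right (by linarith) hp0.le
      linarith
    have h2 : 2 * δ * (A - L) ≤ 2 * δ * ((k + 2) * p + K) :=
      mul_le_mul_of_nonneg_left h1 (by linarith)
    have h3 : 8 * (k + 2) * δ * p ≤ c * p := mul_le_mul_of_nonneg_right hδc hp0.le
    have h4 : δ * K ≤ 1 / 4 * K := mul_le_mul_of_nonneg_right hδ4 hK0.le
    linarith)
  obtain ⟨w₁, hw₁⟩ : ∃ w, w = (1 + ‖y‖ ^ 2) ^ (-(1 + δ)) := ⟨_, rfl⟩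
  obtain ⟨w₂, hw₂⟩ : ∃ w, w = (1 + ‖z‖ ^ 2) ^ (-(1 + δ)) := ⟨_, rfl⟩
  have hw₁0 : 0 ≤ w₁ := by rw [hw₁]; positivity
  have hw₂0 : 0 ≤ w₂ := by rw [hw₂]; positivity
  rw [← hw₁] at hwt hyd
  rw [← hw₂] at hzd
  have hθw : θ ^ p ≤ 4 * D ^ 4 * Real.exp K / p ^ 3 * w₁ := by
    calc θ ^ p ≤ Real.exp (-(c / 2 * p)) * Real.exp (-(2 * (A - L))) := hpow
      _ ≤ Real.exp (-(c / 2 * p)) * (4 * D ^ 4 * Real.exp (c / 4 * p + K) * w₁) := by gcongr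
      _ = 4 * D ^ 4 * Real.exp K * w₁ * Real.exp (-(c / 4 * p)) := by
          rw [show -(c / 4 * p) = -(c / 2 * p) + c / 4 * p by ring, Real.exp_add, Real.exp_add]
          ring
      _ ≤ 4 * D ^ 4 * Real.exp K * w₁ * (1 / p ^ 3) := by gcongr
      _ = _ := by ring
  have hUp : abs (|ansatz Ω k p η τ α β ρ x| ^ (p - 1) * ansatz Ω k p η τ α β ρ x) =
      τ / α ^ 2 * θ ^ p := by
    have e1 : |ansatz Ω k p η τ α β ρ x| = p * τ * θ := by rw [hθ]; field_simp
    rw [abs_rpow_sub_one_mul hp0, e1, Real.mul_rpow (by positivity) hθ0, hpar.rel₁]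
  obtain ⟨G, hG⟩ : ∃ G, G = (k : ℝ) ^ 2 * ‖x‖ ^ (2 * k - 2) / β ^ (2 * k) := ⟨_, rfl⟩
  have hG0 : 0 ≤ G := by rw [hG]; positivity
  rw [error, laplacian_ansatz h hk hα hβ hx, ← hG, ← hy, ← hz, ← hw₁, ← hw₂]
  refine (abs_add_le _ _).trans ?_
  rw [hUp]
  have t0 := abs_add_le (-(τ / α ^ 2 * bubbleDensity p y)) (τ * η * G * bubbleDensity p z)
  rw [abs_neg, abs_mul, abs_mul (τ * η * G), abs_of_pos (by positivity : 0 < τ / α ^ 2),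
    abs_of_nonneg (by positivity : 0 ≤ τ * η * G)] at t0
  have t1 : τ / α ^ 2 * |bubbleDensity p y| ≤ τ / α ^ 2 * (1 / p ^ 3 * w₁) :=
    mul_le_mul_of_nonneg_left hyd (by positivity)
  have t2 : τ * η * G * |bubbleDensity p z| ≤ τ * 1 * G * (1 / p ^ 3 * w₂) := by
    gcongr
    exact hη.eta_le
  have t3 : τ / α ^ 2 * θ ^ p ≤ τ / α ^ 2 * (4 * D ^ 4 * Real.exp K / p ^ 3 * w₁) :=
    mul_le_mul_of_nonneg_left hθw (by positivity)
  have e1 : τ * ((4 * D ^ 4 * Real.exp K + 1) / p ^ 3) * (1 / α ^ 2 * w₁ + G * w₂) =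
      τ / α ^ 2 * (1 / p ^ 3 * w₁) + τ * 1 * G * (1 / p ^ 3 * w₂)
      + τ / α ^ 2 * (4 * D ^ 4 * Real.exp K / p ^ 3 * w₁)
      + τ * (4 * D ^ 4 * Real.exp K / p ^ 3) * (G * w₂) := by ring
  rw [e1]
  have : 0 ≤ τ * (4 * D ^ 4 * Real.exp K / p ^ 3) * (G * w₂) := by positivity
  linarith

/-! ### The weighted norm -/

lemma weight_eq {k : ℕ} {δ α β ρ : ℝ} (hα : 0 < α) (hβ : 0 < β) (x : ℂ) :
    weight k δ α β ρ x = 1 / α ^ 2 * (1 + ‖x / (α : ℂ)‖ ^ 2) ^ (-(1 + δ)) +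
      ‖x‖ ^ (2 * k - 2) / β ^ (2 * k) *
        (1 + ‖(x ^ k - (ρ : ℂ) ^ k) / (β ^ k : ℝ)‖ ^ 2) ^ (-(1 + δ)) := by
  have key : ∀ {b n : ℝ}, 0 < b → 0 ≤ n → b ^ (2 * δ) / (n ^ 2 + b ^ 2) ^ (1 + δ) =
      1 / b ^ 2 * (1 + (n / b) ^ 2) ^ (-(1 + δ)) := by
    intro b n hb hn
    have e1 : n ^ 2 + b ^ 2 = b ^ 2 * (1 + (n / b) ^ 2) := by field_simp; ring
    have e2 : (b ^ 2) ^ (1 + δ) = b ^ 2 * b ^ (2 * δ) := by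
      rw [Real.rpow_add (by positivity), Real.rpow_one, ← Real.rpow_natCast b 2,
        ← Real.rpow_mul hb.le]
      norm_num
    rw [e1, Real.mul_rpow (by positivity) (by positivity), e2, Real.rpow_neg (by positivity)]
    field_simp
  have hβk : 0 < β ^ k := by positivity
  have e3 : β ^ (2 * k * δ) = (β ^ k) ^ (2 * δ) := by
    rw [← Real.rpow_natCast β k, ← Real.rpow_mul hβ.le]; ring_nf
  have e4 : β ^ (2 * k) = (β ^ k) ^ 2 := by rw [← pow_mul, mul_comm]
  rw [weight, norm_div_ofReal hα, norm_div_ofReal hβk, key hα (norm_nonneg x), e3, e4,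
    mul_div_right_comm, key hβk (norm_nonneg _)]
  ring

lemma exists_error_bound {Ω : Set ℂ} (h : IsSmoothBoundedDomain Ω) (h0 : (0 : ℂ) ∈ Ω)
    {k : ℕ} (hk : 0 < k) {c : ℝ} (hc : 0 < c) :
    ∃ C δ : ℝ, 0 < C ∧ 0 < δ ∧ δ < 1 ∧ ∀ᶠ p : ℝ in atTop, ∀ η : ℝ,
      AdmissibleRatio k c η → ∀ τ α β ρ : ℝ, ParamRelations Ω k p η τ α β ρ →
      ∀ x ∈ Ω, |error Ω k p η τ α β ρ x| ≤ C / p ^ 4 * weight k δ α β ρ x := by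
  obtain ⟨K, hK, HK⟩ := exists_concentrated Ω hk hc
  obtain ⟨δ₁, hδ₁, hδ₁', C₁, hC₁, H₁⟩ := exists_error_bound_origin h h0 hk hc hK
  obtain ⟨δ₂, hδ₂, -, C₂, hC₂, H₂⟩ := exists_error_bound_circle h h0 hk hc hK
  obtain ⟨δ₃, hδ₃, -, C₃, hC₃, H₃⟩ := exists_error_bound_far h h0 hk hc hK
  have hK0 : 0 < K := by linarith
  have hk1 : (1 : ℝ) ≤ k := by exact_mod_cast hk
  obtain ⟨C, hC⟩ : ∃ C, C = C₁ + C₂ + C₃ := ⟨_, rfl⟩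
  have hC0 : 0 < C := by rw [hC]; positivity
  refine ⟨K * C * k ^ 2, min δ₁ (min δ₂ δ₃), by positivity, by positivity,
    (min_le_left _ _).trans_lt (by linarith), ?_⟩
  obtain ⟨δ, hδdef⟩ : ∃ δ, δ = min δ₁ (min δ₂ δ₃) := ⟨_, rfl⟩
  have hδ : 0 < δ := by rw [hδdef]; positivity
  have l1 : δ ≤ δ₁ := hδdef.le.trans (min_le_left _ _)
  have l2 : δ ≤ δ₂ := hδdef.le.trans ((min_le_right _ _).trans (min_le_left _ _))
  have l3 : δ ≤ δ₃ := hδdef.le.trans ((min_le_right _ _).trans (min_le_right _ _))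
  rw [← hδdef]
  filter_upwards [HK, H₁, H₂, H₃, eventually_gt_atTop 0]
    with p hp h1 h2 h3 hp0 η hη τ α β ρ hpar x hx
  have hcon := hp η hη τ α β ρ hpar
  have hα := hpar.α_pos
  have hβ := hpar.β_pos
  have hτ := hpar.τ_pos
  have hβk : 0 < β ^ (2 * k) := by positivity
  obtain ⟨w₁, hw₁⟩ : ∃ w, w = (1 + ‖x / (α : ℂ)‖ ^ 2) ^ (-(1 + δ)) := ⟨_, rfl⟩
  obtain ⟨w₂, hw₂⟩ : ∃ w, w = (1 + ‖(x ^ k - (ρ : ℂ) ^ k) / (β ^ k : ℝ)‖ ^ 2) ^ (-(1 + δ)) :=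
    ⟨_, rfl⟩
  have hw₁0 : 0 ≤ w₁ := by rw [hw₁]; positivity
  have hw₂0 : 0 ≤ w₂ := by rw [hw₂]; positivity
  obtain ⟨S, hS⟩ : ∃ S, S = 1 / α ^ 2 * w₁ + k ^ 2 * ‖x‖ ^ (2 * k - 2) / β ^ (2 * k) * w₂ :=
    ⟨_, rfl⟩
  have hS0 : 0 ≤ S := by rw [hS]; positivity
  have hSw : S ≤ k ^ 2 * weight k δ α β ρ x := by
    rw [weight_eq hα hβ, ← hw₁, ← hw₂, hS]
    have : 1 * (1 / α ^ 2 * w₁) ≤ k ^ 2 * (1 / α ^ 2 * w₁) :=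
      mul_le_mul_of_nonneg_right (one_le_pow₀ hk1) (by positivity)
    have e1 : (k : ℝ) ^ 2 * (1 / α ^ 2 * w₁ + ‖x‖ ^ (2 * k - 2) / β ^ (2 * k) * w₂) =
      k ^ 2 * (1 / α ^ 2 * w₁) + k ^ 2 * ‖x‖ ^ (2 * k - 2) / β ^ (2 * k) * w₂ := by ring
    linarith
  have main : |error Ω k p η τ α β ρ x| ≤ τ * (C / p ^ 3) * S := by
    have hmono : ∀ {C' : ℝ}, C' ≤ C → τ * (C' / p ^ 3) * S ≤ τ * (C / p ^ 3) * S := fun h => by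
      gcongr
    rcases le_total ‖x‖ (ρ / 2) with hx1 | hx1
    · have := h1 η hη τ α β ρ hpar hcon x hx hx1 δ hδ l1
      rw [← hw₁, ← hw₂, ← hS] at this
      exact this.trans (hmono (by linarith))
    · rcases le_total ‖x ^ k - (ρ : ℂ) ^ k‖ (ρ ^ k / 2) with hx2 | hx2
      · have := h2 η hη τ α β ρ hpar hcon x hx hx2 δ hδ l2
        rw [← hw₁, ← hw₂, ← hS] at this
        exact this.trans (hmono (by linarith))
      · have := h3 η hη τ α β ρ hpar hcon x hx hx1 hx2 δ hδ l3
        rw [← hw₁, ← hw₂, ← hS] at this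
        exact this.trans (hmono (by linarith))
  calc |error Ω k p η τ α β ρ x| ≤ τ * (C / p ^ 3) * S := main
    _ ≤ K / p * (C / p ^ 3) * (k ^ 2 * weight k δ α β ρ x) := by
        gcongr
        exact hcon.tau_le
    _ = _ := by ring

end LaneEmden

end

theorem proposition3p1 (k : ℕ) (hk : k = 4 ∨ k = 5) :
    ∃ ε : ℝ, 0 < ε ∧
      ∀ Ω : Set ℂ, LaneEmden.IsSmoothBoundedDomain Ω → (0 : ℂ) ∈ Ω →
        LaneEmden.ReflectionInvariant Ω → LaneEmden.RotationInvariant k Ω →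
        ∃ C δ p₀ : ℝ, 0 < C ∧ 0 < δ ∧ δ < 1 ∧ 1 < p₀ ∧
          ∀ p : ℝ, p₀ < p →
          ∀ η : ℝ, 2 / ((k : ℝ) - 1) - ε ≤ η → η ≤ 2 / ((k : ℝ) - 1) + ε →
          ∀ τ α β ρ : ℝ, LaneEmden.ParamRelations Ω k p η τ α β ρ →
            LaneEmden.starNorm Ω k δ α β ρ (LaneEmden.error Ω k p η τ α β ρ)
              ≤ ENNReal.ofReal (C / p ^ 4) := by
  obtain ⟨ε, hε, hη⟩ := LaneEmden.exists_admissibleRatio hk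
  refine ⟨ε, hε, fun Ω h h0 _ _ => ?_⟩
  have hk0 : 0 < k := by omega
  obtain ⟨C, δ, hC, hδ, hδ1, H⟩ :=
    LaneEmden.exists_error_bound h h0 hk0 (show (0 : ℝ) < 1 / 100 by norm_num)
  obtain ⟨p₁, hp₁⟩ := Filter.eventually_atTop.1 H
  refine ⟨C, δ, max p₁ 2, hC, hδ, hδ1, lt_max_of_lt_right one_lt_two,
    fun p hp η h1 h2 τ α β ρ hpar => ?_⟩
  have hpp := hp₁ p ((le_max_left _ _).trans hp.le) η (hη η h1 h2) τ α β ρ hpar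
  refine iSup₂_le fun x hx => ENNReal.ofReal_le_ofReal ?_
  have hw : 0 < LaneEmden.weight k δ α β ρ x := by
    rw [LaneEmden.weight_eq hpar.α_pos hpar.β_pos]
    have hα := hpar.α_pos
    have hβ := hpar.β_pos
    positivity
  rw [abs_div, abs_of_pos hw, div_le_iff₀ hw]
  exact hpp x hx
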